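/- Let $n\ge 0$ be an integer, $q=e^{\pi i s}$ with $0<s<2$, and for real $x$ put $q^x=e^{\pi i s x}$ and $[x]=\frac{\sin(\pi s x)}{\sin(\pi s)}$. Let $U_q(\mathfrak{gl}_n)$ be the $\mathbb C$-algebra with generators $e_m,f_m$ ($1\le m<n$) and $t_i^{\pm1}$ ($1\le i\le n$) and relations: $t_it_i^{-1}=t_i^{-1}t_i=1$, $t_it_j=t_jt_i$, $t_ie_m=q^{\delta_{i,m}-\delta_{i,m+1}}e_mt_i$, $t_if_m=q^{-\delta_{i,m}+\delta_{i,m+1}}f_mt_i$, $e_mf_l-f_le_m=\delta_{m,l}\frac{t_mt_{m+1}^{-1}-t_m^{-1}t_{m+1}}{q-q^{-1}}$, $e_me_l=e_le_m$ and $f_mf_l=f_lf_m$ for $|m-l|>1$, and $e_m^2e_l-(q+q^{-1})e_me_le_m+e_le_m^2=0$, $f_m^2f_l-(q+q^{-1})f_mf_lf_m+f_lf_m^2=0$ for $|m-l|=1$. Let $\lambda=(\lambda_1,\dots,\lambda_n)\in\mathbb R^n$, and let $M(\lambda)$ be the Verma module, the quotient of $U_q(\mathfrak{gl}_n)$ by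 the left ideal generated by all $e_m$ and all $t_i-q^{\lambda_i}$; let $v_\lambda$ be the image of $1$. For $\mu\in\lambda+\mathbb Z^n$ let $M(\lambda)_\mu$ be the space of $v\in M(\lambda)$ with $t_iv=q^{\mu_i}v$ for all $i$. Assume that $q$ and $\lambda$ are generic: $s$ is irrational, and $s(\lambda_i-\lambda_j+k)\notin\mathbb Z$ for all $i\ne j$ and all $k\in\mathbb Z$. Then there is exactly one Hermitian form $(\cdot,\cdot)$ on $M(\lambda)$ such that $(e_mv,w)=(v,f_mw)$ and $(t_iv,w)=(v,t_i^{-1}w)$ for all $m$, $i$, $v$, $w$, and $(v_\lambda,v_\lambda)=1$. It is non-degenerate, $M(\lambda)=\bigoplus_{\mu\in\lambda+\mathbb Z^n}M(\lambda)_\mu$, each $M(\lambda)_\mu$ is finite-dimensional and has an orthogonal basis, and the signature $s(M(\lambda)_\mu)$ (the number of vectors of positive norm minus the number of vectors of negative norm in an orthogonal basis) does not depend on the orthogonal basis. The signature character $ch_s(M(\lambda))=\sum_\mu s(M(\lambda)_\mu)e^\mu$ is $$ch_s(M(\lambda))=\sum_{\Lambda\in A(\lambda)}\tilde s_q(\zeta_\Lambda)\,e^{\mathrm{wt}(\zeta_\Lambda)}.$$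 Here $A(\lambda)$ is the set of real arrays $\Lambda=(\lambda_{m,i})_{1\le i\le m\le n}$ with $\lambda_{n,i}=\lambda_i$ for all $i$ and $\lambda_{m,i}-\lambda_{m-1,i}\in\mathbb Z_{\ge0}$ for $1\le i<m\le n$ (no interlacing condition). The weight $\mathrm{wt}(\zeta_\Lambda)\in\mathbb R^n$ has $k$-th coordinate $\sum_{i=1}^{k}\lambda_{k,i}-\sum_{i=1}^{k-1}\lambda_{k-1,i}$, and each weight is attained by finitely many $\Lambda\in A(\lambda)$. With $\nu_{m,i}=i-\lambda_{m,i}-1$, $\nu_i=i-\lambda_i-1$, $d_{m,i}=\lambda_i-\lambda_{m,i}\in\mathbb Z_{\ge0}$, $[x]^{(d)}=[x][x-1]\cdots[x-d+1]$ ($d$ factors), and $\{x\}\in\{\pm1\}$ denoting the sign of a nonzero real number $x$, $$\tilde s_q(\zeta_\Lambda)=\prod_{1\le i\le m<n}\Big\{\prod_{i<j\le m}[\nu_{m,j}-\nu_{m,i}][\nu_{m,j}-\nu_i]\Big\}\Big\{[\nu_{m,i}-\nu_i]^{(d_{m,i})}\Big\}\Big\{\prod_{i<j\le m+1}[\nu_{m+1,j}-\nu_i-1]^{(d_{m,i})}\Big\}\Big\{\prod_{i\le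 j\le m-1}[\nu_{m-1,j}-\nu_i]^{(d_{m,i})}\Big\},$$ and all the numbers in braces are nonzero, so that $\tilde s_q(\zeta_\Lambda)=\pm1$. -/

import Mathlib

open scoped ComplexConjugate

noncomputable section

namespace UqGl

/-! ### The quantum group -/

/-- Generators of `U_q(gl_n)`: `e_m, f_m` (`n - 1` of each) and `t_i, t_i⁻¹` (`n` of each). -/
inductive Gen (n : ℕ) : Type
  | e (m : Fin (n - 1)) : Gen n
  | f (m : Fin (n - 1)) : Gen n
  | t (i : Fin n) : Gen n
  | tinv (i : Fin n) : Gen n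

/-- The index `m` of a simple root `α_m = ε_m - ε_{m+1}`, seen in `Fin n`. -/
def lo {n : ℕ} (m : Fin (n - 1)) : Fin n := ⟨m.1, by omega⟩

/-- The index `m + 1` of a simple root `α_m = ε_m - ε_{m+1}`, seen in `Fin n`. -/
def hi {n : ℕ} (m : Fin (n - 1)) : Fin n := ⟨m.1 + 1, by omega⟩

/-- The integer `⟨ε_i, α_m⟩`. -/
def pairing {n : ℕ} (i : Fin n) (m : Fin (n - 1)) : ℤ :=
  (if i = lo m then 1 else 0) - (if i = hi m then 1 else 0)

/-- The free generators. -/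
def gen {n : ℕ} (x : Gen n) : FreeAlgebra ℂ (Gen n) := FreeAlgebra.ι ℂ x

/-- The defining relations of `U_q(gl_n)`. -/
inductive Rel (q : ℂ) (n : ℕ) : FreeAlgebra ℂ (Gen n) → FreeAlgebra ℂ (Gen n) → Prop
  | t_tinv (i : Fin n) : Rel q n (gen (.t i) * gen (.tinv i)) 1
  | tinv_t (i : Fin n) : Rel q n (gen (.tinv i) * gen (.t i)) 1
  | t_t (i j : Fin n) : Rel q n (gen (.t i) * gen (.t j)) (gen (.t j) * gen (.t i))
  | t_e (i : Fin n) (m : Fin (n - 1)) :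
      Rel q n (gen (.t i) * gen (.e m)) (q ^ pairing i m • (gen (.e m) * gen (.t i)))
  | t_f (i : Fin n) (m : Fin (n - 1)) :
      Rel q n (gen (.t i) * gen (.f m)) (q ^ (-pairing i m) • (gen (.f m) * gen (.t i)))
  | e_f_same (m : Fin (n - 1)) :
      Rel q n (gen (.e m) * gen (.f m) - gen (.f m) * gen (.e m))
        ((q - q⁻¹)⁻¹ • (gen (.t (lo m)) * gen (.tinv (hi m))
          - gen (.tinv (lo m)) * gen (.t (hi m))))
  | e_f_ne (m l : Fin (n - 1)) (h : m ≠ l) :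
      Rel q n (gen (.e m) * gen (.f l)) (gen (.f l) * gen (.e m))
  | e_e_far (m l : Fin (n - 1)) (h : m.1 + 1 < l.1) :
      Rel q n (gen (.e m) * gen (.e l)) (gen (.e l) * gen (.e m))
  | f_f_far (m l : Fin (n - 1)) (h : m.1 + 1 < l.1) :
      Rel q n (gen (.f m) * gen (.f l)) (gen (.f l) * gen (.f m))
  | e_serre (m l : Fin (n - 1)) (h : m.1 + 1 = l.1 ∨ l.1 + 1 = m.1) :
      Rel q n (gen (.e m) * gen (.e m) * gen (.e l)
        - (q + q⁻¹) • (gen (.e m) * gen (.e l) * gen (.e m))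
        + gen (.e l) * gen (.e m) * gen (.e m)) 0
  | f_serre (m l : Fin (n - 1)) (h : m.1 + 1 = l.1 ∨ l.1 + 1 = m.1) :
      Rel q n (gen (.f m) * gen (.f m) * gen (.f l)
        - (q + q⁻¹) • (gen (.f m) * gen (.f l) * gen (.f m))
        + gen (.f l) * gen (.f m) * gen (.f m)) 0

/-- The quantum group `U_q(gl_n)`, a complex algebra given by generators and relations. -/
abbrev Uq (q : ℂ) (n : ℕ) : Type := RingQuot (Rel q n)

/-- The image of a generator in `U_q(gl_n)`. -/
def el (q : ℂ) {n : ℕ} (x : Gen n) : Uq q n := RingQuot.mkAlgHom ℂ (Rel q n) (gen x)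

/-! ### Verma modules -/

/-- `q ^ x = exp (π i s x)`, for `q = exp (π i s)` and `x` real. -/
def qpow (s x : ℝ) : ℂ := Complex.exp (Real.pi * s * x * Complex.I)

/-- `q = exp (π i s)`. -/
def qOf (s : ℝ) : ℂ := qpow s 1

/-- The left ideal of `U_q(gl_n)` generated by all `e_m` and all `t_i - q ^ λ_i`. -/
def vermaIdeal (s : ℝ) {n : ℕ} (lam : Fin n → ℝ) : Submodule (Uq (qOf s) n) (Uq (qOf s) n) :=
  Submodule.span (Uq (qOf s) n)
    (Set.range (fun m : Fin (n - 1) => el (qOf s) (.e m)) ∪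
      Set.range (fun i : Fin n =>
        el (qOf s) (.t i) - algebraMap ℂ (Uq (qOf s) n) (qpow s (lam i))))

/-- The Verma module `M(λ)`. -/
abbrev Verma (s : ℝ) {n : ℕ} (lam : Fin n → ℝ) : Type := Uq (qOf s) n ⧸ vermaIdeal s lam

/-- The highest weight vector of `M(λ)`. -/
def hwVec (s : ℝ) {n : ℕ} (lam : Fin n → ℝ) : Verma s lam := Submodule.Quotient.mk 1

/-- The subspace of `M(λ)` on which each `t_i` acts by `q ^ μ_i`. -/
def weightSpace (s : ℝ) {n : ℕ} (lam μ : Fin n → ℝ) : Submodule ℂ (Verma s lam) :=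
  ⨅ i : Fin n, Module.End.eigenspace
    (Algebra.lsmul ℂ ℂ (Verma s lam) (el (qOf s) (.t i))) (qpow s (μ i))

/-! ### Hermitian forms and signatures -/

/-- Sesquilinear forms, conjugate-linear in the first variable. -/
abbrev SesqForm (V : Type) [AddCommGroup V] [Module ℂ V] : Type := V →ₗ⋆[ℂ] V →ₗ[ℂ] ℂ

/-- The standard Hermitian form on `M(λ)`: `e_m` and `f_m` are adjoint to each other, `t_i` is
unitary, and the highest weight vector has norm `1`. -/
structure IsStandardForm (s : ℝ) {n : ℕ} (lam : Fin n → ℝ) (B : SesqForm (Verma s lam)) :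
    Prop where
  hermitian : ∀ v w : Verma s lam, B w v = conj (B v w)
  adjoint_e_f : ∀ (m : Fin (n - 1)) (v w : Verma s lam),
    B (el (qOf s) (.e m) • v) w = B v (el (qOf s) (.f m) • w)
  adjoint_t : ∀ (i : Fin n) (v w : Verma s lam),
    B (el (qOf s) (.t i) • v) w = B v (el (qOf s) (.tinv i) • w)
  norm_hwVec : B (hwVec s lam) (hwVec s lam) = 1

/-- No nonzero vector is orthogonal to everything. -/
def IsNondegenerate {V : Type} [AddCommGroup V] [Module ℂ V] (B : SesqForm V) : Prop :=
  ∀ v : V, (∀ w : V, B v w = 0) → v = 0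

/-- `b` is a basis of the subspace `W`, orthogonal with respect to `B`. -/
def IsOrthogonalBasis {V : Type} [AddCommGroup V] [Module ℂ V] (B : SesqForm V)
    (W : Submodule ℂ V) {ι : Type} (b : Module.Basis ι ℂ W) : Prop :=
  ∀ i j : ι, i ≠ j → B (b i : V) (b j : V) = 0

/-- The subspace `W` is finite-dimensional, has an orthogonal basis, and for every orthogonal
basis the number of vectors of positive norm minus the number of vectors of negative norm
is `z`. -/
def HasSignature {V : Type} [AddCommGroup V] [Module ℂ V] (B : SesqForm V)
    (W : Submodule ℂ V) (z : ℤ) : Prop :=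
  FiniteDimensional ℂ W ∧
  (∃ b : Module.Basis (Fin (Module.finrank ℂ W)) ℂ W, IsOrthogonalBasis B W b) ∧
  ∀ b : Module.Basis (Fin (Module.finrank ℂ W)) ℂ W, IsOrthogonalBasis B W b →
    ∑ k, (SignType.sign (B (b k : V) (b k : V)).re : ℤ) = z

/-- The weight `λ + δ`, for an integral vector `δ`. -/
def shift {n : ℕ} (lam : Fin n → ℝ) (δ : Fin n → ℤ) : Fin n → ℝ := fun i => lam i + (δ i : ℝ)

/-- The formal sum `∑_μ c(μ) e^μ` (a function `c` on `ℝ^n`) is the signature character of `M(λ)`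
with respect to the form `B`: the module is the direct sum of its weight spaces `M(λ)_μ`, the
space `M(λ)_μ` has signature `c(μ)`, and no other exponents occur. The degrees `μ` run over the
coset `λ + ℤ^n`: weights are real vectors, and only within one such coset is `μ` determined by
the eigenvalues `q ^ μ_i`. -/
structure HasSignatureCharacter (s : ℝ) {n : ℕ} (lam : Fin n → ℝ) (B : SesqForm (Verma s lam))
    (c : (Fin n → ℝ) → ℤ) : Prop where
  decomposition :
    DirectSum.IsInternal (fun δ : Fin n → ℤ => weightSpace s lam (shift lam δ))
  signature : ∀ δ : Fin n → ℤ,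
    HasSignature B (weightSpace s lam (shift lam δ)) (c (shift lam δ))
  support : ∀ μ : Fin n → ℝ, (∀ δ : Fin n → ℤ, μ ≠ shift lam δ) → c μ = 0

/-! ### Arrays and the sign formula -/

/-- The set `A(λ)` of arrays `Λ = (λ_{m,i})`, `1 ≤ i ≤ m ≤ n` (indices start at `1`; entries
outside this range are set to `0`), with `λ_{n,i} = λ_i` and `λ_{m+1,i} - λ_{m,i} ∈ ℤ_{≥ 0}`. -/
structure GTArray {n : ℕ} (lam : Fin n → ℝ) : Type where
  entry : ℕ → ℕ → ℝ
  entry_outside : ∀ m i : ℕ, ¬ (1 ≤ i ∧ i ≤ m ∧ m ≤ n) → entry m i = 0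
  top : ∀ i : Fin n, entry n (i.1 + 1) = lam i
  step : ∀ m i : ℕ, 1 ≤ i → i ≤ m → m + 1 ≤ n → ∃ k : ℕ, entry (m + 1) i - entry m i = (k : ℝ)

namespace GTArray

variable {n : ℕ} {lam : Fin n → ℝ}

/-- The `k`-th coordinate (starting at `1`) of the weight is
`∑_{i ≤ k} λ_{k,i} - ∑_{i ≤ k-1} λ_{k-1,i}`. -/
def wt (L : GTArray lam) : Fin n → ℝ := fun k =>
  ∑ i ∈ Finset.Icc 1 (k.1 + 1), L.entry (k.1 + 1) i - ∑ i ∈ Finset.Icc 1 k.1, L.entry k.1 i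

/-- `ν_{m,i} = i - λ_{m,i} - 1`. As `λ_{n,i} = λ_i`, the number `ν_i = i - λ_i - 1` is
`ν_{n,i}`. -/
def nu (L : GTArray lam) (m i : ℕ) : ℝ := (i : ℝ) - L.entry m i - 1

/-- `λ_i - λ_{m,i}`, which is a nonnegative integer. -/
def drop (L : GTArray lam) (m i : ℕ) : ℕ := ⌊L.entry n i - L.entry m i⌋₊

end GTArray

/-- `[x] = sin (π s x) / sin (π s)`, the `q`-number of a real `x` for `q = exp (π i s)`. -/
def qnum (s x : ℝ) : ℝ := Real.sin (Real.pi * s * x) / Real.sin (Real.pi * s)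

/-- `[x] [x - 1] ⋯ [x - (d - 1)]`, with `d` factors. -/
def qfall (s x : ℝ) (d : ℕ) : ℝ := ∏ k ∈ Finset.range d, qnum s (x - k)

/-- The sign of a real number, as an integer. -/
def sgn (x : ℝ) : ℤ := (SignType.sign x : ℤ)

/-- The sign `s̃_q(ζ_Λ)`. -/
def stilde (s : ℝ) {n : ℕ} {lam : Fin n → ℝ} (L : GTArray lam) : ℤ :=
  ∏ m ∈ Finset.Ico 1 n, ∏ i ∈ Finset.Icc 1 m,
    (sgn (∏ j ∈ Finset.Ioc i m,
        qnum s (L.nu m j - L.nu m i) * qnum s (L.nu m j - L.nu n i))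
      * sgn (qfall s (L.nu m i - L.nu n i) (L.drop m i))
      * sgn (∏ j ∈ Finset.Ioc i (m + 1),
          qfall s (L.nu (m + 1) j - L.nu n i - 1) (L.drop m i))
      * sgn (∏ j ∈ Finset.Ico i m,
          qfall s (L.nu (m - 1) j - L.nu n i) (L.drop m i)))

/-- The formal sum `∑_{Λ ∈ A(λ)} s̃_q(ζ_Λ) e^{wt(ζ_Λ)}`, as the function that sends `μ` to the
coefficient of `e^μ`. -/
def arraySum (s : ℝ) {n : ℕ} (lam : Fin n → ℝ) (μ : Fin n → ℝ) : ℤ :=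
  ∑ᶠ (L : GTArray lam) (_ : L.wt = μ), stilde s L

end UqGl

end

noncomputable section

namespace UqGl

/-! ### `q`-powers and `q`-numbers -/

/-! The Verma module is realised by explicit Gelfand–Tsetlin formulas. On the free space over
integer arrays `d`, with d_{m,i} = λ_i - λ_{m,i}, the operators e_m and f_m move one entry of row m
by one step. Their coefficients are ratios of products of q-numbers and involve no square roots.
Genericity keeps the denominators nonzero on all integer arrays, and a numerator vanishes whenever a
step would leave A(λ), so the arrays of A(λ) span a stable subspace.

The commutator of e_m and f_m splits in two. Moves of different boxes commute
(`lowerCoeff_mul_raiseCoeff`), and the moves that return to the same array sum to a q-number by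
Lagrange interpolation (`sum_prod_qnum`, `sum_lowerCoeff_mul_raiseCoeff`). The Serre relations are
not checked on coefficients. The top array generates everything under the f's
(`admSpace_le_of_lowerOp_stable`), and a Serre element in the e's commutes with all f's and kills
the top array, so it vanishes (`eq_zero_of_commute`). The diagonal form with the explicit nonzero
norms `gtNorm` makes e_m and f_m adjoint (`gtNorm_add_box`), and the relations among the f's follow
by taking adjoints.

This yields a surjection from M(λ) onto the Gelfand–Tsetlin module. For injectivity the spanning
half of a PBW theorem suffices: the ordered monomials in q-root vectors (`lowerAlg_le_span_pbwMono`)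
are indexed by the arrays of A(λ) with the same weights (`sum_exponents`), each weight has finitely
many arrays (`finite_adm_wtExp`), and a surjective endomorphism of a finite-dimensional weight block
is injective (`vermaToGT_injective`).

Transported to M(λ), the arrays form an orthogonal basis of weight vectors, and the sign of `gtNorm`
is the sign in the formula (`GTArray.stilde_eq`). Sylvester's law (`sum_sign_eq_of_orthogonal`)
makes the signature independent of the basis, and adjointness reduces every value of a standard form
to the norm of v_λ (`IsStandardForm.unique`). -/

theorem qpow_add (s x y : ℝ) : qpow s (x + y) = qpow s x * qpow s y := by
  simp only [qpow, ← Complex.exp_add]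
  congr 1
  push_cast
  ring

@[simp] theorem qpow_zero (s : ℝ) : qpow s 0 = 1 := by simp [qpow]

theorem qpow_ne_zero (s x : ℝ) : qpow s x ≠ 0 := Complex.exp_ne_zero _

theorem qpow_neg (s x : ℝ) : qpow s (-x) = (qpow s x)⁻¹ := by
  refine eq_inv_of_mul_eq_one_left ?_
  rw [← qpow_add, neg_add_cancel, qpow_zero]

theorem conj_qpow (s x : ℝ) : conj (qpow s x) = (qpow s x)⁻¹ := by
  rw [← qpow_neg, qpow, ← Complex.exp_conj, qpow]
  congr 1
  simp

theorem qpow_intCast (s : ℝ) (k : ℤ) : qpow s k = qOf s ^ k := by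
  rw [qOf, qpow, qpow, ← Complex.exp_int_mul]
  congr 1
  push_cast
  ring

theorem qpow_sum (s : ℝ) {ι : Type*} (S : Finset ι) (x : ι → ℝ) :
    qpow s (∑ i ∈ S, x i) = ∏ i ∈ S, qpow s (x i) := by
  classical
  induction S using Finset.induction_on with
  | empty => simp
  | insert a S ha ih => rw [Finset.sum_insert ha, Finset.prod_insert ha, qpow_add, ih]

theorem qpow_sub_neg (s x : ℝ) :
    qpow s x - qpow s (-x) = 2 * Complex.I * Real.sin (Real.pi * s * x) := by
  have h := Complex.two_sin (Real.pi * s * x)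
  have e1 : qpow s (-x) = Complex.exp (-(Real.pi * s * x) * Complex.I) := by
    rw [qpow]; congr 1; push_cast; ring
  rw [e1, qpow]
  push_cast
  linear_combination (-Complex.I) * h + (Complex.exp (Real.pi * s * x * Complex.I)
    - Complex.exp (-(Real.pi * s * x) * Complex.I)) * Complex.I_sq

theorem sin_pi_mul_ne_zero {s : ℝ} (hs : Irrational s) : Real.sin (Real.pi * s) ≠ 0 := by
  intro h
  obtain ⟨k, hk⟩ := Real.sin_eq_zero_iff.1 h
  apply hs
  refine ⟨k, ?_⟩
  have : Real.pi * (k - s) = 0 := by linear_combination hk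
  have := (mul_eq_zero.1 this).resolve_left Real.pi_ne_zero
  push_cast
  linarith

theorem qOf_sub_inv_ne_zero {s : ℝ} (hs : Irrational s) : qOf s - (qOf s)⁻¹ ≠ 0 := by
  rw [qOf, ← qpow_neg, qpow_sub_neg, mul_one]
  exact mul_ne_zero (by simp) (by exact_mod_cast sin_pi_mul_ne_zero hs)

theorem qnum_eq (s x : ℝ) :
    (qnum s x : ℂ) = (qpow s x - qpow s (-x)) / (qOf s - (qOf s)⁻¹) := by
  rw [qOf, ← qpow_neg, qpow_sub_neg, qpow_sub_neg, mul_one, qnum,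
    mul_div_mul_left _ _ (by simp)]
  push_cast
  rfl

@[simp] theorem qnum_zero (s : ℝ) : qnum s 0 = 0 := by simp [qnum]

theorem qnum_neg (s x : ℝ) : qnum s (-x) = -qnum s x := by
  simp [qnum, neg_div]

theorem qnum_one {s : ℝ} (hs : Irrational s) : qnum s 1 = 1 := by
  rw [qnum, mul_one, div_self (sin_pi_mul_ne_zero hs)]

theorem qnum_ne_zero {s x : ℝ} (hs : Irrational s) (h : ∀ l : ℤ, s * x ≠ l) : qnum s x ≠ 0 := by
  rw [qnum, div_ne_zero_iff]
  refine ⟨fun h0 => ?_, sin_pi_mul_ne_zero hs⟩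
  obtain ⟨k, hk⟩ := Real.sin_eq_zero_iff.1 h0
  apply h k
  have : Real.pi * (k - s * x) = 0 := by linear_combination hk
  have := (mul_eq_zero.1 this).resolve_left Real.pi_ne_zero
  linarith

theorem qnum_intCast_ne_zero {s : ℝ} (hs : Irrational s) {k : ℤ} (hk : k ≠ 0) :
    qnum s k ≠ 0 := by
  apply qnum_ne_zero hs
  intro l hl
  exact (hs.mul_intCast hk) ⟨l, by push_cast; exact hl.symm⟩

/-- For irrational s the number q is not a root of unity, because q^k = 1 would force [k] = 0. This
is what lets integral weights be read off from eigenvalues. -/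
theorem qOf_zpow_injective {s : ℝ} (hs : Irrational s) {k : ℤ} (h : qOf s ^ k = 1) : k = 0 := by
  by_contra hk
  have h1 := qnum_eq s k
  rw [qpow_neg, qpow_intCast, h] at h1
  exact qnum_intCast_ne_zero hs hk (by simpa using h1)

/-- Lagrange interpolation of `∏ (X - P_j) - ∏ (X - U_l)` at the nodes `U_k`, evaluated at `0`. -/
theorem sum_prod_sub_div_prod_sub {ι κ : Type*} [DecidableEq ι] (S : Finset ι) (T : Finset κ)
    (U : ι → ℂ) (P : κ → ℂ) (hcard : T.card = S.card) (hU : ∀ k ∈ S, U k ≠ 0)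
    (hinj : Set.InjOn U S) :
    ∑ k ∈ S, (U k)⁻¹ * ((∏ j ∈ T, (P j - U k)) / ∏ l ∈ S.erase k, (U l - U k)) =
      (∏ j ∈ T, P j) / (∏ l ∈ S, U l) - 1 := by
  classical
  open Polynomial in
  set F : ℂ[X] := ∏ j ∈ T, (X - C (P j)) with hF
  set G : ℂ[X] := ∏ l ∈ S, (X - C (U l)) with hG
  have hFm : F.Monic := monic_prod_of_monic _ _ fun j _ => monic_X_sub_C _
  have hGm : G.Monic := monic_prod_of_monic _ _ fun j _ => monic_X_sub_C _
  have hFd : F.degree = S.card := by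
    rw [hF, degree_prod]; simp [hcard]
  have hGd : G.degree = S.card := by
    rw [hG, degree_prod]; simp
  -- Both products are monic of degree |S|, so the leading terms cancel and |S| nodes determine the
  -- difference.
  have hdeg : (F - G).degree < S.card := by
    rw [← hFd]
    exact degree_sub_lt_left (by rw [hFd, hGd]) hFm.ne_zero (by rw [hFm.leadingCoeff, hGm.leadingCoeff])
  have hint := Lagrange.eq_interpolate_of_eval_eq (r := fun k => ∏ j ∈ T, (U k - P j))
    (v := U) (s := S) (f := F - G) hinj hdeg (by
      intro k hk
      have : eval (U k) G = 0 := by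
        rw [hG, eval_prod]; exact Finset.prod_eq_zero hk (by simp)
      rw [eval_sub, this, hF, eval_prod]; simp)
  have h0 := congrArg (eval 0) hint
  rw [Lagrange.interpolate_apply, eval_finsetSum, eval_sub, hF, hG, eval_prod, eval_prod] at h0
  simp only [eval_sub, eval_X, eval_C, zero_sub, eval_mul, Lagrange.basis, eval_prod,
    Lagrange.basisDivisor] at h0
  have hUp : ∏ l ∈ S, U l ≠ 0 := Finset.prod_ne_zero_iff.2 hU
  rw [Finset.prod_neg, Finset.prod_neg, hcard, ← mul_sub] at h0
  have hsgn : ((-1 : ℂ) ^ S.card) * (-1) ^ S.card = 1 := by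
    rw [← mul_pow]; simp
  have h1 : (∏ j ∈ T, P j) - ∏ l ∈ S, U l = ∑ k ∈ S, (∏ l ∈ S, U l) * ((U k)⁻¹ *
      ((∏ j ∈ T, (P j - U k)) / ∏ l ∈ S.erase k, (U l - U k))) := by
    have h2 := congrArg (fun z => (-1 : ℂ) ^ S.card * z) h0
    rw [← mul_assoc, hsgn, one_mul] at h2
    rw [h2, Finset.mul_sum]
    refine Finset.sum_congr rfl fun k hk => ?_
    have e1 : ∏ j ∈ T, (U k - P j) = (-1) ^ S.card * ∏ j ∈ T, (P j - U k) := by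
      rw [← hcard, ← Finset.prod_neg]
      exact Finset.prod_congr rfl fun j _ => by ring
    have e2 : ∏ l ∈ S.erase k, ((U k - U l)⁻¹ * -U l)
        = (∏ l ∈ S.erase k, U l) / ∏ l ∈ S.erase k, (U l - U k) := by
      rw [← Finset.prod_div_distrib]
      refine Finset.prod_congr rfl fun l hl => ?_
      rw [← neg_sub, inv_neg]
      ring
    rw [e1, e2, ← Finset.mul_prod_erase S U hk]
    have := hU k hk
    field_simp
    rw [sq, hsgn, one_mul]
  rw [← Finset.mul_sum] at h1
  rw [eq_sub_iff_add_eq, eq_div_iff hUp]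
  linear_combination -h1

/-- The partial fraction identity behind the relation `[e_m, f_m] = [h_m]`. -/
theorem sum_prod_qnum {s : ℝ} (hs : Irrational s) {ι κ : Type*} [DecidableEq ι]
    (S : Finset ι) (T : Finset κ)
    (u : ι → ℝ) (p : κ → ℝ) (hcard : T.card = S.card)
    (hu : ∀ k ∈ S, ∀ l ∈ S, k ≠ l → qnum s (u k - u l) ≠ 0) :
    ∑ k ∈ S, (∏ j ∈ T, qnum s (p j - u k)) / ∏ l ∈ S.erase k, qnum s (u l - u k) =
      qnum s (∑ j ∈ T, p j - ∑ l ∈ S, u l) := by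
  set c : ℂ := qOf s - (qOf s)⁻¹ with hc
  have hc0 : c ≠ 0 := qOf_sub_inv_ne_zero hs
  set Q := qpow s
  have hQ : ∀ x, Q x ≠ 0 := qpow_ne_zero s
  -- Up to a monomial prefactor, [x - y] is q^{2x} - q^{2y}, which turns products of q-numbers into
  -- products of linear factors with nodes q^{2u}.
  have hsplit : ∀ x y : ℝ, (qnum s (x - y) : ℂ)
      = Q (-x) * (Q (-y) * (c⁻¹ * (Q (2 * x) - Q (2 * y)))) := by
    intro x y
    rw [qnum_eq]
    have e1 : qpow s (x - y) = Q (-x) * Q (-y) * Q (2 * x) := by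
      simp only [Q, ← qpow_add]; congr 1; ring
    have e2 : qpow s (-(x - y)) = Q (-x) * Q (-y) * Q (2 * y) := by
      simp only [Q, ← qpow_add]; congr 1; ring
    rw [e1, e2, ← hc]
    field_simp
  have hinj : Set.InjOn (fun k => Q (2 * u k)) S := by
    intro k hk l hl hkl
    by_contra hne
    apply hu k hk l hl hne
    have := hsplit (u k) (u l)
    simp only at hkl
    rw [hkl, sub_self, mul_zero, mul_zero, mul_zero] at this
    exact_mod_cast this
  have key := sum_prod_sub_div_prod_sub S T (fun k => Q (2 * u k)) (fun j => Q (2 * p j)) hcard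
    (fun k _ => hQ _) hinj
  -- The numerator has one factor more than the denominator. The surplus prefactor q^{-u_k},
  -- together with the q^{-u_k} needed to complete the product over all of S, gives the weight U_k⁻¹
  -- of the interpolation identity.
  have hterm : ∀ k ∈ S, (((∏ j ∈ T, qnum s (p j - u k)) /
      ∏ l ∈ S.erase k, qnum s (u l - u k) : ℝ) : ℂ) =
      ((∏ j ∈ T, Q (-p j)) / (∏ l ∈ S, Q (-u l)) * c⁻¹) * ((Q (2 * u k))⁻¹ *
        ((∏ j ∈ T, (Q (2 * p j) - Q (2 * u k))) /
          ∏ l ∈ S.erase k, (Q (2 * u l) - Q (2 * u k)))) := by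
    intro k hk
    push_cast
    simp only [hsplit, Finset.prod_mul_distrib, Finset.prod_const]
    rw [← Finset.mul_prod_erase S (fun l => Q (-u l)) hk, hcard,
      ← Finset.card_erase_add_one hk]
    have e1 : (Q (2 * u k))⁻¹ = Q (-u k) * Q (-u k) := by
      simp only [Q, ← qpow_add, ← qpow_neg]; congr 1; ring
    have h1 : ∏ l ∈ S.erase k, (Q (2 * u l) - Q (2 * u k)) ≠ 0 := by
      refine Finset.prod_ne_zero_iff.2 fun l hl => sub_ne_zero.2 fun h => ?_
      exact (Finset.mem_erase.1 hl).1 (hinj (Finset.mem_of_mem_erase hl) hk h)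
    have h2 : ∏ l ∈ S.erase k, Q (-u l) ≠ 0 := Finset.prod_ne_zero_iff.2 fun l _ => hQ _
    have h3 := hQ (-u k)
    rw [e1, pow_succ c⁻¹, pow_succ (Q (-u k))]
    have h4 : c⁻¹ ^ (S.erase k).card ≠ 0 := pow_ne_zero _ (inv_ne_zero hc0)
    generalize c⁻¹ ^ (S.erase k).card = z at *
    field_simp
  have hfin : ((∑ k ∈ S, (∏ j ∈ T, qnum s (p j - u k)) /
      ∏ l ∈ S.erase k, qnum s (u l - u k) : ℝ) : ℂ) =
      (qnum s (∑ j ∈ T, p j - ∑ l ∈ S, u l) : ℝ) := by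
    rw [Complex.ofReal_sum, Finset.sum_congr rfl hterm, ← Finset.mul_sum, key, hsplit]
    have f1 : Q (-∑ j ∈ T, p j) = ∏ j ∈ T, Q (-p j) := by
      rw [← Finset.sum_neg_distrib]; exact qpow_sum _ _ _
    have f2 : Q (-∑ l ∈ S, u l) = ∏ l ∈ S, Q (-u l) := by
      rw [← Finset.sum_neg_distrib]; exact qpow_sum _ _ _
    have f3 : Q (2 * ∑ j ∈ T, p j) = ∏ j ∈ T, Q (2 * p j) := by
      rw [Finset.mul_sum]; exact qpow_sum _ _ _
    have f4 : Q (2 * ∑ l ∈ S, u l) = ∏ l ∈ S, Q (2 * u l) := by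
      rw [Finset.mul_sum]; exact qpow_sum _ _ _
    rw [← f1, ← f2, ← f3, ← f4]
    have g : Q (2 * ∑ l ∈ S, u l) = (Q (-∑ l ∈ S, u l))⁻¹ * (Q (-∑ l ∈ S, u l))⁻¹ := by
      simp only [Q, ← qpow_add, ← qpow_neg]; congr 1; ring
    rw [g]
    have := hQ (-∑ l ∈ S, u l)
    field_simp
  exact_mod_cast hfin

/-! ### Gelfand–Tsetlin operators on formal combinations of integral arrays -/

/-- Integral arrays `(d_{m,i})`; the array `d` stands for `λ_{m,i} = λ_i - d_{m,i}`. -/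
abbrev Arr : Type := ℕ → ℕ → ℤ

/-- The array with a single entry `1` in position `(m, i)`. -/
def box (m i : ℕ) : Arr := Pi.single m (Pi.single i 1)

theorem box_apply (m i m' i' : ℕ) : box m i m' i' = if m' = m ∧ i' = i then 1 else 0 := by
  unfold box
  by_cases h : m' = m
  · subst h
    by_cases h' : i' = i
    · subst h'; simp
    · simp [h']
  · simp [h]

/-- `L_i - d_{m,i}`; for `L_i = λ_i - i` this is `λ_{m,i} - i`. -/
def pos (L : ℕ → ℝ) (d : Arr) (m i : ℕ) : ℝ := L i - d m i

theorem pos_add_box (L : ℕ → ℝ) (d : Arr) (m i m' i' : ℕ) :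
    pos L (d + box m i) m' i' = pos L d m' i' - if m' = m ∧ i' = i then 1 else 0 := by
  simp only [pos, Pi.add_apply, box_apply]
  split_ifs <;> push_cast <;> ring

theorem pos_sub_box (L : ℕ → ℝ) (d : Arr) (m i m' i' : ℕ) :
    pos L (d - box m i) m' i' = pos L d m' i' + if m' = m ∧ i' = i then 1 else 0 := by
  simp only [pos, Pi.sub_apply, box_apply]
  split_ifs <;> push_cast <;> ring

/-- Sum of the entries of a row. -/
def rowSum (d : Arr) (k : ℕ) : ℤ := ∑ i ∈ Finset.Icc 1 k, d k i

/-- The `k`-th coordinate of the weight of an array, relative to `λ`. -/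
def wtExp (d : Arr) (k : ℕ) : ℤ := rowSum d (k - 1) - rowSum d k

theorem rowSum_add (d d' : Arr) (k : ℕ) : rowSum (d + d') k = rowSum d k + rowSum d' k :=
  Finset.sum_add_distrib

theorem rowSum_sub (d d' : Arr) (k : ℕ) : rowSum (d - d') k = rowSum d k - rowSum d' k :=
  Finset.sum_sub_distrib _ _

theorem rowSum_box {m i : ℕ} (hi : i ∈ Finset.Icc 1 m) (k : ℕ) :
    rowSum (box m i) k = if k = m then 1 else 0 := by
  unfold rowSum
  simp only [box_apply]
  split_ifs with h
  · subst h
    rw [Finset.sum_eq_single_of_mem i hi] <;> simp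
  · simp [h]

theorem wtExp_add_box (d : Arr) {m i : ℕ} (hi : i ∈ Finset.Icc 1 m) {k : ℕ} (hk : 1 ≤ k) :
    wtExp (d + box m i) k
      = wtExp d k - ((if k = m then 1 else 0) - (if k = m + 1 then 1 else 0)) := by
  have : (k - 1 = m) ↔ (k = m + 1) := by omega
  simp only [wtExp, rowSum_add, rowSum_box hi, this]
  ring

theorem wtExp_sub_box (d : Arr) {m i : ℕ} (hi : i ∈ Finset.Icc 1 m) {k : ℕ} (hk : 1 ≤ k) :
    wtExp (d - box m i) k
      = wtExp d k + ((if k = m then 1 else 0) - (if k = m + 1 then 1 else 0)) := by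
  have : (k - 1 = m) ↔ (k = m + 1) := by omega
  simp only [wtExp, rowSum_sub, rowSum_box hi, this]
  ring

/-- The `k`-th coordinate of the weight of an array. -/
def wtAt (L : ℕ → ℝ) (d : Arr) (k : ℕ) : ℝ := L k + k + wtExp d k

/-- `∏_{l ≠ i} [x_{m,l} - x_{m,i}]`. -/
def rowDen (s : ℝ) (L : ℕ → ℝ) (d : Arr) (m i : ℕ) : ℝ :=
  ∏ l ∈ (Finset.Icc 1 m).erase i, qnum s (pos L d m l - pos L d m i)

/-- `∏_{j ≤ k} [x_{k,j} - x_{m,i}]`. -/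
def rowNum (s : ℝ) (L : ℕ → ℝ) (d : Arr) (k m i : ℕ) : ℝ :=
  ∏ j ∈ Finset.Icc 1 k, qnum s (pos L d k j - pos L d m i)

/-- The coefficient with which `e_m` raises the entry `(m, i)`. -/
def raiseCoeff (s : ℝ) (L : ℕ → ℝ) (d : Arr) (m i : ℕ) : ℝ :=
  -(rowNum s L d (m + 1) m i / rowDen s L d m i)

/-- The coefficient with which `f_m` lowers the entry `(m, i)`. -/
def lowerCoeff (s : ℝ) (L : ℕ → ℝ) (d : Arr) (m i : ℕ) : ℝ :=
  rowNum s L d (m - 1) m i / rowDen s L d m i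

/-- The operator `e_m`. -/
def raiseOp (s : ℝ) (L : ℕ → ℝ) (m : ℕ) : (Arr →₀ ℂ) →ₗ[ℂ] (Arr →₀ ℂ) :=
  Finsupp.linearCombination ℂ fun d => ∑ i ∈ Finset.Icc 1 m,
    Finsupp.single (d - box m i) (raiseCoeff s L d m i : ℂ)

/-- The operator `f_m`. -/
def lowerOp (s : ℝ) (L : ℕ → ℝ) (m : ℕ) : (Arr →₀ ℂ) →ₗ[ℂ] (Arr →₀ ℂ) :=
  Finsupp.linearCombination ℂ fun d => ∑ i ∈ Finset.Icc 1 m,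
    Finsupp.single (d + box m i) (lowerCoeff s L d m i : ℂ)

/-- A diagonal operator. -/
def diagOp (c : Arr → ℂ) : (Arr →₀ ℂ) →ₗ[ℂ] (Arr →₀ ℂ) :=
  Finsupp.linearCombination ℂ fun d => Finsupp.single d (c d)

theorem raiseOp_single (s : ℝ) (L : ℕ → ℝ) (m : ℕ) (d : Arr) (z : ℂ) :
    raiseOp s L m (Finsupp.single d z) = ∑ i ∈ Finset.Icc 1 m,
      Finsupp.single (d - box m i) (z * (raiseCoeff s L d m i : ℂ)) := by
  simp [raiseOp, Finsupp.linearCombination_single, Finset.smul_sum]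

theorem lowerOp_single (s : ℝ) (L : ℕ → ℝ) (m : ℕ) (d : Arr) (z : ℂ) :
    lowerOp s L m (Finsupp.single d z) = ∑ i ∈ Finset.Icc 1 m,
      Finsupp.single (d + box m i) (z * (lowerCoeff s L d m i : ℂ)) := by
  simp [lowerOp, Finsupp.linearCombination_single, Finset.smul_sum]

theorem diagOp_single (c : Arr → ℂ) (d : Arr) (z : ℂ) :
    diagOp c (Finsupp.single d z) = Finsupp.single d (z * c d) := by
  simp [diagOp, Finsupp.linearCombination_single]

theorem diagOp_comp (c c' : Arr → ℂ) (v : Arr →₀ ℂ) :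
    diagOp c (diagOp c' v) = diagOp (fun d => c d * c' d) v := by
  induction v using Finsupp.induction_linear with
  | zero => simp
  | add f g hf hg => simp only [map_add, hf, hg]
  | single d z => simp only [diagOp_single]; congr 1; ring

/-- The operator by which `t_k ^ ε` acts. -/
def torusOp (s : ℝ) (L : ℕ → ℝ) (ε : ℝ) (k : ℕ) : (Arr →₀ ℂ) →ₗ[ℂ] (Arr →₀ ℂ) :=
  diagOp fun d => qpow s (ε * wtAt L d k)

/-- The integer `δ_{k,m} - δ_{k,m+1}`. -/
def rootExp (k m : ℕ) : ℤ := (if k = m then 1 else 0) - (if k = m + 1 then 1 else 0)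

theorem wtAt_sub_box (L : ℕ → ℝ) (d : Arr) {m i : ℕ} (hi : i ∈ Finset.Icc 1 m) {k : ℕ}
    (hk : 1 ≤ k) : wtAt L (d - box m i) k = wtAt L d k + rootExp k m := by
  simp only [wtAt, wtExp_sub_box d hi hk, rootExp]
  push_cast
  ring

theorem wtAt_add_box (L : ℕ → ℝ) (d : Arr) {m i : ℕ} (hi : i ∈ Finset.Icc 1 m) {k : ℕ}
    (hk : 1 ≤ k) : wtAt L (d + box m i) k = wtAt L d k - rootExp k m := by
  simp only [wtAt, wtExp_add_box d hi hk, rootExp]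
  push_cast
  ring

/-- Only the increment of the exponent along a moved box matters, so one computation serves both the
torus operators and the products t_m t_{m+1}⁻¹. -/
theorem diagOp_raiseOp (s : ℝ) (L : ℕ → ℝ) (m : ℕ) {g : Arr → ℝ} {c : ℝ}
    (h : ∀ d, ∀ i ∈ Finset.Icc 1 m, g (d - box m i) = g d + c) (v : Arr →₀ ℂ) :
    diagOp (fun d => qpow s (g d)) (raiseOp s L m v)
      = qpow s c • raiseOp s L m (diagOp (fun d => qpow s (g d)) v) := by
  induction v using Finsupp.induction_linear with
  | zero => simp
  | add f g hf hg => simp only [map_add, hf, hg, smul_add]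
  | single d z =>
    simp only [diagOp_single, raiseOp_single, map_sum, Finset.smul_sum,
      Finsupp.smul_single, smul_eq_mul]
    refine Finset.sum_congr rfl fun i hi => ?_
    rw [h d i hi, qpow_add]
    congr 1
    ring

theorem diagOp_lowerOp (s : ℝ) (L : ℕ → ℝ) (m : ℕ) {g : Arr → ℝ} {c : ℝ}
    (h : ∀ d, ∀ i ∈ Finset.Icc 1 m, g (d + box m i) = g d - c) (v : Arr →₀ ℂ) :
    diagOp (fun d => qpow s (g d)) (lowerOp s L m v)
      = qpow s (-c) • lowerOp s L m (diagOp (fun d => qpow s (g d)) v) := by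
  induction v using Finsupp.induction_linear with
  | zero => simp
  | add f g hf hg => simp only [map_add, hf, hg, smul_add]
  | single d z =>
    simp only [diagOp_single, lowerOp_single, map_sum, Finset.smul_sum,
      Finsupp.smul_single, smul_eq_mul]
    refine Finset.sum_congr rfl fun i hi => ?_
    rw [h d i hi, sub_eq_add_neg, qpow_add]
    congr 1
    ring

theorem torusOp_torusOp (s : ℝ) (L : ℕ → ℝ) (ε ε' : ℝ) (k k' : ℕ) (v : Arr →₀ ℂ) :
    torusOp s L ε k (torusOp s L ε' k' v)
      = diagOp (fun d => qpow s (ε * wtAt L d k + ε' * wtAt L d k')) v := by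
  simp only [torusOp, diagOp_comp, qpow_add]

/-- All `q`-numbers `[λ_i - λ_j + k]` with `i ≠ j` are nonzero. -/
def Generic (s : ℝ) (L : ℕ → ℝ) (n : ℕ) : Prop :=
  ∀ i ∈ Finset.Icc 1 n, ∀ j ∈ Finset.Icc 1 n, i ≠ j → ∀ k : ℤ, qnum s (L i - L j + k) ≠ 0

/-! ### Raising and lowering different boxes -/

section relations

variable {s : ℝ} {L : ℕ → ℝ} {n : ℕ}

/-- Entries of column i stay in the coset L_i + ℤ, so genericity separates distinct columns in any
rows and for any integer array, admissible or not. -/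
theorem Generic.pos_ne (hg : Generic s L n) (d : Arr) {i j : ℕ} (hi : i ∈ Finset.Icc 1 n)
    (hj : j ∈ Finset.Icc 1 n) (hij : i ≠ j) (m m' : ℕ) (k : ℤ) :
    qnum s (pos L d m i - pos L d m' j + k) ≠ 0 := by
  have := hg i hi j hj hij (k + d m' j - d m i)
  push_cast at this
  simp only [pos]
  convert this using 2
  ring

theorem Generic.pos_ne' (hg : Generic s L n) (d : Arr) {i j : ℕ} (hi : i ∈ Finset.Icc 1 n)
    (hj : j ∈ Finset.Icc 1 n) (hij : i ≠ j) (m m' : ℕ) :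
    qnum s (pos L d m i - pos L d m' j) ≠ 0 := by
  simpa using hg.pos_ne d hi hj hij m m' 0

theorem Generic.rowDen_ne_zero (hg : Generic s L n) (d : Arr) {m i : ℕ} (hm : m ≤ n)
    (hi : i ∈ Finset.Icc 1 m) : rowDen s L d m i ≠ 0 := by
  refine Finset.prod_ne_zero_iff.2 fun l hl => ?_
  have hl' := Finset.mem_Icc.1 (Finset.mem_of_mem_erase hl)
  have hi' := Finset.mem_Icc.1 hi
  exact hg.pos_ne' d (by simp; omega) (by simp; omega) (Finset.ne_of_mem_erase hl) m m

theorem rowNum_add_box_of_ne (s : ℝ) (L : ℕ → ℝ) (d : Arr) (k m i : ℕ) {m' i' : ℕ} (h1 : m' ≠ k)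
    (h2 : ¬ (m = m' ∧ i = i')) :
    rowNum s L (d + box m' i') k m i = rowNum s L d k m i := by
  unfold rowNum
  refine Finset.prod_congr rfl fun j hj => ?_
  rw [pos_add_box, pos_add_box, if_neg (by rintro ⟨rfl, -⟩; exact h1 rfl), if_neg h2]
  simp

theorem rowDen_add_box_of_ne (s : ℝ) (L : ℕ → ℝ) (d : Arr) (m i : ℕ) {m' i' : ℕ} (h1 : m' ≠ m) :
    rowDen s L (d + box m' i') m i = rowDen s L d m i := by
  unfold rowDen
  refine Finset.prod_congr rfl fun j hj => ?_
  rw [pos_add_box, pos_add_box, if_neg (by rintro ⟨rfl, -⟩; exact h1 rfl),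
    if_neg (by rintro ⟨rfl, -⟩; exact h1 rfl)]
  simp

theorem rowNum_sub_box_of_ne (s : ℝ) (L : ℕ → ℝ) (d : Arr) (k m i : ℕ) {m' i' : ℕ} (h1 : m' ≠ k)
    (h2 : ¬ (m = m' ∧ i = i')) :
    rowNum s L (d - box m' i') k m i = rowNum s L d k m i := by
  have h := rowNum_add_box_of_ne s L (d - box m' i') k m i h1 h2
  rw [sub_add_cancel] at h
  exact h.symm

theorem rowDen_sub_box_of_ne (s : ℝ) (L : ℕ → ℝ) (d : Arr) (m i : ℕ) {m' i' : ℕ} (h1 : m' ≠ m) :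
    rowDen s L (d - box m' i') m i = rowDen s L d m i := by
  have h := rowDen_add_box_of_ne s L (d - box m' i') m i (i' := i') h1
  rw [sub_add_cancel] at h
  exact h.symm

/-- Split off the factor of `rowNum` in column `j`. -/
theorem rowNum_add_box_row (s : ℝ) (L : ℕ → ℝ) (d : Arr) {k m i j : ℕ} (hkm : k ≠ m)
    (hj : j ∈ Finset.Icc 1 k) :
    rowNum s L (d + box k j) k m i * qnum s (pos L d k j - pos L d m i)
      = rowNum s L d k m i * qnum s (pos L d k j - 1 - pos L d m i) := by
  unfold rowNum
  rw [← Finset.mul_prod_erase _ _ hj, ← Finset.mul_prod_erase _ (fun j => qnum s (pos L d k j - _)) hj,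
    Finset.prod_congr rfl (g := fun l => qnum s (pos L d k l - pos L d m i))]
  · rw [pos_add_box, pos_add_box, if_pos ⟨rfl, rfl⟩, if_neg (by rintro ⟨rfl, -⟩; exact hkm rfl)]
    rw [sub_zero]
    ring
  · intro l hl
    rw [pos_add_box, pos_add_box, if_neg (by rintro ⟨-, rfl⟩; simp at hl),
      if_neg (by rintro ⟨rfl, -⟩; exact hkm rfl)]
    simp

theorem rowDen_add_box_row (s : ℝ) (L : ℕ → ℝ) (d : Arr) {m i j : ℕ} (hij : j ≠ i)
    (hj : j ∈ Finset.Icc 1 m) :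
    rowDen s L (d + box m j) m i * qnum s (pos L d m j - pos L d m i)
      = rowDen s L d m i * qnum s (pos L d m j - 1 - pos L d m i) := by
  have hj' : j ∈ (Finset.Icc 1 m).erase i := Finset.mem_erase.2 ⟨hij, hj⟩
  unfold rowDen
  rw [← Finset.mul_prod_erase _ _ hj',
    ← Finset.mul_prod_erase _ (fun j => qnum s (pos L d m j - _)) hj',
    Finset.prod_congr rfl (g := fun l => qnum s (pos L d m l - pos L d m i))]
  · rw [pos_add_box, pos_add_box, if_pos ⟨rfl, rfl⟩, if_neg (by rintro ⟨-, rfl⟩; exact hij rfl)]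
    rw [sub_zero]
    ring
  · intro l hl
    rw [pos_add_box, pos_add_box, if_neg (by rintro ⟨-, rfl⟩; simp at hl),
      if_neg (by rintro ⟨-, rfl⟩; exact hij rfl)]
    simp

theorem rowNum_sub_box_row (s : ℝ) (L : ℕ → ℝ) (d : Arr) {k m i j : ℕ} (hkm : k ≠ m)
    (hj : j ∈ Finset.Icc 1 k) :
    rowNum s L (d - box k j) k m i * qnum s (pos L d k j - pos L d m i)
      = rowNum s L d k m i * qnum s (pos L d k j + 1 - pos L d m i) := by
  have h := rowNum_add_box_row s L (d - box k j) (i := i) hkm hj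
  rw [sub_add_cancel, pos_sub_box, pos_sub_box, if_pos ⟨rfl, rfl⟩,
    if_neg (by rintro ⟨rfl, -⟩; exact hkm rfl), add_sub_cancel_right, add_zero] at h
  exact h.symm

theorem rowDen_sub_box_row (s : ℝ) (L : ℕ → ℝ) (d : Arr) {m i j : ℕ} (hij : j ≠ i)
    (hj : j ∈ Finset.Icc 1 m) :
    rowDen s L (d - box m j) m i * qnum s (pos L d m j - pos L d m i)
      = rowDen s L d m i * qnum s (pos L d m j + 1 - pos L d m i) := by
  have h := rowDen_add_box_row s L (d - box m j) hij hj
  rw [sub_add_cancel, pos_sub_box, pos_sub_box, if_pos ⟨rfl, rfl⟩,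
    if_neg (by rintro ⟨-, rfl⟩; exact hij rfl), add_sub_cancel_right, add_zero] at h
  exact h.symm

/-- Raising one entry commutes with lowering a different entry. -/
theorem lowerCoeff_mul_raiseCoeff (hg : Generic s L n) (d : Arr) {m m' i j : ℕ}
    (hm : m < n) (hm' : m' < n)
    (hi : i ∈ Finset.Icc 1 m) (hj : j ∈ Finset.Icc 1 m') (hne : m ≠ m' ∨ i ≠ j) :
    lowerCoeff s L d m' j * raiseCoeff s L (d + box m' j) m i
      = raiseCoeff s L d m i * lowerCoeff s L (d - box m i) m' j := by
  have hi' := Finset.mem_Icc.1 hi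
  have hj' := Finset.mem_Icc.1 hj
  have hin : i ∈ Finset.Icc 1 n := by simp; omega
  have hjn : j ∈ Finset.Icc 1 n := by simp; omega
  unfold lowerCoeff raiseCoeff
  have D1 := hg.rowDen_ne_zero d hm.le hi
  have D2 := hg.rowDen_ne_zero d hm'.le hj
  have D3 := hg.rowDen_ne_zero (d + box m' j) hm.le hi
  have D4 := hg.rowDen_ne_zero (d - box m i) hm'.le hj
  by_cases hmm : m = m'
  · subst hmm
    have hij : i ≠ j := by simpa using hne
    rw [rowNum_add_box_of_ne s L d (m + 1) m i (by omega) (by tauto),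
      rowNum_sub_box_of_ne s L d (m - 1) m j (by omega) (by tauto)]
    have A := rowDen_add_box_row s L d hij.symm hj
    have B := rowDen_sub_box_row s L d hij hi
    have g1 := hg.pos_ne' d hjn hin hij.symm m m
    have e1 : pos L d m i - pos L d m j = -(pos L d m j - pos L d m i) := by ring
    have e2 : pos L d m i + 1 - pos L d m j = -(pos L d m j - 1 - pos L d m i) := by ring
    rw [e1, e2, qnum_neg, qnum_neg] at B
    have g2 : qnum s (pos L d m j - 1 - pos L d m i) ≠ 0 := by
      have := hg.pos_ne d hjn hin hij.symm m m (-1)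
      convert this using 2; push_cast; ring
    have A' := eq_div_of_mul_eq g1 A
    have B' := eq_div_of_mul_eq (neg_ne_zero.2 g1) B
    rw [A', B']
    field_simp
  · rw [rowDen_add_box_of_ne s L d m i (Ne.symm hmm), rowDen_sub_box_of_ne s L d m' j hmm]
    -- Raising in row m reads only the rows m and m + 1, lowering in row m' only the rows m' - 1 and
    -- m'. For distinct rows the two coefficients interact only if m' = m + 1.
    by_cases h1 : m' = m + 1
    · subst h1
      rw [Nat.add_sub_cancel]
      have A := rowNum_add_box_row s L d (i := i) (Ne.symm hmm) hj
      have B := rowNum_sub_box_row s L d (i := j) hmm hi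
      set y := pos L d (m + 1) j
      set x := pos L d m i
      have e1 : x - y = -(y - x) := by ring
      have e2 : x + 1 - y = -(y - 1 - x) := by ring
      rw [e1, e2, qnum_neg, qnum_neg] at B
      -- The common factor [y - x] can vanish when both boxes lie in the same column. Then each side
      -- contains a zero numerator, and no division by this factor is needed.
      by_cases hz : qnum s (y - x) = 0
      · have z1 : rowNum s L d (m + 1) m i = 0 := Finset.prod_eq_zero hj hz
        have z2 : rowNum s L d m (m + 1) j = 0 := by
          refine Finset.prod_eq_zero hi ?_
          change qnum s (x - y) = 0
          rw [e1, qnum_neg, hz, neg_zero]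
        rw [z1, z2]; simp
      · have A' := eq_div_of_mul_eq hz A
        have B' := eq_div_of_mul_eq (neg_ne_zero.2 hz) B
        rw [A', B']
        field_simp
    · rw [rowNum_add_box_of_ne s L d (m + 1) m i h1 (by tauto),
        rowNum_sub_box_of_ne s L d (m' - 1) m' j (by omega) (by tauto)]
      ring

theorem raiseOp_lowerOp_of_ne (hg : Generic s L n) {m m' : ℕ} (hm : m < n) (hm' : m' < n)
    (hne : m ≠ m') (v : Arr →₀ ℂ) :
    raiseOp s L m (lowerOp s L m' v) = lowerOp s L m' (raiseOp s L m v) := by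
  induction v using Finsupp.induction_linear with
  | zero => simp
  | add f g hf hg => simp only [map_add, hf, hg]
  | single d z =>
    simp only [raiseOp_single, lowerOp_single, map_sum]
    rw [Finset.sum_comm]
    refine Finset.sum_congr rfl fun i hi => Finset.sum_congr rfl fun j hj => ?_
    have h := lowerCoeff_mul_raiseCoeff hg d hm hm' hi hj (Or.inl hne)
    rw [show d + box m' j - box m i = d - box m i + box m' j by abel, mul_assoc, mul_assoc]
    congr 2
    exact_mod_cast h

end relations

/-! ### The diagonal part of the commutator of e_m and f_m -/

theorem erase_inl_disjSum {α β : Type*} [DecidableEq α] [DecidableEq β] (S : Finset α)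
    (T : Finset β) (a : α) : (S.disjSum T).erase (Sum.inl a) = (S.erase a).disjSum T := by
  ext x
  rcases x with x | x <;> simp

theorem erase_inr_disjSum {α β : Type*} [DecidableEq α] [DecidableEq β] (S : Finset α)
    (T : Finset β) (b : β) : (S.disjSum T).erase (Sum.inr b) = S.disjSum (T.erase b) := by
  ext x
  rcases x with x | x <;> simp

theorem sum_pos (L : ℕ → ℝ) (d : Arr) (k : ℕ) :
    ∑ i ∈ Finset.Icc 1 k, pos L d k i = ∑ i ∈ Finset.Icc 1 k, L i - rowSum d k := by
  simp [pos, rowSum]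

section relations

variable {s : ℝ} {L : ℕ → ℝ} {n : ℕ}

theorem rowNum_add_box_self (s : ℝ) (L : ℕ → ℝ) (d : Arr) {k m i : ℕ} (hkm : k ≠ m) :
    rowNum s L (d + box m i) k m i
      = ∏ j ∈ Finset.Icc 1 k, qnum s (pos L d k j - (pos L d m i - 1)) := by
  refine Finset.prod_congr rfl fun j _ => ?_
  rw [pos_add_box, pos_add_box, if_neg (by rintro ⟨rfl, -⟩; exact hkm rfl), if_pos ⟨rfl, rfl⟩,
    sub_zero]

theorem rowNum_sub_box_self (s : ℝ) (L : ℕ → ℝ) (d : Arr) {k m i : ℕ} (hkm : k ≠ m) :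
    rowNum s L (d - box m i) k m i
      = ∏ j ∈ Finset.Icc 1 k, qnum s (pos L d k j - (pos L d m i + 1)) := by
  refine Finset.prod_congr rfl fun j _ => ?_
  rw [pos_sub_box, pos_sub_box, if_neg (by rintro ⟨rfl, -⟩; exact hkm rfl), if_pos ⟨rfl, rfl⟩,
    add_zero]

theorem rowDen_add_box_self (s : ℝ) (L : ℕ → ℝ) (d : Arr) (m i : ℕ) :
    rowDen s L (d + box m i) m i
      = ∏ l ∈ (Finset.Icc 1 m).erase i, qnum s (pos L d m l - (pos L d m i - 1)) := by
  refine Finset.prod_congr rfl fun l hl => ?_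
  rw [pos_add_box, pos_add_box, if_neg (by rintro ⟨-, rfl⟩; simp at hl), if_pos ⟨rfl, rfl⟩,
    sub_zero]

theorem rowDen_sub_box_self (s : ℝ) (L : ℕ → ℝ) (d : Arr) (m i : ℕ) :
    rowDen s L (d - box m i) m i
      = ∏ l ∈ (Finset.Icc 1 m).erase i, qnum s (pos L d m l - (pos L d m i + 1)) := by
  refine Finset.prod_congr rfl fun l hl => ?_
  rw [pos_sub_box, pos_sub_box, if_neg (by rintro ⟨-, rfl⟩; simp at hl), if_pos ⟨rfl, rfl⟩,
    add_zero]

/-- The diagonal part of `[e_m, f_m]`. -/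
theorem sum_lowerCoeff_mul_raiseCoeff (hs : Irrational s) (hg : Generic s L n) (d : Arr) {m : ℕ}
    (hm1 : 1 ≤ m) (hm : m < n) :
    ∑ i ∈ Finset.Icc 1 m, lowerCoeff s L d m i * raiseCoeff s L (d + box m i) m i
      - ∑ i ∈ Finset.Icc 1 m, raiseCoeff s L d m i * lowerCoeff s L (d - box m i) m i
      = qnum s (wtAt L d m - wtAt L d (m + 1)) := by
  -- There are 2m nodes: x_i - 1 for lowering and then raising box i, and x_i for the opposite
  -- order. They are matched by the (m + 1) + (m - 1) entries of the adjacent rows, the lower of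
  -- which is shifted by -1.
  set u : ℕ ⊕ ℕ → ℝ := Sum.elim (fun i => pos L d m i - 1) (fun i => pos L d m i) with hu
  set p : ℕ ⊕ ℕ → ℝ := Sum.elim (fun j => pos L d (m + 1) j) (fun j => pos L d (m - 1) j - 1)
    with hp
  have hmem : ∀ i ∈ Finset.Icc 1 m, i ∈ Finset.Icc 1 n := fun i hi => by
    simp at hi ⊢; omega
  have key := sum_prod_qnum hs ((Finset.Icc 1 m).disjSum (Finset.Icc 1 m))
    ((Finset.Icc 1 (m + 1)).disjSum (Finset.Icc 1 (m - 1))) u p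
    (by simp only [Finset.card_disjSum, Nat.card_Icc]; omega) (by
      rintro (k | k) hk (l | l) hl hkl <;>
      simp only [Finset.inl_mem_disjSum, Finset.inr_mem_disjSum, ne_eq, Sum.inl.injEq,
        Sum.inr.injEq] at hk hl hkl <;>
      simp only [hu, Sum.elim_inl, Sum.elim_inr]
      · rw [sub_sub_sub_cancel_right]
        exact hg.pos_ne' d (hmem k hk) (hmem l hl) hkl m m
      · rw [show pos L d m k - 1 - pos L d m l = pos L d m k - pos L d m l + ((-1 : ℤ) : ℝ) by
          push_cast; ring]
        by_cases h : k = l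
        · subst h
          rw [sub_self, zero_add]
          exact qnum_intCast_ne_zero hs (by norm_num)
        · exact hg.pos_ne d (hmem k hk) (hmem l hl) h m m _
      · rw [show pos L d m k - (pos L d m l - 1) = pos L d m k - pos L d m l + ((1 : ℤ) : ℝ) by
          push_cast; ring]
        by_cases h : k = l
        · subst h
          rw [sub_self, zero_add]
          exact qnum_intCast_ne_zero hs (by norm_num)
        · exact hg.pos_ne d (hmem k hk) (hmem l hl) h m m _
      · exact hg.pos_ne' d (hmem k hk) (hmem l hl) hkl m m)
  rw [Finset.sum_disjSum] at key
  -- The partner node contributes [1] = 1 at a node of the first kind and [-1] = -1 at one of the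
  -- second. With the sign in `raiseCoeff` this produces a difference of the two products.
  have t1 : ∀ i ∈ Finset.Icc 1 m,
      (∏ j ∈ (Finset.Icc 1 (m + 1)).disjSum (Finset.Icc 1 (m - 1)),
        qnum s (p j - u (Sum.inl i))) /
        ∏ l ∈ ((Finset.Icc 1 m).disjSum (Finset.Icc 1 m)).erase (Sum.inl i),
          qnum s (u l - u (Sum.inl i))
        = -(lowerCoeff s L d m i * raiseCoeff s L (d + box m i) m i) := by
    intro i hi
    rw [erase_inl_disjSum, Finset.prod_disjSum, Finset.prod_disjSum,
      ← Finset.mul_prod_erase (Finset.Icc 1 m) _ hi]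
    simp only [hu, hp, Sum.elim_inl, Sum.elim_inr, lowerCoeff, raiseCoeff,
      rowNum_add_box_self s L d (show m + 1 ≠ m by omega), rowDen_add_box_self,
      sub_sub_sub_cancel_right]
    rw [sub_sub_cancel, qnum_one hs, rowNum, rowDen]
    ring
  have t2 : ∀ i ∈ Finset.Icc 1 m,
      (∏ j ∈ (Finset.Icc 1 (m + 1)).disjSum (Finset.Icc 1 (m - 1)),
        qnum s (p j - u (Sum.inr i))) /
        ∏ l ∈ ((Finset.Icc 1 m).disjSum (Finset.Icc 1 m)).erase (Sum.inr i),
          qnum s (u l - u (Sum.inr i))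
        = raiseCoeff s L d m i * lowerCoeff s L (d - box m i) m i := by
    intro i hi
    rw [erase_inr_disjSum, Finset.prod_disjSum, Finset.prod_disjSum,
      ← Finset.mul_prod_erase (Finset.Icc 1 m) (fun l => qnum s (u (Sum.inl l) - _)) hi]
    simp only [hu, hp, Sum.elim_inl, Sum.elim_inr, lowerCoeff, raiseCoeff,
      rowNum_sub_box_self s L d (show m - 1 ≠ m by omega), rowDen_sub_box_self]
    have e : ∀ a b : ℝ, a - 1 - b = a - (b + 1) := fun a b => by ring
    simp only [e]
    rw [show pos L d m i - (pos L d m i + 1) = -1 by ring, qnum_neg, qnum_one hs, rowNum, rowDen]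
    ring
  rw [Finset.sum_congr rfl t1, Finset.sum_congr rfl t2, Finset.sum_neg_distrib] at key
  have hfin : ∑ j ∈ (Finset.Icc 1 (m + 1)).disjSum (Finset.Icc 1 (m - 1)), p j
      - ∑ l ∈ (Finset.Icc 1 m).disjSum (Finset.Icc 1 m), u l
      = -(wtAt L d m - wtAt L d (m + 1)) := by
    rw [Finset.sum_disjSum, Finset.sum_disjSum]
    simp only [hu, hp, Sum.elim_inl, Sum.elim_inr, Finset.sum_sub_distrib, sum_pos,
      Finset.sum_const, Nat.card_Icc, nsmul_eq_mul, mul_one, wtAt, wtExp]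
    obtain ⟨k, rfl⟩ := Nat.exists_eq_add_of_le' hm1
    simp only [Nat.add_sub_cancel]
    rw [Finset.sum_Icc_succ_top (by omega), Finset.sum_Icc_succ_top (by omega)]
    push_cast
    ring
  rw [hfin, qnum_neg] at key
  linarith

/-- Pairs of moves of different boxes cancel by `lowerCoeff_mul_raiseCoeff`. What remains returns to
the same array and is summed by partial fractions. -/
theorem raiseOp_lowerOp_self (hs : Irrational s) (hg : Generic s L n) {m : ℕ}
    (hm1 : 1 ≤ m) (hm : m < n) (v : Arr →₀ ℂ) :
    raiseOp s L m (lowerOp s L m v) - lowerOp s L m (raiseOp s L m v)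
      = diagOp (fun d => (qnum s (wtAt L d m - wtAt L d (m + 1)) : ℂ)) v := by
  induction v using Finsupp.induction_linear with
  | zero => simp
  | add f g hf hg => simp only [map_add, ← hf, ← hg]; abel
  | single d z =>
    simp only [raiseOp_single, lowerOp_single, map_sum, diagOp_single]
    rw [Finset.sum_comm (f := fun j i => Finsupp.single (d - box m j + box m i) _),
      ← Finset.sum_sub_distrib]
    have h1 : ∀ i ∈ Finset.Icc 1 m,
        (∑ j ∈ Finset.Icc 1 m, Finsupp.single (d + box m i - box m j)
          (z * (lowerCoeff s L d m i : ℂ) * (raiseCoeff s L (d + box m i) m j : ℂ)) -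
        ∑ j ∈ Finset.Icc 1 m, Finsupp.single (d - box m j + box m i)
          (z * (raiseCoeff s L d m j : ℂ) * (lowerCoeff s L (d - box m j) m i : ℂ)))
        = Finsupp.single d (z * ((lowerCoeff s L d m i * raiseCoeff s L (d + box m i) m i
          - raiseCoeff s L d m i * lowerCoeff s L (d - box m i) m i : ℝ) : ℂ)) := by
      intro i hi
      rw [← Finset.sum_sub_distrib, Finset.sum_eq_single_of_mem i hi]
      · rw [add_sub_cancel_right, sub_add_cancel, ← Finsupp.single_sub]
        congr 1
        push_cast
        ring
      · intro j hj hji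
        have h := lowerCoeff_mul_raiseCoeff hg d hm hm hj hi (Or.inr hji)
        rw [show d + box m i - box m j = d - box m j + box m i by abel, ← Finsupp.single_sub,
          mul_assoc, mul_assoc, ← mul_sub, ← Complex.ofReal_mul, ← Complex.ofReal_mul, h,
          sub_self, mul_zero, Finsupp.single_zero]
    rw [Finset.sum_congr rfl h1, ← Finsupp.single_finsetSum, ← Finset.mul_sum,
      ← sum_lowerCoeff_mul_raiseCoeff hs hg d hm1 hm, ← Complex.ofReal_sum,
      ← Finset.sum_sub_distrib]

end relations

/-! ### Admissible arrays -/

/-- The arrays of `A(λ)`: row `n` vanishes and each column weakly decreases. -/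
structure Adm (n : ℕ) (d : Arr) : Prop where
  outside : ∀ m i, ¬ (1 ≤ i ∧ i ≤ m ∧ m < n) → d m i = 0
  step : ∀ m i, 1 ≤ i → i ≤ m → m < n → d (m + 1) i ≤ d m i

theorem adm_zero (n : ℕ) : Adm n 0 := ⟨fun _ _ _ => rfl, fun _ _ _ _ _ => le_rfl⟩

theorem Adm.nonneg {n : ℕ} {d : Arr} (hd : Adm n d) (m i : ℕ) : 0 ≤ d m i := by
  by_cases h : 1 ≤ i ∧ i ≤ m ∧ m < n
  · obtain ⟨h1, h2, h3⟩ := h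
    obtain ⟨k, rfl⟩ : ∃ k, n = m + k := ⟨n - m, by omega⟩
    clear h3
    have : ∀ j ≤ k, 0 ≤ d (m + (k - j)) i := by
      intro j
      induction j with
      | zero => intro _; rw [hd.outside _ _ (by omega)]
      | succ j ih =>
        intro hj
        have h4 := hd.step (m + (k - (j + 1))) i h1 (by omega) (by omega)
        rw [show m + (k - (j + 1)) + 1 = m + (k - j) by omega] at h4
        exact (ih (by omega)).trans h4
    simpa using this k le_rfl
  · rw [hd.outside m i h]

/-- Sum of all entries. -/
def height (n : ℕ) (d : Arr) : ℤ := ∑ m ∈ Finset.range n, rowSum d m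

theorem Adm.height_nonneg {n : ℕ} {d : Arr} (hd : Adm n d) : 0 ≤ height n d :=
  Finset.sum_nonneg fun m _ => Finset.sum_nonneg fun i _ => hd.nonneg m i

theorem height_sub_box {n : ℕ} (d : Arr) {m i : ℕ} (hm : m < n) (hi : i ∈ Finset.Icc 1 m) :
    height n (d - box m i) = height n d - 1 := by
  simp only [height, rowSum_sub, rowSum_box hi, Finset.sum_sub_distrib]
  simp [hm]

theorem height_add_box {n : ℕ} (d : Arr) {m i : ℕ} (hm : m < n) (hi : i ∈ Finset.Icc 1 m) :
    height n (d + box m i) = height n d + 1 := by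
  simp only [height, rowSum_add, rowSum_box hi, Finset.sum_add_distrib]
  simp [hm]

theorem Adm.sub_box {n : ℕ} {d : Arr} (hd : Adm n d) {m i : ℕ} (hm : m < n)
    (hi : i ∈ Finset.Icc 1 m) (h : d (m + 1) i < d m i) : Adm n (d - box m i) := by
  have hi' := Finset.mem_Icc.1 hi
  constructor
  · intro m' i' h'
    simp only [Pi.sub_apply, box_apply]
    rw [hd.outside m' i' h', if_neg (by rintro ⟨rfl, rfl⟩; exact h' ⟨hi'.1, hi'.2, hm⟩), sub_zero]
  · intro m' i' h1 h2 h3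
    have := hd.step m' i' h1 h2 h3
    simp only [Pi.sub_apply, box_apply]
    by_cases e : m' = m ∧ i' = i
    · obtain ⟨rfl, rfl⟩ := e
      simp
      omega
    · rw [if_neg e]
      split_ifs <;> omega

theorem Adm.add_box {n : ℕ} {d : Arr} (hd : Adm n d) {m i : ℕ} (hm : m < n)
    (hi : i ∈ Finset.Icc 1 m) (h : i < m → d m i < d (m - 1) i) : Adm n (d + box m i) := by
  have hi' := Finset.mem_Icc.1 hi
  constructor
  · intro m' i' h'
    simp only [Pi.add_apply, box_apply]
    rw [hd.outside m' i' h', if_neg (by rintro ⟨rfl, rfl⟩; exact h' ⟨hi'.1, hi'.2, hm⟩), add_zero]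
  · intro m' i' h1 h2 h3
    have := hd.step m' i' h1 h2 h3
    simp only [Pi.add_apply, box_apply]
    by_cases e : m' + 1 = m ∧ i' = i
    · obtain ⟨rfl, rfl⟩ := e
      have := h (by omega)
      simp at this ⊢
      omega
    · rw [if_neg e]
      split_ifs <;> omega

/-! ### Boundary coefficients and cyclicity of the top array -/

section coefficients

variable {s : ℝ} {L : ℕ → ℝ} {n : ℕ}

/-- The factor of the numerator from column i itself is [0]. Such boundary zeros keep the operators
inside the admissible arrays. -/
theorem raiseCoeff_eq_zero (s : ℝ) (L : ℕ → ℝ) {d : Arr} {m i : ℕ} (hi : i ∈ Finset.Icc 1 m)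
    (h : d (m + 1) i = d m i) : raiseCoeff s L d m i = 0 := by
  have : rowNum s L d (m + 1) m i = 0 := by
    refine Finset.prod_eq_zero (i := i) (by simp at hi ⊢; omega) ?_
    simp [pos, h]
  rw [raiseCoeff, this]
  simp

theorem lowerCoeff_eq_zero (s : ℝ) (L : ℕ → ℝ) {d : Arr} {m i : ℕ} (hi : i ∈ Finset.Icc 1 m)
    (him : i < m) (h : d (m - 1) i = d m i) : lowerCoeff s L d m i = 0 := by
  have : rowNum s L d (m - 1) m i = 0 := by
    refine Finset.prod_eq_zero (i := i) (by simp at hi ⊢; omega) ?_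
    simp [pos, h]
  rw [lowerCoeff, this]
  simp

theorem Generic.qnum_pos_ne_zero (hg : Generic s L n) (hs : Irrational s) {d : Arr} {m m' i j : ℕ}
    (hi : i ∈ Finset.Icc 1 n) (hj : j ∈ Finset.Icc 1 n) (h : i = j → d m i ≠ d m' i) :
    qnum s (pos L d m i - pos L d m' j) ≠ 0 := by
  by_cases hij : i = j
  · subst hij
    have : pos L d m i - pos L d m' i = ((d m' i - d m i : ℤ) : ℝ) := by
      simp only [pos]; push_cast; ring
    rw [this]
    exact qnum_intCast_ne_zero hs (sub_ne_zero.2 (h rfl).symm)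
  · exact hg.pos_ne' d hi hj hij m m'

theorem lowerCoeff_ne_zero (hg : Generic s L n) (hs : Irrational s) {d : Arr} {m i : ℕ}
    (hm : m < n) (hi : i ∈ Finset.Icc 1 m) (h : i < m → d (m - 1) i ≠ d m i) :
    lowerCoeff s L d m i ≠ 0 := by
  refine div_ne_zero (Finset.prod_ne_zero_iff.2 fun j hj => ?_)
    (hg.rowDen_ne_zero d hm.le hi)
  have hi' := Finset.mem_Icc.1 hi
  have hj' := Finset.mem_Icc.1 hj
  exact hg.qnum_pos_ne_zero hs (by simp; omega) (by simp; omega)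
    (by rintro rfl; exact h (by omega))

theorem Adm.sub_box_or (s : ℝ) (L : ℕ → ℝ) {d : Arr} (hd : Adm n d) {m i : ℕ} (hm : m < n)
    (hi : i ∈ Finset.Icc 1 m) : Adm n (d - box m i) ∨ raiseCoeff s L d m i = 0 := by
  have hi' := Finset.mem_Icc.1 hi
  rcases (hd.step m i hi'.1 hi'.2 hm).lt_or_eq with h | h
  · exact Or.inl (hd.sub_box hm hi h)
  · exact Or.inr (raiseCoeff_eq_zero s L hi h)

theorem Adm.add_box_or (s : ℝ) (L : ℕ → ℝ) {d : Arr} (hd : Adm n d) {m i : ℕ} (hm : m < n)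
    (hi : i ∈ Finset.Icc 1 m) : Adm n (d + box m i) ∨ lowerCoeff s L d m i = 0 := by
  have hi' := Finset.mem_Icc.1 hi
  by_cases him : i < m
  · have h := hd.step (m - 1) i hi'.1 (by omega) (by omega)
    rw [Nat.sub_add_cancel (by omega)] at h
    rcases h.lt_or_eq with h | h
    · exact Or.inl (hd.add_box hm hi fun _ => h)
    · exact Or.inr (lowerCoeff_eq_zero s L hi him h.symm)
  · exact Or.inl (hd.add_box hm hi fun h => absurd h him)

/-- The span of the admissible arrays. -/
def admSpace (n : ℕ) : Submodule ℂ (Arr →₀ ℂ) := Finsupp.supported ℂ ℂ {d | Adm n d}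

theorem single_mem_admSpace {d : Arr} (hd : Adm n d) (z : ℂ) :
    Finsupp.single d z ∈ admSpace n :=
  Finsupp.single_mem_supported ℂ z hd

theorem admSpace_le {P : Submodule ℂ (Arr →₀ ℂ)}
    (h : ∀ d, Adm n d → Finsupp.single d 1 ∈ P) : admSpace n ≤ P := by
  rw [admSpace, Finsupp.supported_eq_span_single, Submodule.span_le]
  rintro _ ⟨d, hd, rfl⟩
  exact h d hd

theorem raiseOp_mem (s : ℝ) (L : ℕ → ℝ) {m : ℕ} (hm : m < n) {v : Arr →₀ ℂ}
    (hv : v ∈ admSpace n) : raiseOp s L m v ∈ admSpace n := by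
  refine admSpace_le (P := (admSpace n).comap (raiseOp s L m)) (fun d hd => ?_) hv
  rw [Submodule.mem_comap, raiseOp_single]
  refine Submodule.sum_mem _ fun i hi => ?_
  rcases hd.sub_box_or s L hm hi with h | h
  · exact single_mem_admSpace h _
  · simp [h]

theorem lowerOp_mem (s : ℝ) (L : ℕ → ℝ) {m : ℕ} (hm : m < n) {v : Arr →₀ ℂ}
    (hv : v ∈ admSpace n) : lowerOp s L m v ∈ admSpace n := by
  refine admSpace_le (P := (admSpace n).comap (lowerOp s L m)) (fun d hd => ?_) hv
  rw [Submodule.mem_comap, lowerOp_single]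
  refine Submodule.sum_mem _ fun i hi => ?_
  rcases hd.add_box_or s L hm hi with h | h
  · exact single_mem_admSpace h _
  · simp [h]

theorem diagOp_mem (c : Arr → ℂ) {v : Arr →₀ ℂ} (hv : v ∈ admSpace n) :
    diagOp c v ∈ admSpace n := by
  refine admSpace_le (P := (admSpace n).comap (diagOp c)) (fun d hd => ?_) hv
  rw [Submodule.mem_comap, diagOp_single]
  exact single_mem_admSpace hd _

theorem raiseOp_top (s : ℝ) (L : ℕ → ℝ) (m : ℕ) : raiseOp s L m (Finsupp.single 0 1) = 0 := by
  rw [raiseOp_single]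
  refine Finset.sum_eq_zero fun i hi => ?_
  rw [raiseCoeff_eq_zero s L hi rfl]
  simp

/-- An array on which a functional annihilating all `f`-descendants of the top array does not
vanish has constant columns. -/
theorem const_of_functional_ne_zero (hg : Generic s L n) (hs : Irrational s)
    (ξ : (Arr →₀ ℂ) →ₗ[ℂ] ℂ) (h : ℤ)
    (hξ : ∀ m, 1 ≤ m → m < n → ∀ d, Adm n d → height n d < h →
      ξ (lowerOp s L m (Finsupp.single d 1)) = 0) (k : ℕ) (hk : k ≤ n) :
    ∀ d, Adm n d → height n d ≤ h → ξ (Finsupp.single d 1) ≠ 0 →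
      ∀ j i, 1 ≤ i → i ≤ j → j ≤ k → d j i = d k i := by
  induction k with
  | zero => intro d _ _ _ j i h1 h2 h3; omega
  | succ k ih =>
    intro d hd hht hne
    have tight := ih (by omega) d hd hht hne
    suffices H : ∀ i ∈ Finset.Icc 1 k, d (k + 1) i = d k i by
      intro j i h1 h2 h3
      rcases h3.lt_or_eq with h3 | rfl
      · rw [tight j i h1 h2 (by omega), H i (by simp; omega)]
      · rfl
    intro i hi
    have hi' := Finset.mem_Icc.1 hi
    by_contra hcon
    have hkn : k < n := by omega
    have hlt : d (k + 1) i < d k i := lt_of_le_of_ne (hd.step k i hi'.1 hi'.2 hkn) hcon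
    have hd' := hd.sub_box hkn hi hlt
    -- Undoing one step in column i of row k: f_k applied to `d'` contains `d` with a nonzero
    -- coefficient, and all its other terms turn out to be invisible to `ξ`.
    set d' := d - box k i with hd'def
    have happ : ∀ m j, d' m j = d m j - if m = k ∧ j = i then 1 else 0 := by
      intro m j; simp [hd'def, box_apply]
    have hz := hξ k (by omega) hkn d' hd' (by rw [height_sub_box d hkn hi]; omega)
    rw [lowerOp_single, map_sum, Finset.sum_eq_single_of_mem i hi] at hz
    · rw [sub_add_cancel, one_mul, ← mul_one (lowerCoeff s L d' k i : ℂ), ← smul_eq_mul,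
        ← Finsupp.smul_single, map_smul, smul_eq_mul] at hz
      refine (mul_eq_zero.1 hz).elim (fun h0 => ?_) hne
      refine lowerCoeff_ne_zero hg hs (d := d') hkn hi (fun hik => ?_) (by exact_mod_cast h0)
      rw [happ, happ, tight (k - 1) i hi'.1 (by omega) (by omega), if_neg (by omega),
        if_pos ⟨rfl, rfl⟩]
      omega
    · intro j hj hji
      have hj' := Finset.mem_Icc.1 hj
      -- If i < k, every other term still has the break in column i between rows k - 1 and k, so the
      -- induction hypothesis kills it. If i = k, then j < k and the columns of `d'` agree in rows k
      -- - 1 and k at j, so the coefficient itself is zero.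
      by_cases hik : i < k
      · rcases hd'.add_box_or s L hkn hj with hadm | h0
        · rw [one_mul, ← mul_one (lowerCoeff s L d' k j : ℂ), ← smul_eq_mul,
            ← Finsupp.smul_single, map_smul, smul_eq_mul]
          refine mul_eq_zero_of_right _ ?_
          by_contra hne'
          have t := ih (by omega) _ hadm
            (by rw [height_add_box _ hkn hj, height_sub_box d hkn hi]; omega) hne'
            (k - 1) i hi'.1 (by omega) (by omega)
          rw [Pi.add_apply, Pi.add_apply, Pi.add_apply, Pi.add_apply, box_apply, box_apply,
            if_neg (by omega), if_neg (by omega), happ, happ,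
            tight (k - 1) i hi'.1 (by omega) (by omega), if_neg (by omega),
            if_pos ⟨rfl, rfl⟩] at t
          omega
        · simp [h0]
      · have hjk : j < k := by omega
        have h0 : lowerCoeff s L d' k j = 0 := by
          refine lowerCoeff_eq_zero s L hj hjk ?_
          rw [happ, happ, if_neg (by omega), if_neg (by omega),
            tight (k - 1) j hj'.1 (by omega) (by omega)]
        simp [h0]

/-- The admissible arrays lie in every subspace that contains the top array and is stable under
the operators `f_m`. -/
theorem admSpace_le_of_lowerOp_stable (hg : Generic s L n) (hs : Irrational s)
    {P : Submodule ℂ (Arr →₀ ℂ)} (h0 : Finsupp.single 0 1 ∈ P)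
    (hP : ∀ m, 1 ≤ m → m < n → ∀ v ∈ P, lowerOp s L m v ∈ P) : admSpace n ≤ P := by
  -- The functional is quantified inside the induction on height, because the step applies the
  -- hypothesis to `ξ` composed with f_m, which again annihilates `P`.
  have main : ∀ h : ℕ, ∀ ξ : (Arr →₀ ℂ) →ₗ[ℂ] ℂ, (∀ v ∈ P, ξ v = 0) →
      ∀ d, Adm n d → height n d < h → ξ (Finsupp.single d 1) = 0 := by
    intro h
    induction h with
    | zero => intro ξ _ d hd hlt; have := hd.height_nonneg; push_cast at hlt; omega
    | succ h ih =>
      intro ξ hξ d hd hlt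
      by_contra hne
      have hc := const_of_functional_ne_zero hg hs ξ h
        (fun m h1 h2 d' hd' hlt' => ih (ξ.comp (lowerOp s L m))
          (fun v hv => hξ _ (hP m h1 h2 v hv)) d' hd' hlt') n le_rfl d hd
          (by push_cast at hlt; omega) hne
      have : d = 0 := by
        funext j i
        by_cases hji : 1 ≤ i ∧ i ≤ j ∧ j < n
        · rw [hc j i hji.1 hji.2.1 hji.2.2.le, hd.outside n i (by omega)]
          rfl
        · rw [hd.outside j i hji]
          rfl
      rw [this] at hne
      exact hne (hξ _ h0)
  refine admSpace_le fun d hd => ?_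
  by_contra hnot
  obtain ⟨ξ, hξ, hker⟩ := Submodule.exists_le_ker_of_notMem hnot
  refine hξ (main ((height n d).toNat + 1) ξ (fun v hv => LinearMap.mem_ker.1 (hker hv)) d hd ?_)
  push_cast
  have := hd.height_nonneg
  omega

end coefficients

/-! ### Norms of the Gelfand–Tsetlin vectors -/

theorem qfall_succ (s x : ℝ) (d : ℕ) : qfall s x (d + 1) = qfall s x d * qnum s (x - d) :=
  Finset.prod_range_succ _ _

@[simp] theorem qfall_zero (s x : ℝ) : qfall s x 0 = 1 := Finset.prod_range_zero _

/-- Both sides are the falling product of length d + 1 from x + 1, with its last or its first factor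
split off. -/
theorem qfall_add_one (s x : ℝ) (d : ℕ) :
    qfall s (x + 1) d * qnum s (x + 1 - d) = qfall s x d * qnum s (x + 1) := by
  rw [← qfall_succ, qfall, Finset.prod_range_succ', qfall]
  push_cast
  simp only [add_sub_add_right_eq_sub, sub_zero]

theorem qfall_ne_zero {s x : ℝ} {d : ℕ} (h : ∀ k < d, qnum s (x - k) ≠ 0) : qfall s x d ≠ 0 :=
  Finset.prod_ne_zero_iff.2 fun k hk => h k (Finset.mem_range.1 hk)

/-- The part of the norm that depends on row `m` only. -/
def rowFactor (s : ℝ) (L : ℕ → ℝ) (d : Arr) (m : ℕ) : ℝ :=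
  (∏ i ∈ Finset.Icc 1 m, ∏ j ∈ Finset.Ioc i m, qnum s (L i - pos L d m j)) /
    (∏ i ∈ Finset.Icc 1 m, ∏ j ∈ Finset.Ioc i m, qnum s (pos L d m i - pos L d m j)) *
    ∏ i ∈ Finset.Icc 1 m, qfall s (L i - pos L d m i) (d m i).toNat

/-- The numerator of the interaction of the rows `m` and `m + 1`. -/
def upFactor (s : ℝ) (L : ℕ → ℝ) (d : Arr) (m : ℕ) : ℝ :=
  ∏ i ∈ Finset.Icc 1 m, ∏ j ∈ Finset.Ioc i (m + 1),
    qfall s (L i - pos L d (m + 1) j - 1) (d m i).toNat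

/-- The denominator of the interaction of the rows `m` and `m + 1`. -/
def downFactor (s : ℝ) (L : ℕ → ℝ) (d : Arr) (m : ℕ) : ℝ :=
  ∏ i ∈ Finset.Icc 1 (m + 1), ∏ j ∈ Finset.Ico i (m + 1),
    qfall s (L i - pos L d m j) (d (m + 1) i).toNat

/-- The norm of the Gelfand–Tsetlin vector indexed by `d`. -/
def gtNorm (s : ℝ) (L : ℕ → ℝ) (n : ℕ) (d : Arr) : ℝ :=
  ∏ m ∈ Finset.range n, rowFactor s L d m * upFactor s L d m / downFactor s L d m

/-- Effect on a product over pairs of a change in one row and one column. -/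
theorem prod_pairs_change (I : Finset ℕ) (J : ℕ → Finset ℕ) {f f' : ℕ → ℕ → ℝ} {i : ℕ}
    {c c' : ℕ → ℝ} (hI : i ∉ I → ∀ j, c j = 1)
    (h : ∀ k ∈ I, ∀ j ∈ J k, f' k j = f k j * ((if k = i then c j else 1) *
      (if j = i then c' k else 1))) :
    ∏ k ∈ I, ∏ j ∈ J k, f' k j = (∏ k ∈ I, ∏ j ∈ J k, f k j) *
      ((∏ j ∈ J i, c j) * ∏ k ∈ I with i ∈ J k, c' k) := by
  rw [Finset.prod_congr rfl fun k hk => Finset.prod_congr rfl (h k hk)]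
  simp only [Finset.prod_mul_distrib]
  congr 2
  · by_cases hi : i ∈ I
    · rw [Finset.prod_eq_single_of_mem i hi]
      · simp
      · intro k _ hk
        simp [hk]
    · simp [hI hi]
  · rw [Finset.prod_filter]
    refine Finset.prod_congr rfl fun k _ => ?_
    rw [Finset.prod_ite_eq']

/-! ### Change of the norm factors when one box is added -/

section change

variable {s : ℝ} {L : ℕ → ℝ} {n : ℕ} {d : Arr} {m i : ℕ}

theorem L_sub_pos (L : ℕ → ℝ) (d : Arr) (m i : ℕ) : L i - pos L d m i = d m i := by
  simp [pos]

theorem Adm.toNat_cast (hd : Adm n d) (m i : ℕ) : (((d m i).toNat : ℕ) : ℝ) = d m i := by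
  have := Int.toNat_of_nonneg (hd.nonneg m i)
  exact_mod_cast congrArg (Int.cast : ℤ → ℝ) this

theorem Adm.toNat_add_box (hd : Adm n d) (m i m' i' : ℕ) :
    ((d + box m i) m' i').toNat = (d m' i').toNat + if m' = m ∧ i' = i then 1 else 0 := by
  have := hd.nonneg m' i'
  simp only [Pi.add_apply, box_apply]
  split_ifs <;> omega

theorem L_sub_qnum_ne_zero (hg : Generic s L n) (d : Arr) {i j : ℕ} (hi : i ∈ Finset.Icc 1 n)
    (hj : j ∈ Finset.Icc 1 n) (hij : i ≠ j) (m : ℕ) (k : ℤ) :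
    qnum s (L i - pos L d m j + k) ≠ 0 := by
  have := hg.pos_ne d hi hj hij m m (d m i + k)
  convert this using 2
  simp only [pos]; push_cast; ring

/-- The moved entry is the length of the falling products of row i, so each of them gains exactly
one factor. -/
theorem upFactor_add_box (hd : Adm n d) (hi : i ∈ Finset.Icc 1 m) :
    upFactor s L (d + box m i) m = upFactor s L d m *
      ∏ j ∈ Finset.Ioc i (m + 1), qnum s (pos L d m i - pos L d (m + 1) j - 1) := by
  unfold upFactor
  rw [prod_pairs_change (f := fun i j => qfall s (L i - pos L d (m + 1) j - 1) (d m i).toNat)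
    (i := i) (c := fun j => qnum s (pos L d m i - pos L d (m + 1) j - 1)) (c' := fun _ => 1) _ _
    (fun h => absurd hi h)]
  · simp
  · intro k _ j _
    rw [pos_add_box, if_neg (by omega), sub_zero, hd.toNat_add_box]
    by_cases hk : k = i
    · subst hk
      simp only [if_true, and_self, ite_self, mul_one]
      rw [qfall_succ, hd.toNat_cast]
      congr 2
      simp only [pos]; ring
    · simp [hk]

/-- Here the moved entry sits in the argument of the falling products. A shift of the argument by
one telescopes, by `qfall_add_one`, to a ratio of the two end factors. -/
theorem downFactor_add_box (hg : Generic s L n) (hs : Irrational s) (hd : Adm n d) (hm : m < n)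
    (hi : i ∈ Finset.Icc 1 m) :
    downFactor s L (d + box m i) m = downFactor s L d m *
      ∏ k ∈ Finset.Icc 1 i,
        qnum s (L k - pos L d m i + 1) / qnum s (pos L d (m + 1) k - pos L d m i + 1) := by
  have hi' := Finset.mem_Icc.1 hi
  unfold downFactor
  rw [prod_pairs_change (f := fun i j => qfall s (L i - pos L d m j) (d (m + 1) i).toNat)
    (i := i) (c' := fun k => qnum s (L k - pos L d m i + 1) /
      qnum s (pos L d (m + 1) k - pos L d m i + 1)) (c := fun _ => 1) _ _
    (fun _ _ => rfl)]
  · simp only [Finset.prod_const_one, one_mul]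
    congr 1
    refine Finset.prod_congr ?_ fun _ _ => rfl
    ext k
    simp only [Finset.mem_filter, Finset.mem_Icc, Finset.mem_Ico]
    omega
  · intro k hk j hj
    have hk' := Finset.mem_Icc.1 hk
    have hj' := Finset.mem_Ico.1 hj
    rw [pos_add_box, hd.toNat_add_box, if_neg (c := m + 1 = m ∧ k = i) (by omega), add_zero]
    by_cases hji : j = i
    · subst hji
      simp only [if_true, and_self, ite_self, one_mul]
      -- In the column of the box the argument is d_{m,k} - d_{m+1,k} + 1, a positive integer by
      -- admissibility; in other columns genericity applies.
      have hB : qnum s (pos L d (m + 1) k - pos L d m j + 1) ≠ 0 := by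
        by_cases hkj : k = j
        · subst hkj
          have h1 := hd.step m k hi'.1 hi'.2 hm
          have : pos L d (m + 1) k - pos L d m k + 1 = ((d m k - d (m + 1) k + 1 : ℤ) : ℝ) := by
            simp only [pos]; push_cast; ring
          rw [this]
          exact qnum_intCast_ne_zero hs (by omega)
        · have := hg.pos_ne d (i := k) (j := j) (by simp; omega) (by simp; omega) hkj (m + 1) m 1
          simpa using this
      rw [← mul_div_assoc, eq_div_iff hB]
      have h := qfall_add_one s (L k - pos L d m j) (d (m + 1) k).toNat
      rw [hd.toNat_cast] at h
      rw [show L k - (pos L d m j - 1) = L k - pos L d m j + 1 by ring, ← h]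
      congr 2
      simp only [pos]; ring
    · simp [hji]

theorem upFactor_add_box_above (hg : Generic s L n) (hd : Adm n d) (hm : m + 1 < n)
    (hi : i ∈ Finset.Icc 1 (m + 1)) :
    upFactor s L (d + box (m + 1) i) m = upFactor s L d m *
      ∏ k ∈ Finset.Ico 1 i,
        qnum s (L k - pos L d (m + 1) i) / qnum s (pos L d m k - pos L d (m + 1) i) := by
  have hi' := Finset.mem_Icc.1 hi
  unfold upFactor
  rw [prod_pairs_change (f := fun i j => qfall s (L i - pos L d (m + 1) j - 1) (d m i).toNat)
    (i := i) (c' := fun k => qnum s (L k - pos L d (m + 1) i) /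
      qnum s (pos L d m k - pos L d (m + 1) i)) (c := fun _ => 1) _ _
    (fun _ _ => rfl)]
  · simp only [Finset.prod_const_one, one_mul]
    congr 1
    refine Finset.prod_congr ?_ fun _ _ => rfl
    ext k
    simp only [Finset.mem_filter, Finset.mem_Icc, Finset.mem_Ico, Finset.mem_Ioc]
    omega
  · intro k hk j hj
    have hk' := Finset.mem_Icc.1 hk
    have hj' := Finset.mem_Ioc.1 hj
    rw [pos_add_box, hd.toNat_add_box, if_neg (c := m = m + 1 ∧ k = i) (by omega), add_zero]
    by_cases hji : j = i
    · subst hji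
      simp only [if_true, and_self, ite_self, one_mul]
      have hB : qnum s (pos L d m k - pos L d (m + 1) j) ≠ 0 :=
        hg.pos_ne' d (i := k) (j := j) (by simp; omega) (by simp; omega) (by omega) m (m + 1)
      rw [← mul_div_assoc, eq_div_iff hB]
      have h := qfall_add_one s (L k - pos L d (m + 1) j - 1) (d m k).toNat
      rw [hd.toNat_cast, sub_add_cancel] at h
      rw [show L k - (pos L d (m + 1) j - 1) - 1 = L k - pos L d (m + 1) j by ring, ← h]
      congr 2
      simp only [pos]; ring
    · simp [hji]

theorem downFactor_add_box_above (hd : Adm n d) (hi : i ∈ Finset.Icc 1 (m + 1)) :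
    downFactor s L (d + box (m + 1) i) m = downFactor s L d m *
      ∏ j ∈ Finset.Ico i (m + 1), qnum s (pos L d (m + 1) i - pos L d m j) := by
  unfold downFactor
  rw [prod_pairs_change (f := fun i j => qfall s (L i - pos L d m j) (d (m + 1) i).toNat)
    (i := i) (c := fun j => qnum s (pos L d (m + 1) i - pos L d m j)) (c' := fun _ => 1) _ _
    (fun h => absurd hi h)]
  · simp
  · intro k _ j _
    rw [pos_add_box, if_neg (by omega), sub_zero, hd.toNat_add_box]
    by_cases hk : k = i
    · subst hk
      simp only [if_true, and_self, ite_self, mul_one]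
      rw [qfall_succ, hd.toNat_cast]
      congr 2
      simp only [pos]; ring
    · simp [hk]

theorem rowFactor_add_box (hg : Generic s L n) (hd : Adm n d) (hm : m < n)
    (hi : i ∈ Finset.Icc 1 m) :
    rowFactor s L (d + box m i) m = rowFactor s L d m *
      ((∏ k ∈ Finset.Ico 1 i, qnum s (L k - pos L d m i + 1) / qnum s (L k - pos L d m i)) /
       ((∏ j ∈ Finset.Ioc i m,
          qnum s (pos L d m j - pos L d m i + 1) / qnum s (pos L d m j - pos L d m i)) *
        ∏ k ∈ Finset.Ico 1 i,
          qnum s (pos L d m k - pos L d m i + 1) / qnum s (pos L d m k - pos L d m i)) *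
       qnum s (L i - pos L d m i + 1)) := by
  have hi' := Finset.mem_Icc.1 hi
  have hfilter : ∀ c' : ℕ → ℝ, ∏ k ∈ Finset.Icc 1 m with i ∈ Finset.Ioc k m, c' k
      = ∏ k ∈ Finset.Ico 1 i, c' k := by
    intro c'
    refine Finset.prod_congr ?_ fun _ _ => rfl
    ext k
    simp only [Finset.mem_filter, Finset.mem_Icc, Finset.mem_Ico, Finset.mem_Ioc]
    omega
  have hmem : ∀ k ∈ Finset.Icc 1 m, k ∈ Finset.Icc 1 n := fun k hk => by simp at hk ⊢; omega
  unfold rowFactor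
  rw [prod_pairs_change (f := fun i j => qnum s (L i - pos L d m j)) (i := i)
    (f' := fun k j => qnum s (L k - pos L (d + box m i) m j))
    (c' := fun k => qnum s (L k - pos L d m i + 1) / qnum s (L k - pos L d m i))
    (c := fun _ => 1) _ _ (fun _ _ => rfl), hfilter,
    prod_pairs_change (f := fun i j => qnum s (pos L d m i - pos L d m j)) (i := i)
    (f' := fun k j => qnum s (pos L (d + box m i) m k - pos L (d + box m i) m j))
    (c' := fun k => qnum s (pos L d m k - pos L d m i + 1) / qnum s (pos L d m k - pos L d m i))
    (c := fun j => qnum s (pos L d m j - pos L d m i + 1) / qnum s (pos L d m j - pos L d m i))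
    _ _ (fun h => absurd hi h), hfilter]
  · have hq : ∏ k ∈ Finset.Icc 1 m,
        qfall s (L k - pos L (d + box m i) m k) ((d + box m i) m k).toNat
        = (∏ k ∈ Finset.Icc 1 m, qfall s (L k - pos L d m k) (d m k).toNat) *
          qnum s (L i - pos L d m i + 1) := by
      rw [← Finset.mul_prod_erase _ _ hi, ← Finset.mul_prod_erase _
        (fun k => qfall s (L k - pos L d m k) _) hi, Finset.prod_congr rfl
        (g := fun k => qfall s (L k - pos L d m k) (d m k).toNat)]
      · rw [pos_add_box, hd.toNat_add_box, if_pos ⟨rfl, rfl⟩, if_pos ⟨rfl, rfl⟩]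
        have h := qfall_succ s (L i - pos L d m i + 1) (d m i).toNat
        have h2 := qfall_add_one s (L i - pos L d m i) (d m i).toNat
        rw [show L i - (pos L d m i - 1) = L i - pos L d m i + 1 by ring, h, h2]
        ring
      · intro k hk
        have hne := Finset.ne_of_mem_erase hk
        rw [pos_add_box, hd.toNat_add_box, if_neg (by tauto), if_neg (by tauto), sub_zero,
          add_zero]
    rw [hq]
    simp only [Finset.prod_const_one, one_mul]
    ring
  · intro k hk j hj
    have hk' := Finset.mem_Icc.1 hk
    have hj' := Finset.mem_Ioc.1 hj
    rw [pos_add_box, pos_add_box]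
    by_cases hki : k = i
    · subst hki
      have hne : j ≠ k := by omega
      have hB := hg.pos_ne' d (hmem j (by simp; omega)) (hmem k hk) hne m m
      simp only [true_and, if_true, hne, if_false, and_false, mul_one, sub_zero]
      rw [show pos L d m k - 1 - pos L d m j = -(pos L d m j - pos L d m k + 1) by ring,
        show pos L d m k - pos L d m j = -(pos L d m j - pos L d m k) by ring, qnum_neg, qnum_neg]
      field_simp
    · simp only [hki, and_false, if_false, one_mul, sub_zero]
      by_cases hji : j = i
      · subst hji
        have hB := hg.pos_ne' d (hmem k hk) (hmem j hi) hki m m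
        simp only [true_and, if_true]
        rw [show pos L d m k - (pos L d m j - 1) = pos L d m k - pos L d m j + 1 by ring]
        field_simp
      · simp [hji]
  · intro k hk j hj
    have hk' := Finset.mem_Icc.1 hk
    have hj' := Finset.mem_Ioc.1 hj
    rw [pos_add_box]
    by_cases hji : j = i
    · subst hji
      have hB := L_sub_qnum_ne_zero hg d (hmem k hk) (hmem j hi) (by omega) m 0
      simp only [Int.cast_zero, add_zero] at hB
      simp only [true_and, if_true, ite_self, one_mul]
      rw [show L k - (pos L d m j - 1) = L k - pos L d m j + 1 by ring]
      field_simp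
    · simp [hji]

theorem rowFactor_add_box_of_ne {k : ℕ} (h : k ≠ m) :
    rowFactor s L (d + box m i) k = rowFactor s L d k := by
  have h1 : ∀ j, pos L (d + box m i) k j = pos L d k j := fun j => by
    rw [pos_add_box, if_neg (by tauto), sub_zero]
  have h2 : ∀ j, (d + box m i) k j = d k j := fun j => by
    rw [Pi.add_apply, Pi.add_apply, box_apply, if_neg (by tauto), add_zero]
  simp only [rowFactor, h1, h2]

theorem upFactor_add_box_of_ne {k : ℕ} (h : k ≠ m) (h' : k + 1 ≠ m) :
    upFactor s L (d + box m i) k = upFactor s L d k := by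
  have h1 : ∀ j, pos L (d + box m i) (k + 1) j = pos L d (k + 1) j := fun j => by
    rw [pos_add_box, if_neg (by tauto), sub_zero]
  have h2 : ∀ j, (d + box m i) k j = d k j := fun j => by
    rw [Pi.add_apply, Pi.add_apply, box_apply, if_neg (by tauto), add_zero]
  simp only [upFactor, h1, h2]

theorem downFactor_add_box_of_ne {k : ℕ} (h : k ≠ m) (h' : k + 1 ≠ m) :
    downFactor s L (d + box m i) k = downFactor s L d k := by
  have h1 : ∀ j, pos L (d + box m i) k j = pos L d k j := fun j => by
    rw [pos_add_box, if_neg (by tauto), sub_zero]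
  have h2 : ∀ j, (d + box m i) (k + 1) j = d (k + 1) j := fun j => by
    rw [Pi.add_apply, Pi.add_apply, box_apply, if_neg (by tauto), add_zero]
  simp only [downFactor, h1, h2]

end change

/-! ### Ratios of neighbouring norms -/

section norm

variable {s : ℝ} {L : ℕ → ℝ} {n : ℕ} {d : Arr} {m i : ℕ}

/-- A box in a row affects only the factors indexed by that row and by the row below. The row is
written m + 1 so that the row below has an index without subtraction. -/
theorem gtNorm_add_box_eq (hg : Generic s L n) (hs : Irrational s) (hd : Adm n d) (hm : m + 1 < n)
    (hi : i ∈ Finset.Icc 1 (m + 1)) :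
    gtNorm s L n (d + box (m + 1) i) = gtNorm s L n d *
      (((∏ k ∈ Finset.Ico 1 i,
          qnum s (L k - pos L d (m + 1) i + 1) / qnum s (L k - pos L d (m + 1) i)) /
       ((∏ j ∈ Finset.Ioc i (m + 1), qnum s (pos L d (m + 1) j - pos L d (m + 1) i + 1) /
            qnum s (pos L d (m + 1) j - pos L d (m + 1) i)) *
        ∏ k ∈ Finset.Ico 1 i, qnum s (pos L d (m + 1) k - pos L d (m + 1) i + 1) /
          qnum s (pos L d (m + 1) k - pos L d (m + 1) i)) *
       qnum s (L i - pos L d (m + 1) i + 1)) *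
      ((∏ j ∈ Finset.Ioc i (m + 1 + 1), qnum s (pos L d (m + 1) i - pos L d (m + 1 + 1) j - 1)) /
        ∏ k ∈ Finset.Icc 1 i, qnum s (L k - pos L d (m + 1) i + 1) /
          qnum s (pos L d (m + 1 + 1) k - pos L d (m + 1) i + 1)) *
      ((∏ k ∈ Finset.Ico 1 i,
        qnum s (L k - pos L d (m + 1) i) / qnum s (pos L d m k - pos L d (m + 1) i)) /
        ∏ j ∈ Finset.Ico i (m + 1), qnum s (pos L d (m + 1) i - pos L d m j))) := by
  have hm1 : m + 1 ∈ Finset.range n := Finset.mem_range.2 hm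
  have hm0 : m ∈ (Finset.range n).erase (m + 1) := by simp; omega
  unfold gtNorm
  rw [← Finset.mul_prod_erase _ _ hm1, ← Finset.mul_prod_erase _ _ hm0,
    ← Finset.mul_prod_erase _ (fun k => rowFactor s L d k * _ / _) hm1,
    ← Finset.mul_prod_erase _ (fun k => rowFactor s L d k * _ / _) hm0,
    Finset.prod_congr rfl (g := fun k => rowFactor s L d k * upFactor s L d k /
      downFactor s L d k),
    rowFactor_add_box hg hd hm hi, upFactor_add_box hd hi, downFactor_add_box hg hs hd hm hi,
    rowFactor_add_box_of_ne (by omega), upFactor_add_box_above hg hd hm hi,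
    downFactor_add_box_above hd hi]
  · simp only [div_eq_mul_inv, mul_inv]
    ring
  · intro k hk
    have h1 := Finset.ne_of_mem_erase hk
    have h2 := Finset.ne_of_mem_erase (Finset.mem_of_mem_erase hk)
    rw [rowFactor_add_box_of_ne h2, upFactor_add_box_of_ne h2 (by omega),
      downFactor_add_box_of_ne h2 (by omega)]

theorem prod_erase_Icc (f : ℕ → ℝ) {m i : ℕ} (hi : i ∈ Finset.Icc 1 m) :
    ∏ l ∈ (Finset.Icc 1 m).erase i, f l
      = (∏ l ∈ Finset.Ico 1 i, f l) * ∏ l ∈ Finset.Ioc i m, f l := by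
  have hi' := Finset.mem_Icc.1 hi
  rw [← Finset.prod_union]
  · refine Finset.prod_congr ?_ fun _ _ => rfl
    ext k
    simp only [Finset.mem_erase, Finset.mem_Icc, Finset.mem_union, Finset.mem_Ico, Finset.mem_Ioc]
    omega
  · rw [Finset.disjoint_left]
    intro k h1 h2
    simp only [Finset.mem_Ico, Finset.mem_Ioc] at h1 h2
    omega

theorem prod_Icc_split (f : ℕ → ℝ) {m i : ℕ} (hi : i ≤ m) :
    ∏ l ∈ Finset.Icc 1 m, f l
      = (∏ l ∈ Finset.Icc 1 i, f l) * ∏ l ∈ Finset.Ioc i m, f l := by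
  rw [← Finset.prod_union]
  · refine Finset.prod_congr ?_ fun _ _ => rfl
    ext k
    simp only [Finset.mem_Icc, Finset.mem_union, Finset.mem_Ioc]
    omega
  · rw [Finset.disjoint_left]
    intro k h1 h2
    simp only [Finset.mem_Icc, Finset.mem_Ioc] at h1 h2
    omega

theorem prod_Icc_split' (f : ℕ → ℝ) {m i : ℕ} (hi1 : 1 ≤ i) (hi : i ≤ m + 1) :
    ∏ l ∈ Finset.Icc 1 m, f l
      = (∏ l ∈ Finset.Ico 1 i, f l) * ∏ l ∈ Finset.Ico i (m + 1), f l := by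
  rw [← Finset.prod_union]
  · refine Finset.prod_congr ?_ fun _ _ => rfl
    ext k
    simp only [Finset.mem_Icc, Finset.mem_union, Finset.mem_Ico]
    omega
  · rw [Finset.disjoint_left]
    intro k h1 h2
    simp only [Finset.mem_Ico] at h1 h2
    omega

/-- The norms are compatible with the adjointness of `e_m` and `f_m`. -/
theorem gtNorm_add_box (hg : Generic s L n) (hs : Irrational s) (hd : Adm n d)
    (hm1 : 1 ≤ m) (hm : m < n) (hi : i ∈ Finset.Icc 1 m) (hd' : Adm n (d + box m i)) :
    gtNorm s L n (d + box m i) * lowerCoeff s L d m i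
      = gtNorm s L n d * raiseCoeff s L (d + box m i) m i := by
  obtain ⟨m, rfl⟩ := Nat.exists_eq_add_of_le' hm1
  have hi' := Finset.mem_Icc.1 hi
  have hmem : ∀ k, 1 ≤ k → k ≤ m + 1 + 1 → k ∈ Finset.Icc 1 n := fun k h1 h2 => by simp; omega
  rw [gtNorm_add_box_eq hg hs hd hm hi, lowerCoeff, raiseCoeff, rowNum_add_box_self s L d (by omega),
    rowDen_add_box_self, rowNum, rowDen, Nat.add_sub_cancel, prod_erase_Icc _ hi,
    prod_erase_Icc _ hi, prod_Icc_split' _ hi'.1 hi'.2,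
    prod_Icc_split _ (show i ≤ m + 1 + 1 by omega)]
  set x := pos L d (m + 1) i with hx
  simp only [Finset.prod_div_distrib, sub_sub_eq_add_sub, add_sub_right_comm _ (1 : ℝ) x]
  have hIcc : ∏ k ∈ Finset.Icc 1 i, qnum s (L k - x + 1)
      = (∏ k ∈ Finset.Ico 1 i, qnum s (L k - x + 1)) * qnum s (L i - x + 1) := by
    rw [← Finset.prod_Ico_mul_eq_prod_Icc hi'.1]
  -- The norm uses differences opposite to those in the coefficients. Row m yields m + 1 - i signs
  -- and row m + 2 one more, which the minus sign in `raiseCoeff` absorbs.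
  have hz : ∏ j ∈ Finset.Ico i (m + 1), qnum s (pos L d m j - x)
      = (-1) ^ (m + 1 - i) * ∏ j ∈ Finset.Ico i (m + 1), qnum s (x - pos L d m j) := by
    rw [← Nat.card_Ico, ← Finset.prod_const, ← Finset.prod_mul_distrib]
    refine Finset.prod_congr rfl fun j _ => ?_
    rw [neg_one_mul, ← qnum_neg, neg_sub]
  have hy : ∏ j ∈ Finset.Ioc i (m + 1 + 1), qnum s (pos L d (m + 1 + 1) j - x + 1)
      = -((-1) ^ (m + 1 - i)) *
        ∏ j ∈ Finset.Ioc i (m + 1 + 1), qnum s (x - pos L d (m + 1 + 1) j - 1) := by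
    have : -((-1 : ℝ) ^ (m + 1 - i)) = (-1) ^ (m + 1 + 1 - i) := by
      rw [Nat.sub_add_comm hi'.2, pow_succ, mul_neg_one]
    rw [this, ← Nat.card_Ioc, ← Finset.prod_const, ← Finset.prod_mul_distrib]
    refine Finset.prod_congr rfl fun j _ => ?_
    rw [neg_one_mul, ← qnum_neg]
    congr 1
    ring
  rw [hIcc, hz, hy]
  have n1 : ∏ k ∈ Finset.Ico 1 i, qnum s (L k - x + 1) ≠ 0 :=
    Finset.prod_ne_zero_iff.2 fun k hk => by
      have hk := Finset.mem_Ico.1 hk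
      simpa using L_sub_qnum_ne_zero hg d (hmem k hk.1 (by omega)) (hmem i hi'.1 (by omega))
        (by omega) (m + 1) 1
  have n2 : ∏ k ∈ Finset.Ico 1 i, qnum s (L k - x) ≠ 0 :=
    Finset.prod_ne_zero_iff.2 fun k hk => by
      have hk := Finset.mem_Ico.1 hk
      simpa using L_sub_qnum_ne_zero hg d (hmem k hk.1 (by omega)) (hmem i hi'.1 (by omega))
        (by omega) (m + 1) 0
  have n3 : qnum s (L i - x + 1) ≠ 0 := by
    rw [hx, L_sub_pos]
    have := hd.nonneg (m + 1) i
    exact_mod_cast qnum_intCast_ne_zero hs (k := d (m + 1) i + 1) (by omega)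
  have n4 : ∏ k ∈ Finset.Ico 1 i, qnum s (pos L d (m + 1) k - x) ≠ 0 :=
    Finset.prod_ne_zero_iff.2 fun k hk => by
      have hk := Finset.mem_Ico.1 hk
      exact hg.pos_ne' d (hmem k hk.1 (by omega)) (hmem i hi'.1 (by omega)) (by omega) _ _
  have n5 : ∏ k ∈ Finset.Ioc i (m + 1), qnum s (pos L d (m + 1) k - x) ≠ 0 :=
    Finset.prod_ne_zero_iff.2 fun k hk => by
      have hk := Finset.mem_Ioc.1 hk
      exact hg.pos_ne' d (hmem k (by omega) (by omega)) (hmem i hi'.1 (by omega)) (by omega) _ _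
  have n6 : ∏ k ∈ Finset.Ico 1 i, qnum s (pos L d m k - x) ≠ 0 :=
    Finset.prod_ne_zero_iff.2 fun k hk => by
      have hk := Finset.mem_Ico.1 hk
      exact hg.pos_ne' d (hmem k hk.1 (by omega)) (hmem i hi'.1 (by omega)) (by omega) _ _
  -- The factor of column i is nonzero because the array with the added box is admissible: before
  -- the addition the entry of row m exceeds that of row m + 1 strictly.
  have n7 : ∏ k ∈ Finset.Ico i (m + 1), qnum s (x - pos L d m k) ≠ 0 :=
    Finset.prod_ne_zero_iff.2 fun k hk => by
      have hk := Finset.mem_Ico.1 hk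
      refine hg.qnum_pos_ne_zero hs (hmem i hi'.1 (by omega)) (hmem k (by omega) (by omega)) ?_
      rintro rfl
      have := hd'.step m i hi'.1 (by omega) (by omega)
      simp [box_apply] at this
      omega
  generalize ∏ k ∈ Finset.Ico 1 i, qnum s (L k - x + 1) = a1 at *
  generalize ∏ k ∈ Finset.Ico 1 i, qnum s (L k - x) = a2 at *
  generalize qnum s (L i - x + 1) = a3 at *
  generalize ∏ k ∈ Finset.Ico 1 i, qnum s (pos L d (m + 1) k - x) = a4 at *
  generalize ∏ k ∈ Finset.Ioc i (m + 1), qnum s (pos L d (m + 1) k - x) = a5 at *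
  generalize ∏ k ∈ Finset.Ico 1 i, qnum s (pos L d m k - x) = a6 at *
  generalize ∏ k ∈ Finset.Ico i (m + 1), qnum s (x - pos L d m k) = a7 at *
  field_simp

theorem gtNorm_ne_zero (hg : Generic s L n) (hs : Irrational s) (hd : Adm n d) :
    gtNorm s L n d ≠ 0 := by
  refine Finset.prod_ne_zero_iff.2 fun m hm => ?_
  have hm := Finset.mem_range.1 hm
  have hmem : ∀ k, 1 ≤ k → k ≤ m + 1 → k ∈ Finset.Icc 1 n := fun k h1 h2 => by simp; omega
  refine div_ne_zero (mul_ne_zero (mul_ne_zero (div_ne_zero ?_ ?_) ?_) ?_) ?_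
  · refine Finset.prod_ne_zero_iff.2 fun i hi => Finset.prod_ne_zero_iff.2 fun j hj => ?_
    have hi := Finset.mem_Icc.1 hi
    have hj := Finset.mem_Ioc.1 hj
    simpa using L_sub_qnum_ne_zero hg d (hmem i hi.1 (by omega)) (hmem j (by omega) (by omega))
      (by omega) m 0
  · refine Finset.prod_ne_zero_iff.2 fun i hi => Finset.prod_ne_zero_iff.2 fun j hj => ?_
    have hi := Finset.mem_Icc.1 hi
    have hj := Finset.mem_Ioc.1 hj
    exact hg.pos_ne' d (hmem i hi.1 (by omega)) (hmem j (by omega) (by omega)) (by omega) _ _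
  · refine Finset.prod_ne_zero_iff.2 fun i hi => qfall_ne_zero fun k hk => ?_
    rw [L_sub_pos]
    have := hd.nonneg m i
    exact_mod_cast qnum_intCast_ne_zero hs (k := d m i - k) (by omega)
  · refine Finset.prod_ne_zero_iff.2 fun i hi => Finset.prod_ne_zero_iff.2 fun j hj =>
      qfall_ne_zero fun k _ => ?_
    have hi := Finset.mem_Icc.1 hi
    have hj := Finset.mem_Ioc.1 hj
    have := L_sub_qnum_ne_zero hg d (hmem i hi.1 (by omega)) (hmem j (by omega) (by omega))
      (by omega) (m + 1) (-1 - k)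
    convert this using 2
    push_cast
    ring
  · refine Finset.prod_ne_zero_iff.2 fun i hi => Finset.prod_ne_zero_iff.2 fun j hj =>
      qfall_ne_zero fun k hk => ?_
    have hi := Finset.mem_Icc.1 hi
    have hj := Finset.mem_Ico.1 hj
    by_cases hij : i = j
    · subst hij
      have h1 := hd.step m i hi.1 (by omega) hm
      have h2 := hd.nonneg (m + 1) i
      rw [L_sub_pos]
      exact_mod_cast qnum_intCast_ne_zero hs (k := d m i - k) (by omega)
    · have := L_sub_qnum_ne_zero hg d (hmem i hi.1 (by omega)) (hmem j (by omega) (by omega))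
        hij m (-k)
      convert this using 2
      push_cast
      ring

theorem gtNorm_zero (hg : Generic s L n) : gtNorm s L n 0 = 1 := by
  refine Finset.prod_eq_one fun m hm => ?_
  have hm := Finset.mem_range.1 hm
  have h0 : ∀ m i, pos L 0 m i = L i := fun m i => by simp [pos]
  simp only [rowFactor, upFactor, downFactor, h0, Pi.zero_apply, Int.toNat_zero, qfall_zero,
    Finset.prod_const_one, mul_one, div_one]
  refine div_self (Finset.prod_ne_zero_iff.2 fun i hi => Finset.prod_ne_zero_iff.2 fun j hj => ?_)
  have hi := Finset.mem_Icc.1 hi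
  have hj := Finset.mem_Ioc.1 hj
  simpa using hg i (by simp; omega) j (by simp; omega) (by omega) 0

end norm

/-! ### Serre relations -/

/-- The quantum Serre expression. -/
def serre {A : Type*} [Ring A] [Algebra ℂ A] (q : ℂ) (a b : A) : A :=
  a * a * b - (q + q⁻¹) • (a * b * a) + b * a * a

/-- A reassociated form of a commutation rule, so that `simp` can apply it inside right-nested
products. -/
theorem mul_mul_eq_of_eq {A : Type*} [Semigroup A] {a b c : A} (h : a * b = c) (x : A) :
    a * (b * x) = c * x := by rw [← mul_assoc, h]

theorem commutator_mul_comm_symm {A : Type*} [Ring A] {e e' f : A}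
    (h : (e * e' - e' * e) * f = f * (e * e' - e' * e)) :
    (e' * e - e * e') * f = f * (e' * e - e * e') := by
  rw [← neg_sub, neg_mul, mul_neg, h]

theorem commutator_mul_comm_of_comm {A : Type*} [Ring A] {e e' f : A}
    (hef : e * f = f * e) (hef' : e' * f = f * e') :
    (e * e' - e' * e) * f = f * (e * e' - e' * e) := by
  simp only [mul_sub, sub_mul, mul_assoc, hef, hef', mul_mul_eq_of_eq hef, mul_mul_eq_of_eq hef']

/-! ### Serre elements and commutators against a lowering operator -/

section abstract

variable {A : Type*} [Ring A] [Algebra ℂ A] {e e' f K K' : A} {q c : ℂ}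

/-- Here e, f belong to the same index and K, K' model t_m t_{m+1}⁻¹ and its inverse. Moving f to
the left leaves terms in which K or K' replaces one copy of e; once K and K' are moved to the right,
their coefficients in q cancel. -/
theorem serre_mul_comm_left (hq : q ≠ 0) (hef : e * f = f * e + c • (K - K'))
    (hef' : e' * f = f * e') (hK : K * e = (q * q) • (e * K))
    (hK' : K' * e = (q⁻¹ * q⁻¹) • (e * K')) (hKe : K * e' = q⁻¹ • (e' * K))
    (hKe' : K' * e' = q • (e' * K')) : serre q e e' * f = f * serre q e e' := by
  simp only [serre, mul_add, add_mul, mul_sub, sub_mul, mul_assoc, smul_mul_assoc, mul_smul_comm,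
    hef, hef', hK, hK', hKe, hKe', mul_mul_eq_of_eq hef, mul_mul_eq_of_eq hef',
    mul_mul_eq_of_eq hK, mul_mul_eq_of_eq hK', mul_mul_eq_of_eq hKe, mul_mul_eq_of_eq hKe',
    smul_add, smul_sub, smul_smul]
  match_scalars <;> field_simp <;> ring

/-- Now f pairs with the simple factor e', so K and K' only need to be moved past the two copies of
e. -/
theorem serre_mul_comm_right (hq : q ≠ 0) (hef : e * f = f * e)
    (hef' : e' * f = f * e' + c • (K - K')) (hKe : K * e = q⁻¹ • (e * K))
    (hKe' : K' * e = q • (e * K')) : serre q e e' * f = f * serre q e e' := by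
  simp only [serre, mul_add, add_mul, mul_sub, sub_mul, mul_assoc, smul_mul_assoc, mul_smul_comm,
    hef, hef', hKe, hKe', mul_mul_eq_of_eq hef, mul_mul_eq_of_eq hef',
    mul_mul_eq_of_eq hKe, mul_mul_eq_of_eq hKe',
    smul_add, smul_sub, smul_smul]
  match_scalars <;> field_simp <;> ring

theorem serre_mul_comm_of_comm (hef : e * f = f * e) (hef' : e' * f = f * e') :
    serre q e e' * f = f * serre q e e' := by
  simp only [serre, mul_add, add_mul, mul_sub, sub_mul, mul_assoc, smul_mul_assoc, mul_smul_comm,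
    hef, hef', mul_mul_eq_of_eq hef, mul_mul_eq_of_eq hef']

theorem commutator_mul_comm (hef : e * f = f * e + c • (K - K')) (hef' : e' * f = f * e')
    (hK : K * e' = e' * K) (hK' : K' * e' = e' * K') :
    (e * e' - e' * e) * f = f * (e * e' - e' * e) := by
  simp only [mul_add, add_mul, mul_sub, sub_mul, mul_assoc, smul_mul_assoc, mul_smul_comm,
    hef, hef', mul_mul_eq_of_eq hef, mul_mul_eq_of_eq hef', hK, hK']
  abel

end abstract

/-! ### Relations among the raising operators -/

section module

variable {s : ℝ} {L : ℕ → ℝ} {n : ℕ}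

/-- The operator `t_m t_{m+1}⁻¹`, or its inverse for `ε = -1`. -/
def cartanOp (s : ℝ) (L : ℕ → ℝ) (ε : ℝ) (m : ℕ) : (Arr →₀ ℂ) →ₗ[ℂ] (Arr →₀ ℂ) :=
  diagOp fun d => qpow s (ε * (wtAt L d m - wtAt L d (m + 1)))

theorem diagOp_sub (c c' : Arr → ℂ) (v : Arr →₀ ℂ) :
    diagOp (fun d => c d - c' d) v = diagOp c v - diagOp c' v := by
  induction v using Finsupp.induction_linear with
  | zero => simp
  | add f g hf hg => simp only [map_add, hf, hg]; abel
  | single d z => simp only [diagOp_single, ← Finsupp.single_sub]; congr 1; ring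

theorem diagOp_const_mul (a : ℂ) (c : Arr → ℂ) (v : Arr →₀ ℂ) :
    diagOp (fun d => a * c d) v = a • diagOp c v := by
  induction v using Finsupp.induction_linear with
  | zero => simp
  | add f g hf hg => simp only [map_add, hf, hg, smul_add]
  | single d z =>
    simp only [diagOp_single, Finsupp.smul_single, smul_eq_mul]; congr 1; ring

theorem raiseOp_lowerOp (hs : Irrational s) (hg : Generic s L n) {m : ℕ}
    (hm1 : 1 ≤ m) (hm : m < n) (v : Arr →₀ ℂ) :
    raiseOp s L m (lowerOp s L m v) = lowerOp s L m (raiseOp s L m v) +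
      (qOf s - (qOf s)⁻¹)⁻¹ • (cartanOp s L 1 m v - cartanOp s L (-1) m v) := by
  rw [← sub_eq_iff_eq_add', raiseOp_lowerOp_self hs hg hm1 hm, cartanOp, cartanOp, ← diagOp_sub,
    ← diagOp_const_mul]
  congr 2
  funext d
  rw [qnum_eq, one_mul, neg_one_mul, div_eq_inv_mul]

theorem cartanOp_raiseOp (ε : ℝ) {k m : ℕ} (hk : 1 ≤ k) (v : Arr →₀ ℂ) :
    cartanOp s L ε k (raiseOp s L m v) =
      qpow s (ε * (rootExp k m - rootExp (k + 1) m : ℤ)) • raiseOp s L m (cartanOp s L ε k v) := by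
  refine diagOp_raiseOp s L m (fun d i hi => ?_) v
  rw [wtAt_sub_box L d hi hk, wtAt_sub_box L d hi (by omega)]
  push_cast
  ring

/-- An operator that kills the top array and commutes with all `f_m` vanishes on the span of the
admissible arrays. -/
theorem eq_zero_of_commute (hg : Generic s L n) (hs : Irrational s)
    (S : Module.End ℂ (Arr →₀ ℂ)) (h0 : S (Finsupp.single 0 1) = 0)
    (hS : ∀ m, 1 ≤ m → m < n → S * lowerOp s L m = lowerOp s L m * S) :
    ∀ v ∈ admSpace n, S v = 0 := by
  intro v hv
  have : admSpace n ≤ LinearMap.ker S := by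
    refine admSpace_le_of_lowerOp_stable hg hs h0 fun m h1 h2 v hv => ?_
    have := LinearMap.congr_fun (hS m h1 h2) v
    rw [LinearMap.mem_ker] at hv ⊢
    rw [Module.End.mul_apply, Module.End.mul_apply, hv, map_zero] at this
    exact this
  exact this hv

theorem raiseOp_mul_lowerOp (hs : Irrational s) (hg : Generic s L n) {m : ℕ}
    (hm1 : 1 ≤ m) (hm : m < n) :
    (raiseOp s L m * lowerOp s L m : Module.End ℂ (Arr →₀ ℂ)) = lowerOp s L m * raiseOp s L m +
      (qOf s - (qOf s)⁻¹)⁻¹ • (cartanOp s L 1 m - cartanOp s L (-1) m) :=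
  LinearMap.ext (raiseOp_lowerOp hs hg hm1 hm)

theorem raiseOp_mul_lowerOp_of_ne (hg : Generic s L n) {m m' : ℕ} (hm : m < n) (hm' : m' < n)
    (hne : m ≠ m') :
    (raiseOp s L m * lowerOp s L m' : Module.End ℂ (Arr →₀ ℂ)) = lowerOp s L m' * raiseOp s L m :=
  LinearMap.ext (raiseOp_lowerOp_of_ne hg hm hm' hne)

theorem cartanOp_mul_raiseOp {k m : ℕ} (hk : 1 ≤ k) {ε : ℝ} {z : ℤ}
    (hz : ε * (rootExp k m - rootExp (k + 1) m : ℤ) = z) :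
    (cartanOp s L ε k * raiseOp s L m : Module.End ℂ (Arr →₀ ℂ))
      = (qOf s ^ z) • (raiseOp s L m * cartanOp s L ε k) := by
  refine LinearMap.ext fun v => ?_
  rw [← qpow_intCast, ← hz]
  exact cartanOp_raiseOp ε hk v

/-- Commutation with f_k is one of three abstract computations, according to whether k is m, l or
neither; the top array is killed because each e_m kills it. -/
theorem serre_raiseOp (hs : Irrational s) (hg : Generic s L n) {m l : ℕ} (hm1 : 1 ≤ m)
    (hm : m < n) (hl1 : 1 ≤ l) (hl : l < n) (h : m + 1 = l ∨ l + 1 = m) :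
    ∀ v ∈ admSpace n,
      serre (A := Module.End ℂ (Arr →₀ ℂ)) (qOf s) (raiseOp s L m) (raiseOp s L l) v = 0 := by
  refine eq_zero_of_commute hg hs _ ?_ fun k hk1 hk => ?_
  · simp [serre, raiseOp_top]
  have hq : qOf s ≠ 0 := qpow_ne_zero s 1
  by_cases hkm : k = m
  · subst hkm
    refine serre_mul_comm_left hq (raiseOp_mul_lowerOp hs hg hk1 hk)
      (raiseOp_mul_lowerOp_of_ne hg hl hk (by omega)) ?_ ?_ ?_ ?_
    · rw [cartanOp_mul_raiseOp hk1 (z := 2) (by simp [rootExp])]; rw [zpow_two]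
    · rw [cartanOp_mul_raiseOp hk1 (z := -2) (by simp [rootExp]), zpow_neg, zpow_two,
        mul_inv]
    · rw [cartanOp_mul_raiseOp hk1 (z := -1) (by rcases h with rfl | rfl <;> simp [rootExp] <;> omega),
        zpow_neg_one]
    · rw [cartanOp_mul_raiseOp hk1 (z := 1) (by rcases h with rfl | rfl <;> simp [rootExp] <;> omega),
        zpow_one]
  by_cases hkl : k = l
  · subst hkl
    refine serre_mul_comm_right hq (raiseOp_mul_lowerOp_of_ne hg hm hk (by omega))
      (raiseOp_mul_lowerOp hs hg hk1 hk) ?_ ?_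
    · rw [cartanOp_mul_raiseOp hk1 (z := -1) (by rcases h with rfl | rfl <;> simp [rootExp] <;> omega),
        zpow_neg_one]
    · rw [cartanOp_mul_raiseOp hk1 (z := 1) (by rcases h with rfl | rfl <;> simp [rootExp] <;> omega),
        zpow_one]
  · exact serre_mul_comm_of_comm (raiseOp_mul_lowerOp_of_ne hg hm hk (Ne.symm hkm))
      (raiseOp_mul_lowerOp_of_ne hg hl hk (Ne.symm hkl))

theorem raiseOp_comm_raiseOp (hs : Irrational s) (hg : Generic s L n) {m l : ℕ} (hm1 : 1 ≤ m)
    (hl : l < n) (h : m + 1 < l) :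
    ∀ v ∈ admSpace n, (raiseOp s L m * raiseOp s L l - raiseOp s L l * raiseOp s L m :
      Module.End ℂ (Arr →₀ ℂ)) v = 0 := by
  refine eq_zero_of_commute hg hs _ ?_ fun k hk1 hk => ?_
  · simp [raiseOp_top]
  by_cases hkm : k = m
  · subst hkm
    refine commutator_mul_comm (A := Module.End ℂ (Arr →₀ ℂ)) (raiseOp_mul_lowerOp hs hg hk1 hk)
      (raiseOp_mul_lowerOp_of_ne hg hl hk (by omega)) ?_ ?_ <;>
    · rw [cartanOp_mul_raiseOp hk1 (z := 0), zpow_zero, one_smul]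
      simp only [rootExp]
      rw [if_neg (by omega), if_neg (by omega), if_neg (by omega), if_neg (by omega)]
      simp
  by_cases hkl : k = l
  · subst hkl
    refine commutator_mul_comm_symm (A := Module.End ℂ (Arr →₀ ℂ)) ?_
    refine commutator_mul_comm (A := Module.End ℂ (Arr →₀ ℂ)) (raiseOp_mul_lowerOp hs hg hk1 hk)
      (raiseOp_mul_lowerOp_of_ne hg (by omega) hk (by omega)) ?_ ?_ <;>
    · rw [cartanOp_mul_raiseOp hk1 (z := 0), zpow_zero, one_smul]
      simp only [rootExp]
      rw [if_neg (by omega), if_neg (by omega), if_neg (by omega), if_neg (by omega)]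
      simp
  · have h1 := raiseOp_mul_lowerOp_of_ne hg (m := m) (by omega) hk (Ne.symm hkm)
    have h2 := raiseOp_mul_lowerOp_of_ne hg hl hk (Ne.symm hkl)
    exact commutator_mul_comm_of_comm (A := Module.End ℂ (Arr →₀ ℂ)) h1 h2

end module

/-! ### The Hermitian form on the Gelfand–Tsetlin module -/

/-- The form for which the Gelfand–Tsetlin vectors are orthogonal, with norms `N`. -/
def diagForm (N : Arr → ℝ) : SesqForm (Arr →₀ ℂ) :=
  LinearMap.mk₂'ₛₗ (starRingEnd ℂ) (RingHom.id ℂ)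
    (fun v w => w.sum fun d z => (N d : ℂ) * conj (v d) * z)
    (fun v v' w => by
      simp only [Finsupp.add_apply, map_add, mul_add, add_mul, Finsupp.sum_add])
    (fun c v w => by
      simp only [Finsupp.smul_apply, smul_eq_mul, map_mul, Finsupp.sum]
      rw [Finset.mul_sum]
      exact Finset.sum_congr rfl fun _ _ => by ring)
    (fun v w w' => Finsupp.sum_add_index' (fun _ => by simp) fun _ _ _ => by ring)
    (fun c v w => by
      rw [Finsupp.sum_smul_index (by simp), RingHom.id_apply, smul_eq_mul, Finsupp.sum,
        Finsupp.sum, Finset.mul_sum]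
      exact Finset.sum_congr rfl fun _ _ => by ring)

theorem diagForm_single (N : Arr → ℝ) (v : Arr →₀ ℂ) (d : Arr) (z : ℂ) :
    diagForm N v (Finsupp.single d z) = N d * conj (v d) * z := by
  simp [diagForm, Finsupp.sum_single_index]

open scoped Classical in
theorem diagForm_single_single (N : Arr → ℝ) (d d' : Arr) (z z' : ℂ) :
    diagForm N (Finsupp.single d z) (Finsupp.single d' z')
      = if d = d' then N d * conj z * z' else 0 := by
  rw [diagForm_single, Finsupp.single_apply]
  split_ifs with h
  · rw [h]
  · simp

theorem diagForm_hermitian (N : Arr → ℝ) (v w : Arr →₀ ℂ) :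
    diagForm N w v = conj (diagForm N v w) := by
  induction v using Finsupp.induction_linear with
  | zero => simp
  | add f g hf hg => simp only [map_add, LinearMap.add_apply, hf, hg]
  | single d z =>
    induction w using Finsupp.induction_linear with
    | zero => simp
    | add f g hf hg => simp only [map_add, LinearMap.add_apply, hf, hg]
    | single d' z' =>
      simp only [diagForm_single_single]
      by_cases h : d = d'
      · subst h; simp [mul_right_comm]
      · simp [h, Ne.symm h]

/-- Adjointness of two operators may be checked on a spanning set. -/
theorem adjoint_of_single {n : ℕ} (B : SesqForm (Arr →₀ ℂ)) (S T : (Arr →₀ ℂ) →ₗ[ℂ] (Arr →₀ ℂ))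
    (h : ∀ d d', Adm n d → Adm n d' →
      B (S (Finsupp.single d 1)) (Finsupp.single d' 1)
        = B (Finsupp.single d 1) (T (Finsupp.single d' 1))) :
    ∀ v ∈ admSpace n, ∀ w ∈ admSpace n, B (S v) w = B v (T w) := by
  have h1 : ∀ d, Adm n d → ∀ w ∈ admSpace n,
      B (S (Finsupp.single d 1)) w = B (Finsupp.single d 1) (T w) := by
    intro d hd w hw
    exact admSpace_le (P := LinearMap.eqLocus (B (S (Finsupp.single d 1)))
      ((B (Finsupp.single d 1)).comp T)) (fun d' hd' => h d d' hd hd') hw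
  intro v hv
  rw [admSpace, Finsupp.supported_eq_span_single] at hv
  induction hv using Submodule.span_induction with
  | mem v hv =>
    obtain ⟨d, hd, rfl⟩ := hv
    exact h1 d hd
  | zero => simp
  | add x y _ _ hx hy => intro w hw; simp only [map_add, LinearMap.add_apply, hx w hw, hy w hw]
  | smul a x _ hx =>
    intro w hw
    simp only [map_smul, LinearMap.map_smulₛₗ, LinearMap.smul_apply, hx w hw]

/-! ### The form and the representation on the Gelfand–Tsetlin module -/

section module

variable {s : ℝ} {L : ℕ → ℝ} {n : ℕ}

/-- A matrix entry is possibly nonzero only between arrays that differ by one box of row m, and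
there the claim is `gtNorm_add_box`. -/
theorem raiseOp_adjoint (hs : Irrational s) (hg : Generic s L n) {m : ℕ} (hm1 : 1 ≤ m)
    (hm : m < n) : ∀ v ∈ admSpace n, ∀ w ∈ admSpace n,
      diagForm (gtNorm s L n) (raiseOp s L m v) w = diagForm (gtNorm s L n) v (lowerOp s L m w) := by
  refine adjoint_of_single _ _ _ fun d d' hd hd' => ?_
  rw [raiseOp_single, lowerOp_single, map_sum, map_sum, LinearMap.sum_apply]
  refine Finset.sum_congr rfl fun i hi => ?_
  rw [diagForm_single_single, diagForm_single_single]
  by_cases h : d = d' + box m i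
  · subst h
    rw [add_sub_cancel_right, if_pos rfl, if_pos rfl]
    have := gtNorm_add_box hg hs hd' hm1 hm hi hd
    simp only [one_mul, map_one, mul_one, Complex.conj_ofReal, ← Complex.ofReal_mul]
    rw [this]
  · rw [if_neg h, if_neg (fun h' => h (by rw [← h', sub_add_cancel]))]

theorem diagForm_nondegenerate (hs : Irrational s) (hg : Generic s L n) {v : Arr →₀ ℂ}
    (hv : v ∈ admSpace n) (h : ∀ w ∈ admSpace n, diagForm (gtNorm s L n) v w = 0) : v = 0 := by
  ext d
  by_cases hd : Adm n d
  · have := h _ (single_mem_admSpace hd 1)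
    rw [diagForm_single, mul_one] at this
    have h2 := (mul_eq_zero.1 this).resolve_left (by exact_mod_cast gtNorm_ne_zero hg hs hd)
    simpa using h2
  · exact (Finsupp.mem_supported' ℂ v).1 hv d hd

/-- The Gelfand–Tsetlin module. -/
def GTMod (n : ℕ) : Type := ↥(admSpace n)

instance (n : ℕ) : AddCommGroup (GTMod n) := inferInstanceAs (AddCommGroup ↥(admSpace n))

instance (n : ℕ) : Module ℂ (GTMod n) := inferInstanceAs (Module ℂ ↥(admSpace n))

/-- The inclusion of the Gelfand–Tsetlin module in the space of all combinations of arrays. -/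
def GTMod.val {n : ℕ} : GTMod n →ₗ[ℂ] (Arr →₀ ℂ) := (admSpace n).subtype

/-- A combination of admissible arrays, as an element of the Gelfand–Tsetlin module. -/
def GTMod.mk {n : ℕ} (v : Arr →₀ ℂ) (hv : v ∈ admSpace n) : GTMod n := ⟨v, hv⟩

theorem GTMod.val_mem (v : GTMod n) : v.val ∈ admSpace n := Subtype.property v

theorem GTMod.ext {v w : GTMod n} (h : v.val = w.val) : v = w := Subtype.ext h

/-- The restriction of an operator to the Gelfand–Tsetlin module. -/
def GTMod.restrict (T : (Arr →₀ ℂ) →ₗ[ℂ] (Arr →₀ ℂ)) (h : ∀ v ∈ admSpace n, T v ∈ admSpace n) :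
    Module.End ℂ (GTMod n) :=
  LinearMap.restrict (p := admSpace n) (q := admSpace n) T h

/-- The action of a generator on the Gelfand–Tsetlin module. -/
def gtGen (s : ℝ) (L : ℕ → ℝ) (n : ℕ) : Gen n → Module.End ℂ (GTMod n)
  | .e m => GTMod.restrict (raiseOp s L (m.1 + 1)) fun _ hv => raiseOp_mem s L (by omega) hv
  | .f m => GTMod.restrict (lowerOp s L (m.1 + 1)) fun _ hv => lowerOp_mem s L (by omega) hv
  | .t i => GTMod.restrict (torusOp s L 1 (i.1 + 1)) fun _ hv => diagOp_mem _ hv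
  | .tinv i => (torusOp s L (-1) (i.1 + 1)).restrict fun _ hv => diagOp_mem _ hv

/-- The form on the Gelfand–Tsetlin module. -/
def gtForm (s : ℝ) (L : ℕ → ℝ) (n : ℕ) : SesqForm (GTMod n) :=
  LinearMap.mk₂'ₛₗ (starRingEnd ℂ) (RingHom.id ℂ)
    (fun v w => diagForm (gtNorm s L n) v.val w.val)
    (fun _ _ _ => by simp) (fun _ _ _ => by simp) (fun _ _ _ => by simp) (fun _ _ _ => by simp)

theorem gtForm_apply (v w : GTMod n) :
    gtForm s L n v w = diagForm (gtNorm s L n) v.val w.val := rfl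

theorem gtForm_nondegenerate (hs : Irrational s) (hg : Generic s L n) :
    IsNondegenerate (gtForm s L n) := by
  intro v h
  refine GTMod.ext ?_
  rw [map_zero]
  exact diagForm_nondegenerate hs hg v.val_mem fun w hw => h (GTMod.mk w hw)

theorem gtForm_e_f (hs : Irrational s) (hg : Generic s L n) (m : Fin (n - 1)) (v w : GTMod n) :
    gtForm s L n (gtGen s L n (.e m) v) w = gtForm s L n v (gtGen s L n (.f m) w) :=
  raiseOp_adjoint hs hg (by omega) (by omega) _ v.val_mem _ w.val_mem

theorem gtForm_f_e (hs : Irrational s) (hg : Generic s L n) (m : Fin (n - 1)) (v w : GTMod n) :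
    gtForm s L n (gtGen s L n (.f m) v) w = gtForm s L n v (gtGen s L n (.e m) w) := by
  rw [gtForm_apply, diagForm_hermitian, ← gtForm_apply, ← gtForm_e_f hs hg, gtForm_apply,
    ← diagForm_hermitian, gtForm_apply]

/-- The eigenvalues q^x lie on the unit circle, so conjugation inverts them. -/
theorem gtForm_t (i : Fin n) (v w : GTMod n) :
    gtForm s L n (gtGen s L n (.t i) v) w = gtForm s L n v (gtGen s L n (.tinv i) w) := by
  refine adjoint_of_single (diagForm (gtNorm s L n)) (torusOp s L 1 (i.1 + 1))
    (torusOp s L (-1) (i.1 + 1)) (fun d d' _ _ => ?_) _ v.val_mem _ w.val_mem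
  rw [torusOp, torusOp, diagOp_single, diagOp_single, diagForm_single_single,
    diagForm_single_single]
  split_ifs with h
  · subst h
    simp [qpow_neg, conj_qpow]
  · rfl

theorem serre_gtGen_e (hs : Irrational s) (hg : Generic s L n) (m l : Fin (n - 1))
    (h : m.1 + 1 = l.1 ∨ l.1 + 1 = m.1) :
    serre (qOf s) (gtGen s L n (.e m)) (gtGen s L n (.e l)) = 0 := by
  refine LinearMap.ext fun v => GTMod.ext ?_
  exact serre_raiseOp hs hg (m := m.1 + 1) (l := l.1 + 1) (by omega) (by omega) (by omega)
    (by omega) (by omega) _ v.val_mem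

/-- The Serre expression is invariant under reversing products and q + q⁻¹ is real, so the element
in the f's is adjoint to the one in the e's. Nondegeneracy finishes the argument. -/
theorem serre_gtGen_f (hs : Irrational s) (hg : Generic s L n) (m l : Fin (n - 1))
    (h : m.1 + 1 = l.1 ∨ l.1 + 1 = m.1) :
    serre (qOf s) (gtGen s L n (.f m)) (gtGen s L n (.f l)) = 0 := by
  refine LinearMap.ext fun v => gtForm_nondegenerate hs hg _ fun w => ?_
  have h0 := LinearMap.congr_fun (serre_gtGen_e hs hg m l h) w
  have hq : conj (qOf s + (qOf s)⁻¹) = qOf s + (qOf s)⁻¹ := by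
    rw [map_add, map_inv₀, qOf, conj_qpow, inv_inv, add_comm]
  have h1 : gtForm s L n v (serre (qOf s) (gtGen s L n (.e m)) (gtGen s L n (.e l)) w) = 0 := by
    rw [h0]; simp
  rw [← h1]
  simp only [serre, LinearMap.add_apply, LinearMap.sub_apply, LinearMap.smul_apply,
    Module.End.mul_apply, map_add, map_sub, map_smul, LinearMap.map_smulₛₗ, hq,
    gtForm_f_e hs hg]
  ring

theorem gtGen_e_comm (hs : Irrational s) (hg : Generic s L n) (m l : Fin (n - 1))
    (h : m.1 + 1 < l.1) :
    gtGen s L n (.e m) * gtGen s L n (.e l) = gtGen s L n (.e l) * gtGen s L n (.e m) := by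
  rw [← sub_eq_zero]
  refine LinearMap.ext fun v => GTMod.ext ?_
  exact raiseOp_comm_raiseOp hs hg (m := m.1 + 1) (l := l.1 + 1) (by omega) (by omega)
    (by omega) _ v.val_mem

theorem gtGen_f_comm (hs : Irrational s) (hg : Generic s L n) (m l : Fin (n - 1))
    (h : m.1 + 1 < l.1) :
    gtGen s L n (.f m) * gtGen s L n (.f l) = gtGen s L n (.f l) * gtGen s L n (.f m) := by
  rw [← sub_eq_zero]
  refine LinearMap.ext fun v => gtForm_nondegenerate hs hg _ fun w => ?_
  have h0 := LinearMap.congr_fun (gtGen_e_comm hs hg m l h) w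
  simp only [Module.End.mul_apply] at h0
  simp only [LinearMap.sub_apply, Module.End.mul_apply, map_sub, gtForm_f_e hs hg, h0, sub_self]

theorem torusOp_raiseOp {k m : ℕ} (hk : 1 ≤ k) (v : Arr →₀ ℂ) :
    torusOp s L 1 k (raiseOp s L m v) = qOf s ^ rootExp k m • raiseOp s L m (torusOp s L 1 k v) := by
  rw [← qpow_intCast]
  exact diagOp_raiseOp s L m (fun d i hi => by rw [wtAt_sub_box L d hi hk]; ring) v

theorem torusOp_lowerOp {k m : ℕ} (hk : 1 ≤ k) (v : Arr →₀ ℂ) :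
    torusOp s L 1 k (lowerOp s L m v)
      = qOf s ^ (-rootExp k m) • lowerOp s L m (torusOp s L 1 k v) := by
  rw [← qpow_intCast, Int.cast_neg]
  exact diagOp_lowerOp s L m (fun d i hi => by rw [wtAt_add_box L d hi hk]; ring) v

theorem pairing_eq (i : Fin n) (m : Fin (n - 1)) : pairing i m = rootExp (i.1 + 1) (m.1 + 1) := by
  simp only [pairing, rootExp, lo, hi, Fin.ext_iff, add_left_inj]

theorem diagOp_one (v : Arr →₀ ℂ) : diagOp (fun _ => 1) v = v := by
  induction v using Finsupp.induction_linear with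
  | zero => simp
  | add f g hf hg => simp only [map_add, hf, hg]
  | single d z => simp [diagOp_single]

theorem gtGen_t_tinv (i : Fin n) : gtGen s L n (.t i) * gtGen s L n (.tinv i) = 1 := by
  refine LinearMap.ext fun v => GTMod.ext ?_
  change torusOp s L 1 (i.1 + 1) (torusOp s L (-1) (i.1 + 1) v.val) = v.val
  simp [torusOp_torusOp, diagOp_one]

theorem gtGen_tinv_t (i : Fin n) : gtGen s L n (.tinv i) * gtGen s L n (.t i) = 1 := by
  refine LinearMap.ext fun v => GTMod.ext ?_
  change torusOp s L (-1) (i.1 + 1) (torusOp s L 1 (i.1 + 1) v.val) = v.val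
  simp [torusOp_torusOp, diagOp_one]

theorem gtGen_rel (hs : Irrational s) (hg : Generic s L n) {x y : FreeAlgebra ℂ (Gen n)}
    (h : Rel (qOf s) n x y) :
    FreeAlgebra.lift ℂ (gtGen s L n) x = FreeAlgebra.lift ℂ (gtGen s L n) y := by
  have hι : ∀ g : Gen n, FreeAlgebra.lift ℂ (gtGen s L n) (gen g) = gtGen s L n g :=
    fun g => FreeAlgebra.lift_ι_apply _ _
  induction h with
  | t_tinv i => rw [map_mul, hι, hι, map_one, gtGen_t_tinv]
  | tinv_t i => rw [map_mul, hι, hι, map_one, gtGen_tinv_t]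
  | t_t i j =>
    simp only [map_mul, hι]
    refine LinearMap.ext fun v => GTMod.ext ?_
    change torusOp s L 1 (i.1 + 1) (torusOp s L 1 (j.1 + 1) v.val)
      = torusOp s L 1 (j.1 + 1) (torusOp s L 1 (i.1 + 1) v.val)
    rw [torusOp_torusOp, torusOp_torusOp]
    congr 2
    funext d
    rw [add_comm]
  | t_e i m =>
    simp only [map_mul, map_smul, hι, pairing_eq]
    exact LinearMap.ext fun v => GTMod.ext (torusOp_raiseOp (by omega) _)
  | t_f i m =>
    simp only [map_mul, map_smul, hι, pairing_eq]
    exact LinearMap.ext fun v => GTMod.ext (torusOp_lowerOp (by omega) _)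
  | e_f_same m =>
    simp only [map_mul, map_sub, map_smul, hι]
    refine LinearMap.ext fun v => GTMod.ext ?_
    change raiseOp s L (m.1 + 1) (lowerOp s L (m.1 + 1) v.val)
        - lowerOp s L (m.1 + 1) (raiseOp s L (m.1 + 1) v.val)
      = (qOf s - (qOf s)⁻¹)⁻¹ • (torusOp s L 1 (m.1 + 1) (torusOp s L (-1) (m.1 + 1 + 1) v.val)
        - torusOp s L (-1) (m.1 + 1) (torusOp s L 1 (m.1 + 1 + 1) v.val))
    rw [raiseOp_lowerOp hs hg (by omega) (by omega), add_sub_cancel_left, cartanOp, cartanOp,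
      torusOp_torusOp, torusOp_torusOp]
    congr 4 <;>
    · funext d
      congr 1
      ring
  | e_f_ne m l h =>
    simp only [map_mul, hι]
    refine LinearMap.ext fun v => GTMod.ext (raiseOp_lowerOp_of_ne hg (by omega) (by omega) ?_ _)
    intro h'
    exact h (Fin.ext (by omega))
  | e_e_far m l h => simpa only [map_mul, hι] using gtGen_e_comm hs hg m l h
  | f_f_far m l h => simpa only [map_mul, hι] using gtGen_f_comm hs hg m l h
  | e_serre m l h =>
    simpa only [map_add, map_sub, map_smul, map_mul, hι, map_zero, serre] using serre_gtGen_e hs hg m l h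
  | f_serre m l h =>
    simpa only [map_add, map_sub, map_smul, map_mul, hι, map_zero, serre] using serre_gtGen_f hs hg m l h

/-- The representation of `U_q(gl_n)` on the Gelfand–Tsetlin module. -/
def gtRep (hs : Irrational s) (hg : Generic s L n) : Uq (qOf s) n →ₐ[ℂ] Module.End ℂ (GTMod n) :=
  RingQuot.liftAlgHom ℂ ⟨FreeAlgebra.lift ℂ (gtGen s L n), fun _ _ h => gtGen_rel hs hg h⟩

theorem gtRep_el (hs : Irrational s) (hg : Generic s L n) (g : Gen n) :
    gtRep hs hg (el (qOf s) g) = gtGen s L n g := by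
  rw [gtRep, el, RingQuot.liftAlgHom_mkAlgHom_apply]
  exact FreeAlgebra.lift_ι_apply _ _

end module

/-! ### Ordered monomials in the negative part -/

/-- The relations between the generators `f_m`. -/
structure SerreFamily {A : Type*} [Ring A] [Algebra ℂ A] (q : ℂ) (f : ℕ → A) : Prop where
  far : ∀ i j, i + 1 < j → f i * f j = f j * f i
  up : ∀ i, serre q (f i) (f (i + 1)) = 0
  down : ∀ i, serre q (f (i + 1)) (f i) = 0

/-- The root vector `[f_i, [f_{i+1}, …, f_{i+l}]_q]_q`. -/
def rootVec {A : Type*} [Ring A] [Algebra ℂ A] (q : ℂ) (f : ℕ → A) : ℕ → ℕ → A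
  | i, 0 => f i
  | i, l + 1 => f i * rootVec q f (i + 1) l - q • (rootVec q f (i + 1) l * f i)

/-- The ordered monomial `g_0 ^ c_0 ⋯ g_{i-1} ^ c_{i-1}`. -/
def orderedMono {A : Type*} [Monoid A] (g : ℕ → A) (c : ℕ → ℕ) : ℕ → A
  | 0 => 1
  | i + 1 => orderedMono g c i * g i ^ c i

theorem orderedMono_congr {A : Type*} [Monoid A] (g : ℕ → A) {c c' : ℕ → ℕ} :
    ∀ {i : ℕ}, (∀ l < i, c l = c' l) → orderedMono g c i = orderedMono g c' i
  | 0, _ => rfl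
  | i + 1, h => by
    rw [orderedMono, orderedMono, orderedMono_congr g fun l hl => h l (by omega), h i (by omega)]

theorem orderedMono_comm {A : Type*} [Monoid A] {g : ℕ → A} {x : A} (c : ℕ → ℕ) :
    ∀ {i : ℕ}, (∀ l < i, g l * x = x * g l) → orderedMono g c i * x = x * orderedMono g c i
  | 0, _ => by simp [orderedMono]
  | i + 1, h => by
    have h1 : g i ^ c i * x = x * g i ^ c i := (Commute.pow_left (h i (by omega)) _)
    rw [orderedMono, mul_assoc, h1, ← mul_assoc, orderedMono_comm c fun l hl => h l (by omega),
      mul_assoc]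

/-! ### Commutation of root vectors and straightening -/

section abstract

variable {A : Type*} [Ring A] [Algebra ℂ A] {q : ℂ} {f : ℕ → A}

/-- The Serre expression is linear in its second argument, and c passes through a, so it can be
pulled out on either side. -/
theorem serre_bracket {a b c : A} (h : serre q a b = 0) (hac : a * c = c * a) :
    serre q a (b * c - q • (c * b)) = 0 := by
  have key : serre q a (b * c - q • (c * b)) = serre q a b * c - q • (c * serre q a b) := by
    simp only [serre, mul_add, add_mul, mul_sub, sub_mul, mul_assoc, smul_mul_assoc,
      mul_smul_comm, smul_add, smul_sub, smul_smul, hac, mul_mul_eq_of_eq hac]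
    module
  rw [key, h]
  simp

/-- The difference of the two sides is -q times the Serre element: the Serre relation says that a
q-commutes with its q-bracket. -/
theorem mul_bracket_of_serre (hq : q ≠ 0) {a b : A} (h : serre q a b = 0) :
    (a * b - q • (b * a)) * a = q • (a * (a * b - q • (b * a))) := by
  have key : (a * b - q • (b * a)) * a - q • (a * (a * b - q • (b * a))) = -q • serre q a b := by
    simp only [serre, mul_sub, sub_mul, mul_assoc, smul_mul_assoc,
      mul_smul_comm, smul_add, smul_sub, smul_smul]
    match_scalars
    all_goals (try field_simp)
    all_goals (try ring)
  rw [h, smul_zero, sub_eq_zero] at key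
  exact key

theorem bracket_mul_of_serre (hq : q ≠ 0) {a b : A} (h : serre q b a = 0) :
    b * (a * b - q • (b * a)) = q • ((a * b - q • (b * a)) * b) := by
  have key : b * (a * b - q • (b * a)) - q • ((a * b - q • (b * a)) * b) = -q • serre q b a := by
    simp only [serre, mul_sub, sub_mul, mul_assoc, smul_mul_assoc,
      mul_smul_comm, smul_add, smul_sub, smul_smul]
    match_scalars
    all_goals (try field_simp)
    all_goals (try ring)
  rw [h, smul_zero, sub_eq_zero] at key
  exact key

/-- After multiplication by q + q⁻¹ the commutator of b and F is a combination of multiples of the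
two Serre elements with b doubled. Dividing requires q + q⁻¹ ≠ 0. -/
theorem mul_double_bracket (hq : q ≠ 0) (hq2 : q + q⁻¹ ≠ 0) {a b c F : A} (h1 : serre q b a = 0)
    (h2 : serre q b c = 0) (hac : c * a = a * c)
    (hF : F = a * (b * c - q • (c * b)) - q • ((b * c - q • (c * b)) * a)) :
    b * F = F * b := by
  have key : (q + q⁻¹) • (b * F - F * b) =
      (q + q⁻¹) • (q • (a * serre q b c) - q • (serre q b a * c)) +
      (q * q) • (serre q b a * c - a * serre q b c - serre q b c * a + c * serre q b a) := by
    simp only [hF, serre, mul_add, add_mul, mul_sub, sub_mul, mul_assoc, smul_mul_assoc,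
      mul_smul_comm, smul_add, smul_sub, smul_smul, hac, mul_mul_eq_of_eq hac]
    match_scalars <;> field_simp <;> ring
  rw [h1, h2] at key
  simp only [mul_zero, zero_mul, smul_zero, sub_zero, add_zero] at key
  exact sub_eq_zero.1 ((smul_eq_zero.1 key).resolve_left hq2)

theorem SerreFamily.comm_rootVec (hf : SerreFamily q f) {j : ℕ} :
    ∀ {l i : ℕ}, j + 1 < i → f j * rootVec q f i l = rootVec q f i l * f j
  | 0, i, h => hf.far j i h
  | l + 1, i, h => by
    have h1 := hf.far j i h
    have h2 := hf.comm_rootVec (j := j) (l := l) (i := i + 1) (by omega)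
    simp only [rootVec, mul_sub, sub_mul, mul_assoc, smul_mul_assoc, mul_smul_comm, h1, h2,
      mul_mul_eq_of_eq h1, mul_mul_eq_of_eq h2]

theorem SerreFamily.serre_rootVec (hf : SerreFamily q f) (i : ℕ) :
    ∀ l, serre q (f i) (rootVec q f (i + 1) l) = 0
  | 0 => hf.up i
  | l + 1 => serre_bracket (hf.up i) (hf.comm_rootVec (by omega))

theorem SerreFamily.rootVec_mul_self (hf : SerreFamily q f) (hq : q ≠ 0) (i l : ℕ) :
    rootVec q f i (l + 1) * f i = q • (f i * rootVec q f i (l + 1)) :=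
  mul_bracket_of_serre hq (hf.serre_rootVec i l)

/-- Next to the left end this is `mul_double_bracket`; further inside, f_j also commutes with f_i
and the bracket inherits commutation from its shorter constituent. -/
theorem SerreFamily.comm_rootVec_inner (hf : SerreFamily q f) (hq : q ≠ 0) (hq2 : q + q⁻¹ ≠ 0)
    {j : ℕ} : ∀ {l i : ℕ}, i < j → j < i + l → f j * rootVec q f i l = rootVec q f i l * f j
  | 0, i, h, h' => by omega
  | 1, i, h, h' => by omega
  | l + 2, i, h, h' => by
    by_cases hj : j = i + 1
    · subst hj
      exact mul_double_bracket hq hq2 (hf.down i) (hf.serre_rootVec (i + 1) l)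
        (hf.comm_rootVec (by omega)).symm rfl
    · have h1 := (hf.far i j (by omega)).symm
      have h2 := hf.comm_rootVec_inner hq hq2 (j := j) (l := l + 1) (i := i + 1) (by omega)
        (by omega)
      rw [rootVec]
      simp only [mul_sub, sub_mul, mul_assoc, smul_mul_assoc, mul_smul_comm, h1, h2,
        mul_mul_eq_of_eq h1, mul_mul_eq_of_eq h2]

/-- Expand the shorter root vector as a bracket: its first generator is interior to the longer one
and commutes with it, while the remaining root vector q-commutes with it by induction. -/
theorem SerreFamily.rootVec_mul_rootVec (hf : SerreFamily q f) (hq : q ≠ 0) (hq2 : q + q⁻¹ ≠ 0) :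
    ∀ l i : ℕ, rootVec q f (i + 1) l * rootVec q f i (l + 1)
      = q • (rootVec q f i (l + 1) * rootVec q f (i + 1) l)
  | 0, i => bracket_mul_of_serre hq (hf.down i)
  | l + 1, i => by
    have hb := hf.comm_rootVec_inner hq hq2 (j := i + 1) (l := l + 2) (i := i) (by omega)
      (by omega)
    have hc : rootVec q f (i + 2) l * rootVec q f i (l + 2)
        = q • (rootVec q f i (l + 2) * rootVec q f (i + 2) l) := by
      have h1 := hf.rootVec_mul_rootVec hq hq2 l (i + 1)
      have h2 := (hf.comm_rootVec (j := i) (l := l) (i := i + 2) (by omega)).symm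
      rw [show rootVec q f i (l + 2) = f i * rootVec q f (i + 1) (l + 1)
        - q • (rootVec q f (i + 1) (l + 1) * f i) from rfl]
      simp only [mul_sub, sub_mul, mul_assoc, smul_mul_assoc, mul_smul_comm, h1, h2,
        mul_mul_eq_of_eq h1, mul_mul_eq_of_eq h2, smul_sub, smul_smul]
    rw [show rootVec q f (i + 1) (l + 1) = f (i + 1) * rootVec q f (i + 2) l
        - q • (rootVec q f (i + 2) l * f (i + 1)) from rfl]
    change (_ : A) * rootVec q f i (l + 2) = q • (rootVec q f i (l + 2) * _)
    simp only [mul_sub, sub_mul, mul_assoc, smul_mul_assoc, mul_smul_comm, hb, hc,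
        mul_mul_eq_of_eq hb, mul_mul_eq_of_eq hc, smul_sub, smul_smul]

theorem pow_mul_of_mul_eq {g x : A} {q : ℂ} (h : g * x = q • (x * g)) (a : ℕ) :
    g ^ a * x = q ^ a • (x * g ^ a) := by
  induction a with
  | zero => simp
  | succ a ih =>
    rw [pow_succ, mul_assoc, h, mul_smul_comm, ← mul_assoc, ih, smul_mul_assoc, smul_smul,
      mul_assoc, pow_succ, mul_comm q]

theorem pow_mul_of_bracket {g g' x : A} {q : ℂ} (h : g * x = q⁻¹ • (x * g - g'))
    (hg : g * g' = q • (g' * g)) (b : ℕ) :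
    ∃ α β : ℂ, g ^ b * x = α • (x * g ^ b) + β • (g' * g ^ (b - 1)) := by
  induction b with
  -- For b = 0 the second coefficient is zero, so the truncated exponent b - 1 does no harm.
  | zero => exact ⟨1, 0, by simp⟩
  | succ b ih =>
    obtain ⟨α, β, ih⟩ := ih
    have e : β • (g' * g ^ (b - 1) * g) = β • (g' * g ^ b) ∨ b = 0 := by
      rcases b with _ | b
      · exact Or.inr rfl
      · left; rw [mul_assoc, Nat.add_sub_cancel, ← pow_succ]
    have h0 : g ^ (b + 1) * x = q⁻¹ • (g ^ b * x * g) - q⁻¹ • (q ^ b • (g' * g ^ b)) := by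
      rw [pow_succ, mul_assoc, h, mul_smul_comm, mul_sub, smul_sub, pow_mul_of_mul_eq hg b,
        mul_assoc]
    rcases e with e | rfl
    · refine ⟨q⁻¹ * α, q⁻¹ * β - q⁻¹ * q ^ b, ?_⟩
      rw [h0, ih, add_mul, smul_mul_assoc, smul_mul_assoc, e, Nat.add_sub_cancel, mul_assoc,
        ← pow_succ]
      module
    · refine ⟨q⁻¹, -q⁻¹, ?_⟩
      rw [h0]
      simp [sub_eq_add_neg]

/-- Intended for x = f_j and g_l the root vector from l to k. All g_l commute with x except g_j,
which q-commutes, and g_{j+1}, whose passage can turn one copy of g_{j+1} into g_j. That copy is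
then moved into the block of g_j, so the monomial stays ordered. -/
theorem orderedMono_mul {g : ℕ → A} {x : A} {q : ℂ} {j : ℕ}
    (h1 : ∀ l < j, g l * x = x * g l) (h2 : g j * x = q • (x * g j))
    (h3 : g (j + 1) * x = q⁻¹ • (x * g (j + 1) - g j))
    (h4 : g (j + 1) * g j = q • (g j * g (j + 1))) (k : ℕ)
    (h5 : ∀ l, j + 1 < l → l ≤ k → g l * x = x * g l) (c : ℕ → ℕ) :
    ∀ i, j + 2 ≤ i → i ≤ k + 1 → ∃ (α β : ℂ) (c' : ℕ → ℕ), (∀ l, j + 2 ≤ l → c' l = c l) ∧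
      orderedMono g c i * x = α • (x * orderedMono g c i) + β • orderedMono g c' i := by
  intro i hi
  induction i, hi using Nat.le_induction with
  | base =>
    intro _
    obtain ⟨α, β, hb⟩ := pow_mul_of_bracket h3 h4 (c (j + 1))
    have ha := pow_mul_of_mul_eq h2 (c j)
    have hM := orderedMono_comm c h1
    refine ⟨α * q ^ c j, β, fun l => if l = j then c j + 1 else if l = j + 1 then c (j + 1) - 1
      else c l, fun l hl => ?_, ?_⟩
    · beta_reduce
      rw [if_neg (by omega), if_neg (by omega)]
    · simp only [orderedMono, if_true, Nat.succ_ne_self, if_false]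
      rw [orderedMono_congr g (c := fun l => if l = j then c j + 1 else if l = j + 1 then
        c (j + 1) - 1 else c l) (c' := c) (i := j) fun l hl => by
          rw [if_neg (by omega), if_neg (by omega)]]
      simp only [mul_assoc, hb, mul_add, mul_smul_comm]
      rw [mul_mul_eq_of_eq ha, smul_mul_assoc, mul_smul_comm, mul_assoc, mul_mul_eq_of_eq hM,
        smul_smul, pow_succ]
      simp only [mul_assoc]
  | succ i hi ih =>
    intro hik
    obtain ⟨α, β, c', hc', ih⟩ := ih (by omega)
    refine ⟨α, β, c', hc', ?_⟩
    have h : g i ^ c i * x = x * g i ^ c i := Commute.pow_left (h5 i (by omega) (by omega)) _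
    rw [orderedMono, orderedMono, mul_assoc, h, ← mul_assoc, ih, hc' i hi, add_mul,
      smul_mul_assoc, smul_mul_assoc, mul_assoc]

/-- The subalgebra generated by `f_0, …, f_{k-1}`. -/
def lowerAlg (f : ℕ → A) (k : ℕ) : Subalgebra ℂ A := Algebra.adjoin ℂ (f '' Set.Iio k)

/-- A subspace that contains `1` and is stable under right multiplication by the generators
contains the generated subalgebra. -/
theorem adjoin_le_of_mul_right {S : Set A} {P : Submodule ℂ A} (h1 : 1 ∈ P)
    (h : ∀ x ∈ S, ∀ p ∈ P, p * x ∈ P) : Subalgebra.toSubmodule (Algebra.adjoin ℂ S) ≤ P := by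
  intro x hx
  have : ∀ p ∈ P, p * x ∈ P := by
    refine Algebra.adjoin_induction (p := fun x _ => ∀ p ∈ P, p * x ∈ P) h ?_ ?_ ?_ hx
    · intro r p hp
      rw [← Algebra.commutes, ← Algebra.smul_def]
      exact P.smul_mem r hp
    · intro x y _ _ hx hy p hp
      rw [mul_add]
      exact P.add_mem (hx p hp) (hy p hp)
    · intro x y _ _ hx hy p hp
      rw [← mul_assoc]
      exact hy _ (hx p hp)
  simpa using this 1 h1

/-- The root vectors ending at `k`. -/
def rootTo (q : ℂ) (f : ℕ → A) (k i : ℕ) : A := rootVec q f i (k - i)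

/-- The right-hand side contains 1 and is stable under right multiplication by f_0, …, f_k: for j <
k the generator is straightened to the left into the smaller subalgebra, and f_k is itself the last
root vector, so it only increases the last exponent. -/
theorem lowerAlg_succ_le (hf : SerreFamily q f) (hq : q ≠ 0) (hq2 : q + q⁻¹ ≠ 0) (k : ℕ) :
    Subalgebra.toSubmodule (lowerAlg f (k + 1)) ≤ Subalgebra.toSubmodule (lowerAlg f k) *
      Submodule.span ℂ (Set.range fun c => orderedMono (rootTo q f k) c (k + 1)) := by
  set S := Submodule.span ℂ (Set.range fun c => orderedMono (rootTo q f k) c (k + 1)) with hS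
  have hSmem : ∀ c, orderedMono (rootTo q f k) c (k + 1) ∈ S :=
    fun c => Submodule.subset_span ⟨c, rfl⟩
  have hone : ∀ i, orderedMono (rootTo q f k) 0 i = 1 := by
    intro i
    induction i with
    | zero => rfl
    | succ i ih => simp [orderedMono, ih]
  refine adjoin_le_of_mul_right ?_ ?_
  · rw [← one_mul (1 : A)]
    exact Submodule.mul_mem_mul (Subalgebra.one_mem _) (by rw [← hone (k + 1)]; exact hSmem 0)
  rintro _ ⟨j, hj, rfl⟩ p hp
  have hj : j < k + 1 := hj
  refine Submodule.mul_induction_on hp ?_ fun x y hx hy => by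
    rw [add_mul]; exact Submodule.add_mem _ hx hy
  intro u hu w hw
  suffices H : w * f j ∈ Subalgebra.toSubmodule (lowerAlg f k) * S by
    rw [mul_assoc]
    have : u * (w * f j) ∈ Subalgebra.toSubmodule (lowerAlg f k) *
        (Subalgebra.toSubmodule (lowerAlg f k) * S) := Submodule.mul_mem_mul hu H
    rwa [← mul_assoc, (Subalgebra.isIdempotentElem_toSubmodule _).eq] at this
  have hSle : S ≤ Subalgebra.toSubmodule (lowerAlg f k) * S := fun x hx => by
    rw [← one_mul x]
    exact Submodule.mul_mem_mul (Subalgebra.one_mem _) hx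
  induction hw using Submodule.span_induction with
  | zero => simp
  | add x y _ _ hx hy => rw [add_mul]; exact Submodule.add_mem _ hx hy
  | smul a x _ hx => rw [smul_mul_assoc]; exact Submodule.smul_mem _ _ hx
  | mem w hw =>
    obtain ⟨c, rfl⟩ := hw
    rcases Nat.lt_succ_iff_lt_or_eq.1 hj with hjk | rfl
    · have hfj : f j ∈ lowerAlg f k := Algebra.subset_adjoin ⟨j, hjk, rfl⟩
      have hsucc : k - j = k - (j + 1) + 1 := by omega
      obtain ⟨α, β, c', -, he⟩ := orderedMono_mul (g := rootTo q f k) (x := f j) (q := q) (j := j)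
        (fun l hl => (hf.comm_rootVec_inner hq hq2 hl (by omega)).symm)
        (by rw [rootTo, hsucc]; exact hf.rootVec_mul_self hq j _)
        (by
          have : rootTo q f k j = f j * rootTo q f k (j + 1) - q • (rootTo q f k (j + 1) * f j) := by
            rw [rootTo, hsucc, rootVec, rootTo]
          rw [this, sub_sub_cancel, smul_smul, inv_mul_cancel₀ hq, one_smul])
        (by
          rw [rootTo, rootTo, hsucc]
          exact hf.rootVec_mul_rootVec hq hq2 _ j)
        k (fun l hl hlk => (hf.comm_rootVec hl).symm) c (k + 1) (by omega) le_rfl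
      simp only [he]
      exact Submodule.add_mem _
        (Submodule.smul_mem _ _ (Submodule.mul_mem_mul hfj (hSmem c)))
        (Submodule.smul_mem _ _ (hSle (hSmem c')))
    · refine hSle ?_
      have : orderedMono (rootTo q f j) c (j + 1) * f j
          = orderedMono (rootTo q f j) (Function.update c j (c j + 1)) (j + 1) := by
        rw [orderedMono, orderedMono, Function.update_self, pow_succ, mul_assoc,
          orderedMono_congr (c := Function.update c j _) (c' := c) _ fun l hl =>
            Function.update_of_ne (by omega) _ _, rootTo, Nat.sub_self, rootVec]
      simp only [this]
      exact hSmem _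

/-- Ordered monomials in all the root vectors. -/
def pbwMono (q : ℂ) (f : ℕ → A) (c : ℕ → ℕ → ℕ) : ℕ → A
  | 0 => 1
  | k + 1 => pbwMono q f c k * orderedMono (rootTo q f k) (c k) (k + 1)

theorem pbwMono_congr {c c' : ℕ → ℕ → ℕ} :
    ∀ {k : ℕ}, (∀ l < k, ∀ i ≤ l, c l i = c' l i) → pbwMono q f c k = pbwMono q f c' k
  | 0, _ => rfl
  | k + 1, h => by
    rw [pbwMono, pbwMono, pbwMono_congr fun l hl => h l (by omega),
      orderedMono_congr _ fun l hl => h k (by omega) l (by omega)]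

/-- The ordered monomials span the negative part. -/
theorem lowerAlg_le_span_pbwMono (hf : SerreFamily q f) (hq : q ≠ 0) (hq2 : q + q⁻¹ ≠ 0) (k : ℕ) :
    Subalgebra.toSubmodule (lowerAlg f k) ≤
      Submodule.span ℂ (Set.range fun c => pbwMono q f c k) := by
  induction k with
  | zero =>
    refine adjoin_le_of_mul_right (Submodule.subset_span ⟨0, rfl⟩) ?_
    rintro _ ⟨j, hj, rfl⟩
    exact absurd hj (by simp)
  | succ k ih =>
    refine (lowerAlg_succ_le hf hq hq2 k).trans ((mul_le_mul' ih le_rfl).trans ?_)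
    rw [Submodule.span_mul_span, Submodule.span_le]
    rintro _ ⟨_, ⟨c, rfl⟩, _, ⟨c', rfl⟩, rfl⟩
    refine Submodule.subset_span ⟨Function.update c k c', ?_⟩
    simp only [pbwMono, Function.update_self]
    rw [pbwMono_congr (c := Function.update c k c') (c' := c) fun l hl i _ => by
      rw [Function.update_of_ne (by omega)]]

end abstract

/-! ### The quantum group and its Verma modules -/

section uq

variable (q : ℂ) {n : ℕ}

theorem mkAlgHom_eq_of_rel {x y : FreeAlgebra ℂ (Gen n)} (h : Rel q n x y) :
    RingQuot.mkAlgHom ℂ (Rel q n) x = RingQuot.mkAlgHom ℂ (Rel q n) y :=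
  RingQuot.mkAlgHom_rel ℂ h

theorem el_t_tinv (i : Fin n) : el q (.t i) * el q (.tinv i) = 1 := by
  simpa only [map_mul, map_one, el] using mkAlgHom_eq_of_rel q (Rel.t_tinv i)

theorem el_tinv_t (i : Fin n) : el q (.tinv i) * el q (.t i) = 1 := by
  simpa only [map_mul, map_one, el] using mkAlgHom_eq_of_rel q (Rel.tinv_t i)

theorem el_t_f (i : Fin n) (m : Fin (n - 1)) :
    el q (.t i) * el q (.f m) = q ^ (-pairing i m) • (el q (.f m) * el q (.t i)) := by
  simpa only [map_mul, map_smul, el] using mkAlgHom_eq_of_rel q (Rel.t_f i m)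

theorem el_tinv_f (hq : q ≠ 0) (i : Fin n) (m : Fin (n - 1)) :
    el q (.tinv i) * el q (.f m) = q ^ pairing i m • (el q (.f m) * el q (.tinv i)) := by
  have h : el q (.f m) * el q (.t i) = q ^ pairing i m • (el q (.t i) * el q (.f m)) := by
    rw [el_t_f, smul_smul, ← zpow_add₀ hq, add_neg_cancel, zpow_zero, one_smul]
  calc el q (.tinv i) * el q (.f m)
      = el q (.tinv i) * (el q (.f m) * el q (.t i)) * el q (.tinv i) := by
        rw [mul_assoc, mul_assoc, el_t_tinv, mul_one]
    _ = _ := by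
        rw [h, mul_smul_comm, smul_mul_assoc, ← mul_assoc, el_tinv_t, one_mul]

theorem el_e_f_same (m : Fin (n - 1)) :
    el q (.e m) * el q (.f m) = el q (.f m) * el q (.e m) +
      (q - q⁻¹)⁻¹ • (el q (.t (lo m)) * el q (.tinv (hi m))
        - el q (.tinv (lo m)) * el q (.t (hi m))) := by
  rw [← sub_eq_iff_eq_add']
  simpa only [map_mul, map_sub, map_smul, el] using mkAlgHom_eq_of_rel q (Rel.e_f_same m)

theorem el_e_f_ne {m l : Fin (n - 1)} (h : m ≠ l) :
    el q (.e m) * el q (.f l) = el q (.f l) * el q (.e m) := by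
  simpa only [map_mul, el] using mkAlgHom_eq_of_rel q (Rel.e_f_ne m l h)

/-- The generators `f_m` of `U_q(gl_n)`, extended by zero. -/
def lowGen (q : ℂ) (n : ℕ) (j : ℕ) : Uq q n := if h : j < n - 1 then el q (.f ⟨j, h⟩) else 0

theorem lowGen_of_lt {j : ℕ} (h : j < n - 1) : lowGen q n j = el q (.f ⟨j, h⟩) := dif_pos h

theorem lowGen_of_not_lt {j : ℕ} (h : ¬ j < n - 1) : lowGen q n j = 0 := dif_neg h

theorem serre_el_f (m l : Fin (n - 1)) (h : m.1 + 1 = l.1 ∨ l.1 + 1 = m.1) :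
    serre q (el q (.f m)) (el q (.f l)) = 0 := by
  simpa only [map_mul, map_sub, map_add, map_smul, map_zero, serre, el]
    using mkAlgHom_eq_of_rel q (Rel.f_serre m l h)

theorem serreFamily_lowGen : SerreFamily q (lowGen q n) := by
  constructor
  · intro i j hij
    by_cases hj : j < n - 1
    · rw [lowGen_of_lt q (show i < n - 1 by omega), lowGen_of_lt q hj]
      simpa only [map_mul, el] using mkAlgHom_eq_of_rel q
        (Rel.f_f_far (⟨i, by omega⟩ : Fin (n - 1)) ⟨j, hj⟩ hij)
    · rw [lowGen_of_not_lt q hj, mul_zero, zero_mul]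
  · intro i
    by_cases hi : i + 1 < n - 1
    · rw [lowGen_of_lt q (show i < n - 1 by omega), lowGen_of_lt q hi]
      exact serre_el_f q _ _ (Or.inl rfl)
    · rw [lowGen_of_not_lt q hi]; simp [serre]
  · intro i
    by_cases hi : i + 1 < n - 1
    · rw [lowGen_of_lt q (show i < n - 1 by omega), lowGen_of_lt q hi]
      exact serre_el_f q _ _ (Or.inr rfl)
    · rw [lowGen_of_not_lt q hi]; simp [serre]

theorem adjoin_range_el : Algebra.adjoin ℂ (Set.range (el q (n := n))) = ⊤ := by
  rw [eq_top_iff]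
  rintro x -
  obtain ⟨y, rfl⟩ := RingQuot.mkAlgHom_surjective ℂ (Rel q n) x
  induction y using FreeAlgebra.induction with
  | grade0 r => rw [AlgHom.commutes]; exact Subalgebra.algebraMap_mem _ r
  | grade1 g => exact Algebra.subset_adjoin ⟨g, rfl⟩
  | mul a b ha hb => rw [map_mul]; exact mul_mem ha hb
  | add a b ha hb => rw [map_add]; exact add_mem ha hb

/-- A subspace of a module that is stable under a set is stable under the subalgebra it
generates. -/
theorem smul_mem_of_mem_adjoin {A M : Type*} [Ring A] [Algebra ℂ A] [AddCommGroup M] [Module ℂ M]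
    [Module A M] [IsScalarTower ℂ A M] {S : Set A} {P : Submodule ℂ M}
    (h : ∀ x ∈ S, ∀ p ∈ P, x • p ∈ P) {x : A} (hx : x ∈ Algebra.adjoin ℂ S) :
    ∀ p ∈ P, x • p ∈ P := by
  refine Algebra.adjoin_induction (p := fun x _ => ∀ p ∈ P, x • p ∈ P) h ?_ ?_ ?_ hx
  · intro r p hp
    rw [algebraMap_smul]
    exact P.smul_mem r hp
  · intro x y _ _ hx hy p hp
    rw [add_smul]
    exact P.add_mem (hx p hp) (hy p hp)
  · intro x y _ _ hx hy p hp
    rw [mul_smul]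
    exact hx _ (hy p hp)

end uq

/-! ### Verma modules as spans of lowering words -/

section verma

variable (s : ℝ) {n : ℕ} (lam : Fin n → ℝ)

theorem qOf_ne_zero : qOf s ≠ 0 := qpow_ne_zero s 1

theorem mk_eq_smul_hwVec (x : Uq (qOf s) n) :
    (Submodule.Quotient.mk x : Verma s lam) = x • hwVec s lam := by
  rw [hwVec, ← Submodule.Quotient.mk_smul, smul_eq_mul, mul_one]

theorem e_smul_hwVec (m : Fin (n - 1)) : el (qOf s) (.e m) • hwVec s lam = 0 := by
  rw [← mk_eq_smul_hwVec]
  exact (Submodule.Quotient.mk_eq_zero _).2 (Submodule.subset_span (Or.inl ⟨m, rfl⟩))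

theorem t_smul_hwVec (i : Fin n) :
    el (qOf s) (.t i) • hwVec s lam = qpow s (lam i) • hwVec s lam := by
  have h : (el (qOf s) (.t i) - algebraMap ℂ (Uq (qOf s) n) (qpow s (lam i))) • hwVec s lam
      = 0 := by
    rw [← mk_eq_smul_hwVec]
    exact (Submodule.Quotient.mk_eq_zero _).2 (Submodule.subset_span (Or.inr ⟨i, rfl⟩))
  rwa [sub_smul, algebraMap_smul, sub_eq_zero] at h

variable {s lam}

theorem el_smul_smul (g : Gen n) (c : ℂ) (v : Verma s lam) :
    el (qOf s) g • (c • v) = c • (el (qOf s) g • v) :=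
  (Algebra.lsmul ℂ ℂ (Verma s lam) (el (qOf s) g)).map_smul c v

variable (s lam)

theorem tinv_smul_hwVec (i : Fin n) :
    el (qOf s) (.tinv i) • hwVec s lam = (qpow s (lam i))⁻¹ • hwVec s lam := by
  have h : el (qOf s) (.tinv i) • (el (qOf s) (.t i) • hwVec s lam) = hwVec s lam := by
    rw [← mul_smul, el_tinv_t, one_smul]
  rw [t_smul_hwVec, el_smul_smul] at h
  exact (eq_inv_smul_iff₀ (β := Verma s lam) (qpow_ne_zero s (lam i))).2 h

/-- The span of the vectors obtained from the highest weight vector by applying `f`'s. -/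
def lowSpan : Submodule ℂ (Verma s lam) :=
  (Subalgebra.toSubmodule (lowerAlg (lowGen (qOf s) n) (n - 1))).map
    ((LinearMap.toSpanSingleton (Uq (qOf s) n) (Verma s lam) (hwVec s lam)).restrictScalars ℂ)

theorem mem_lowSpan {v : Verma s lam} :
    v ∈ lowSpan s lam ↔ ∃ x ∈ lowerAlg (lowGen (qOf s) n) (n - 1), x • hwVec s lam = v := Iff.rfl

theorem f_smul_mem_lowSpan (m : Fin (n - 1)) {v : Verma s lam} (hv : v ∈ lowSpan s lam) :
    el (qOf s) (.f m) • v ∈ lowSpan s lam := by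
  obtain ⟨x, hx, rfl⟩ := (mem_lowSpan s lam).1 hv
  refine (mem_lowSpan s lam).2 ⟨el (qOf s) (.f m) * x, mul_mem ?_ hx, mul_smul _ _ _⟩
  exact Algebra.subset_adjoin ⟨m.1, m.2, lowGen_of_lt _ m.2⟩

theorem hwVec_mem_lowSpan : hwVec s lam ∈ lowSpan s lam :=
  (mem_lowSpan s lam).2 ⟨1, one_mem _, one_smul _ _⟩

theorem lowSpan_le {P : Submodule ℂ (Verma s lam)} (h0 : hwVec s lam ∈ P)
    (h : ∀ (m : Fin (n - 1)), ∀ v ∈ P, el (qOf s) (.f m) • v ∈ P) : lowSpan s lam ≤ P := by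
  intro v hv
  obtain ⟨x, hx, rfl⟩ := (mem_lowSpan s lam).1 hv
  refine smul_mem_of_mem_adjoin ?_ hx _ h0
  rintro _ ⟨j, hj, rfl⟩ p hp
  rw [lowGen_of_lt _ hj]
  exact h _ p hp

theorem t_smul_mem_lowSpan (i : Fin n) {v : Verma s lam} (hv : v ∈ lowSpan s lam) :
    el (qOf s) (.t i) • v ∈ lowSpan s lam := by
  have : lowSpan s lam ≤ lowSpan s lam ⊓ (lowSpan s lam).comap
      (Algebra.lsmul ℂ ℂ (Verma s lam) (el (qOf s) (.t i))) := by
    refine lowSpan_le s lam ⟨hwVec_mem_lowSpan s lam, ?_⟩ fun m v hv =>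
      ⟨f_smul_mem_lowSpan s lam m hv.1, ?_⟩
    · change el (qOf s) (.t i) • hwVec s lam ∈ lowSpan s lam
      rw [t_smul_hwVec]
      exact Submodule.smul_mem _ _ (hwVec_mem_lowSpan s lam)
    · change el (qOf s) (.t i) • (el (qOf s) (.f m) • v) ∈ lowSpan s lam
      rw [← mul_smul, el_t_f, smul_assoc, mul_smul]
      exact Submodule.smul_mem _ _ (f_smul_mem_lowSpan s lam m hv.2)
  exact (this hv).2

theorem tinv_smul_mem_lowSpan (i : Fin n) {v : Verma s lam} (hv : v ∈ lowSpan s lam) :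
    el (qOf s) (.tinv i) • v ∈ lowSpan s lam := by
  have : lowSpan s lam ≤ lowSpan s lam ⊓ (lowSpan s lam).comap
      (Algebra.lsmul ℂ ℂ (Verma s lam) (el (qOf s) (.tinv i))) := by
    refine lowSpan_le s lam ⟨hwVec_mem_lowSpan s lam, ?_⟩ fun m v hv =>
      ⟨f_smul_mem_lowSpan s lam m hv.1, ?_⟩
    · change el (qOf s) (.tinv i) • hwVec s lam ∈ lowSpan s lam
      rw [tinv_smul_hwVec]
      exact Submodule.smul_mem _ _ (hwVec_mem_lowSpan s lam)
    · change el (qOf s) (.tinv i) • (el (qOf s) (.f m) • v) ∈ lowSpan s lam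
      rw [← mul_smul, el_tinv_f _ (qOf_ne_zero s), smul_assoc, mul_smul]
      exact Submodule.smul_mem _ _ (f_smul_mem_lowSpan s lam m hv.2)
  exact (this hv).2

theorem e_smul_mem_lowSpan (m : Fin (n - 1)) {v : Verma s lam} (hv : v ∈ lowSpan s lam) :
    el (qOf s) (.e m) • v ∈ lowSpan s lam := by
  have : lowSpan s lam ≤ lowSpan s lam ⊓ (lowSpan s lam).comap
      (Algebra.lsmul ℂ ℂ (Verma s lam) (el (qOf s) (.e m))) := by
    refine lowSpan_le s lam ⟨hwVec_mem_lowSpan s lam, ?_⟩ fun l v hv =>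
      ⟨f_smul_mem_lowSpan s lam l hv.1, ?_⟩
    · change el (qOf s) (.e m) • hwVec s lam ∈ lowSpan s lam
      rw [e_smul_hwVec]
      exact Submodule.zero_mem _
    · change el (qOf s) (.e m) • (el (qOf s) (.f l) • v) ∈ lowSpan s lam
      have h2 : el (qOf s) (.e m) • v ∈ lowSpan s lam := hv.2
      rw [← mul_smul]
      by_cases h : m = l
      · subst h
        rw [el_e_f_same, add_smul, mul_smul, smul_assoc, sub_smul, mul_smul, mul_smul]
        exact Submodule.add_mem _ (f_smul_mem_lowSpan s lam m h2) (Submodule.smul_mem _ _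
          (Submodule.sub_mem _
            (t_smul_mem_lowSpan s lam _ (tinv_smul_mem_lowSpan s lam _ hv.1))
            (tinv_smul_mem_lowSpan s lam _ (t_smul_mem_lowSpan s lam _ hv.1))))
      · rw [el_e_f_ne _ h, mul_smul]
        exact f_smul_mem_lowSpan s lam l h2
  exact (this hv).2

/-- The span of the f-words on v_λ is stable under every generator, since e_m and t_i can be pushed
through the f's to v_λ. This weak form of the triangular decomposition is all that is used. -/
theorem lowSpan_eq_top : lowSpan s lam = ⊤ := by
  rw [eq_top_iff]
  rintro v -
  obtain ⟨x, rfl⟩ := Submodule.Quotient.mk_surjective _ v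
  rw [mk_eq_smul_hwVec]
  refine smul_mem_of_mem_adjoin (S := Set.range (el (qOf s) (n := n))) ?_
    (by rw [adjoin_range_el]; trivial) _ (hwVec_mem_lowSpan s lam)
  rintro _ ⟨g, rfl⟩ p hp
  cases g with
  | e m => exact e_smul_mem_lowSpan s lam m hp
  | f m => exact f_smul_mem_lowSpan s lam m hp
  | t i => exact t_smul_mem_lowSpan s lam i hp
  | tinv i => exact tinv_smul_mem_lowSpan s lam i hp

variable {s}

theorem qOf_add_inv_ne_zero (hs : Irrational s) : qOf s + (qOf s)⁻¹ ≠ 0 := by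
  intro h
  have hq := qOf_ne_zero s
  have h2 : qOf s ^ 2 = -1 := by
    field_simp at h
    linear_combination h
  have h4 : qOf s ^ (4 : ℤ) = 1 := by
    have : qOf s ^ (4 : ℤ) = (qOf s ^ 2) ^ 2 := by norm_cast; ring
    rw [this, h2]
    norm_num
  exact absurd (qOf_zpow_injective hs h4) (by norm_num)

/-- The ordered monomials applied to the highest weight vector span the Verma module. -/
theorem span_pbwMono_smul_hwVec (hs : Irrational s) :
    Submodule.span ℂ (Set.range fun c : ℕ → ℕ → ℕ =>
      pbwMono (qOf s) (lowGen (qOf s) n) c (n - 1) • hwVec s lam) = ⊤ := by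
  rw [eq_top_iff, ← lowSpan_eq_top, lowSpan]
  refine (Submodule.map_mono (lowerAlg_le_span_pbwMono (serreFamily_lowGen _) (qOf_ne_zero s)
    (qOf_add_inv_ne_zero hs) (n - 1))).trans ?_
  rw [Submodule.map_span, ← Set.range_comp]
  exact le_rfl

end verma

/-! ### The Verma module is the Gelfand–Tsetlin module -/

/-- The numbers `λ_i - i`. -/
def shifted {n : ℕ} (lam : Fin n → ℝ) (i : ℕ) : ℝ :=
  if h : 1 ≤ i ∧ i ≤ n then lam ⟨i - 1, by omega⟩ - i else 0

theorem shifted_succ {n : ℕ} (lam : Fin n → ℝ) (i : Fin n) :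
    shifted lam (i.1 + 1) = lam i - (i.1 + 1 : ℕ) := by
  rw [shifted, dif_pos (by omega)]
  rfl

theorem generic_shifted {n : ℕ} {s : ℝ} (hs : Irrational s) {lam : Fin n → ℝ}
    (hlam : ∀ i j : Fin n, i ≠ j → ∀ k l : ℤ, s * (lam i - lam j + (k : ℝ)) ≠ (l : ℝ)) :
    Generic s (shifted lam) n := by
  intro i hi j hj hij k
  have hi := Finset.mem_Icc.1 hi
  have hj := Finset.mem_Icc.1 hj
  refine qnum_ne_zero hs fun l => ?_
  rw [shifted, dif_pos hi, shifted, dif_pos hj]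
  have := hlam ⟨i - 1, by omega⟩ ⟨j - 1, by omega⟩ (by simp; omega) (k - i + j) l
  convert this using 2
  push_cast
  ring

theorem wtAt_shifted {n : ℕ} (lam : Fin n → ℝ) (d : Arr) (i : Fin n) :
    wtAt (shifted lam) d (i.1 + 1) = lam i + wtExp d (i.1 + 1) := by
  rw [wtAt, shifted_succ]
  push_cast
  ring

/-! #### Weights of ordered monomials -/

section weights

variable {A : Type*} [Ring A] [Algebra ℂ A] {q : ℂ} {t : A}

/-- `t x = q ^ z x t`. -/
def QComm (q : ℂ) (t x : A) (z : ℤ) : Prop := t * x = q ^ z • (x * t)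

theorem QComm.mul (hq : q ≠ 0) {x y : A} {z w : ℤ} (hx : QComm q t x z) (hy : QComm q t y w) :
    QComm q t (x * y) (z + w) := by
  unfold QComm at *
  rw [← mul_assoc, hx, smul_mul_assoc, mul_assoc, hy, mul_smul_comm, smul_smul, zpow_add₀ hq,
    mul_assoc]

theorem QComm.sub_smul {x y : A} {z : ℤ} (hx : QComm q t x z) (hy : QComm q t y z) (c : ℂ) :
    QComm q t (x - c • y) z := by
  unfold QComm at *
  rw [mul_sub, mul_smul_comm, hx, hy, sub_mul, smul_mul_assoc, smul_sub, smul_comm c]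

theorem QComm.one : QComm q t 1 0 := by
  simp [QComm]

theorem QComm.pow (hq : q ≠ 0) {x : A} {z : ℤ} (hx : QComm q t x z) (k : ℕ) :
    QComm q t (x ^ k) (k * z) := by
  induction k with
  | zero => simpa using QComm.one
  | succ k ih =>
    rw [pow_succ]
    convert ih.mul hq hx using 1
    push_cast
    ring

theorem QComm.rootVec (hq : q ≠ 0) {f : ℕ → A} {z : ℕ → ℤ} (h : ∀ i, QComm q t (f i) (z i)) :
    ∀ l i, QComm q t (rootVec q f i l) (∑ j ∈ Finset.range (l + 1), z (i + j))
  | 0, i => by simpa [UqGl.rootVec] using h i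
  | l + 1, i => by
    have h1 := h i
    have h2 := QComm.rootVec hq h l (i + 1)
    have e : ∑ j ∈ Finset.range (l + 1 + 1), z (i + j)
        = z i + ∑ j ∈ Finset.range (l + 1), z (i + 1 + j) := by
      rw [Finset.sum_range_succ', add_zero, add_comm (z i)]
      congr 1
      exact Finset.sum_congr rfl fun j _ => by congr 1; ring
    rw [UqGl.rootVec]
    refine QComm.sub_smul ?_ ?_ q
    · rw [e]; exact h1.mul hq h2
    · rw [e, add_comm (z i)]; exact h2.mul hq h1

theorem QComm.orderedMono (hq : q ≠ 0) {g : ℕ → A} {z : ℕ → ℤ} (c : ℕ → ℕ) :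
    ∀ {i : ℕ}, (∀ l < i, QComm q t (g l) (z l)) →
      QComm q t (orderedMono g c i) (∑ l ∈ Finset.range i, c l * z l)
  | 0, _ => by simpa [UqGl.orderedMono] using QComm.one
  | i + 1, h => by
    rw [UqGl.orderedMono, Finset.sum_range_succ]
    exact (QComm.orderedMono hq c fun l hl => h l (by omega)).mul hq ((h i (by omega)).pow hq _)

theorem QComm.pbwMono (hq : q ≠ 0) {f : ℕ → A} {z : ℕ → ℕ → ℤ} (c : ℕ → ℕ → ℕ) :
    ∀ {k : ℕ}, (∀ l < k, ∀ i ≤ l, QComm q t (rootTo q f l i) (z l i)) →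
      QComm q t (pbwMono q f c k) (∑ l ∈ Finset.range k, ∑ i ∈ Finset.range (l + 1), c l i * z l i)
  | 0, _ => by simpa [UqGl.pbwMono] using QComm.one
  | k + 1, h => by
    rw [UqGl.pbwMono, Finset.sum_range_succ]
    exact (QComm.pbwMono hq c fun l hl => h l (by omega)).mul hq
      (QComm.orderedMono hq (c k) fun l hl => h k (by omega) l (by omega))

end weights

/-- The exponents of the ordered monomial that corresponds to an array. -/
def exponents (d : Arr) (k i : ℕ) : ℕ := (d (k + 1) (i + 1) - d (k + 2) (i + 1)).toNat

theorem Adm.exponents_cast {n : ℕ} {d : Arr} (hd : Adm n d) {k i : ℕ} (hk : k < n - 1)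
    (hi : i ≤ k) : (exponents d k i : ℤ) = d (k + 1) (i + 1) - d (k + 2) (i + 1) := by
  have := hd.step (k + 1) (i + 1) (by omega) (by omega) (by omega)
  rw [exponents, Int.toNat_of_nonneg]
  change d (k + 2) (i + 1) ≤ _ at this
  omega

/-- The exponents are the consecutive drops within a column, so the array is recovered by summing
them from the zero row n downwards. -/
theorem exists_adm_exponents (n : ℕ) (c : ℕ → ℕ → ℕ) :
    ∃ d, Adm n d ∧ ∀ k < n - 1, ∀ i ≤ k, exponents d k i = c k i := by
  set d : Arr := fun m i => if 1 ≤ i ∧ i ≤ m ∧ m < n then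
    ((∑ l ∈ Finset.Ico (m - 1) (n - 1), c l (i - 1) : ℕ) : ℤ) else 0 with hd
  have hstep : ∀ m i, 1 ≤ i → i ≤ m → m < n → d m i = c (m - 1) (i - 1) + d (m + 1) i := by
    intro m i h1 h2 h3
    simp only [hd]
    rw [if_pos ⟨h1, h2, h3⟩, Finset.sum_eq_sum_Ico_succ_bot (by omega)]
    split_ifs with h
    · rw [show m - 1 + 1 = m + 1 - 1 by omega]
      push_cast
      rfl
    · rw [Finset.Ico_eq_empty (by omega)]
      simp
  refine ⟨d, ⟨fun m i h => if_neg h, fun m i h1 h2 h3 => ?_⟩, fun k hk i hi => ?_⟩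
  · rw [hstep m i h1 h2 h3]
    omega
  · rw [exponents, hstep (k + 1) (i + 1) (by omega) (by omega) (by omega)]
    simp

/-- The root vector from i to k adds 1 to coordinate k + 1 and subtracts 1 from coordinate i,
counted from zero. Since exponents are drops, the first contribution is a difference of partial row
sums and the second telescopes along a column. -/
theorem sum_exponents {n : ℕ} {d : Arr} (hd : Adm n d) {j : ℕ} (hj : j < n) :
    ∑ k ∈ Finset.range (n - 1), ∑ i ∈ Finset.range (k + 1),
      (exponents d k i : ℤ) * ((if j = k + 1 then 1 else 0) - (if j = i then 1 else 0))
      = wtExp d (j + 1) := by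
  have h1 : ∀ k ∈ Finset.range (n - 1), ∀ i ∈ Finset.range (k + 1),
      (exponents d k i : ℤ) * ((if j = k + 1 then 1 else 0) - (if j = i then 1 else 0))
      = (if j = k + 1 then d j (i + 1) - d (j + 1) (i + 1) else 0)
        - (if j = i then d (k + 1) (j + 1) - d (k + 2) (j + 1) else 0) := by
    intro k hk i hi
    rw [hd.exponents_cast (by simpa using hk) (by simp at hi; omega)]
    split_ifs with a b b
    · have := Finset.mem_range.1 hi
      omega
    · subst a; simp
    · subst b; simp
    · simp
  rw [Finset.sum_congr rfl fun k hk => Finset.sum_congr rfl (h1 k hk)]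
  simp only [Finset.sum_sub_distrib]
  have hA : ∑ k ∈ Finset.range (n - 1), ∑ i ∈ Finset.range (k + 1),
      (if j = k + 1 then d j (i + 1) - d (j + 1) (i + 1) else 0)
      = ∑ i ∈ Finset.range j, (d j (i + 1) - d (j + 1) (i + 1)) := by
    rcases j with _ | j
    · simp
    · rw [Finset.sum_eq_single_of_mem j (by simp; omega)]
      · simp
      · intro k _ hk
        exact Finset.sum_eq_zero fun i _ => if_neg (by omega)
  have hB : ∑ k ∈ Finset.range (n - 1), ∑ i ∈ Finset.range (k + 1),
      (if j = i then d (k + 1) (j + 1) - d (k + 2) (j + 1) else 0) = d (j + 1) (j + 1) := by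
    have : ∀ k ∈ Finset.range (n - 1), ∑ i ∈ Finset.range (k + 1),
        (if j = i then d (k + 1) (j + 1) - d (k + 2) (j + 1) else 0)
        = if j ≤ k then d (k + 1) (j + 1) - d (k + 2) (j + 1) else 0 := by
      intro k _
      rw [Finset.sum_ite_eq]
      simp
    rw [Finset.sum_congr rfl this]
    have tele : ∀ N, j ≤ N → ∑ k ∈ Finset.range N,
        (if j ≤ k then d (k + 1) (j + 1) - d (k + 2) (j + 1) else 0)
        = d (j + 1) (j + 1) - d (N + 1) (j + 1) := by
      intro N hN
      induction N, hN using Nat.le_induction with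
      | base =>
        rw [sub_self]
        exact Finset.sum_eq_zero fun k hk => if_neg (by simp at hk; omega)
      | succ N hN ih =>
        rw [Finset.sum_range_succ, ih, if_pos hN]
        ring
    rw [tele _ (by omega), hd.outside (n - 1 + 1) (j + 1) (by omega), sub_zero]
  rw [hA, hB, wtExp, rowSum, rowSum, Nat.add_sub_cancel, Finset.sum_Icc_succ_top (by omega),
    Finset.sum_sub_distrib]
  have e : ∀ g : ℕ → ℤ, ∑ i ∈ Finset.range j, g (i + 1) = ∑ i ∈ Finset.Icc 1 j, g i := by
    intro g
    rw [Finset.range_eq_Ico, Finset.sum_Ico_add', zero_add]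
    exact Finset.sum_congr (by ext; simp) fun _ _ => rfl
  rw [e fun i => d j i, e fun i => d (j + 1) i]
  ring

theorem t_smul_pbwMono_smul_hwVec (s : ℝ) {n : ℕ} (lam : Fin n → ℝ) {d : Arr} (hd : Adm n d)
    (j : Fin n) :
    el (qOf s) (.t j) • (pbwMono (qOf s) (lowGen (qOf s) n) (exponents d) (n - 1) • hwVec s lam)
      = qpow s (wtAt (shifted lam) d (j.1 + 1)) •
        (pbwMono (qOf s) (lowGen (qOf s) n) (exponents d) (n - 1) • hwVec s lam) := by
  have hq := qOf_ne_zero s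
  have hf : ∀ i, QComm (qOf s) (el (qOf s) (.t j)) (lowGen (qOf s) n i)
      ((if j.1 = i + 1 then 1 else 0) - (if j.1 = i then 1 else 0)) := by
    intro i
    by_cases hin : i < n - 1
    · rw [lowGen_of_lt _ hin, QComm, el_t_f]
      congr 2
      simp only [pairing, lo, hi, Fin.ext_iff]
      ring
    · rw [lowGen_of_not_lt _ hin]
      simp [QComm]
  have hroot : ∀ l < n - 1, ∀ i ≤ l, QComm (qOf s) (el (qOf s) (.t j))
      (rootTo (qOf s) (lowGen (qOf s) n) l i)
      ((if j.1 = l + 1 then 1 else 0) - (if j.1 = i then 1 else 0)) := by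
    intro l _ i hi
    have h := QComm.rootVec hq hf (l - i) i
    -- The weights of the generators f_i, …, f_l telescope, leaving only the two ends of the root.
    have e := Finset.sum_range_sub (fun k => if j.1 = i + k then (1 : ℤ) else 0) (l - i + 1)
    simp only [← add_assoc, add_zero] at e
    rw [e, show i + (l - i) + 1 = l + 1 by omega] at h
    exact h
  have h := QComm.pbwMono hq (exponents d) hroot
  rw [sum_exponents hd j.2, QComm] at h
  rw [← mul_smul, h, smul_assoc, mul_smul, t_smul_hwVec, wtAt_shifted, add_comm (lam j), qpow_add,
    qpow_intCast]
  have h' := (Algebra.lsmul ℂ ℂ (Verma s lam)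
    (pbwMono (qOf s) (lowGen (qOf s) n) (exponents d) (n - 1))).map_smul (qpow s (lam j))
    (hwVec s lam)
  simp only [Algebra.lsmul_coe] at h'
  rw [h', smul_smul]

/-! #### The isomorphism -/

section iso

variable {s : ℝ} {n : ℕ} {lam : Fin n → ℝ} (hs : Irrational s)
  (hg : Generic s (shifted lam) n)

/-- The highest weight vector of the Gelfand–Tsetlin module. -/
def gtTop (n : ℕ) : GTMod n := GTMod.mk (Finsupp.single 0 1) (single_mem_admSpace (adm_zero n) 1)

/-- The action on the highest weight vector. -/
def gtOrbit : Uq (qOf s) n →ₗ[ℂ] GTMod n :=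
  (LinearMap.applyₗ (gtTop n)).comp (gtRep hs hg).toLinearMap

theorem gtOrbit_apply (x : Uq (qOf s) n) : gtOrbit hs hg x = gtRep hs hg x (gtTop n) := rfl

theorem gtOrbit_eq_zero {x : Uq (qOf s) n} (hx : x ∈ vermaIdeal s lam) :
    gtOrbit hs hg x = 0 := by
  induction hx using Submodule.span_induction with
  | zero => exact map_zero _
  | add x y _ _ hx hy => rw [map_add, hx, hy, add_zero]
  | smul a x _ hx =>
    rw [gtOrbit_apply] at hx ⊢
    rw [smul_eq_mul, map_mul, Module.End.mul_apply, hx, map_zero]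
  | mem x hx =>
    rw [gtOrbit_apply]
    rcases hx with ⟨m, rfl⟩ | ⟨i, rfl⟩
    · simp only [gtRep_el]
      refine GTMod.ext ?_
      rw [map_zero]
      exact raiseOp_top s _ _
    · rw [map_sub, gtRep_el, AlgHom.commutes, LinearMap.sub_apply, sub_eq_zero]
      refine GTMod.ext ?_
      change torusOp s (shifted lam) 1 (i.1 + 1) (Finsupp.single 0 1)
        = qpow s (lam i) • Finsupp.single 0 1
      rw [torusOp, diagOp_single, one_mul, one_mul, wtAt_shifted]
      simp [wtExp, rowSum]

/-- The homomorphism from the Verma module to the Gelfand–Tsetlin module. -/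
def vermaToGT : Verma s lam →ₗ[ℂ] GTMod n :=
  (((vermaIdeal s lam).restrictScalars ℂ).liftQ (gtOrbit hs hg)
    fun _ hx => gtOrbit_eq_zero hs hg hx).comp
    (Submodule.Quotient.restrictScalarsEquiv ℂ (vermaIdeal s lam)).symm.toLinearMap

theorem vermaToGT_mk (x : Uq (qOf s) n) :
    vermaToGT hs hg (Submodule.Quotient.mk x) = gtRep hs hg x (gtTop n) := rfl

theorem vermaToGT_smul (x : Uq (qOf s) n) (v : Verma s lam) :
    vermaToGT hs hg (x • v) = gtRep hs hg x (vermaToGT hs hg v) := by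
  obtain ⟨y, rfl⟩ := Submodule.Quotient.mk_surjective _ v
  rw [← Submodule.Quotient.mk_smul, vermaToGT_mk, vermaToGT_mk, smul_eq_mul, map_mul,
    Module.End.mul_apply]

theorem vermaToGT_el_smul (g : Gen n) (v : Verma s lam) :
    vermaToGT hs hg (el (qOf s) g • v) = gtGen s (shifted lam) n g (vermaToGT hs hg v) := by
  rw [vermaToGT_smul, gtRep_el]

theorem vermaToGT_hwVec : vermaToGT hs hg (hwVec s lam) = gtTop n := by
  rw [hwVec, vermaToGT_mk, map_one]
  rfl

theorem vermaToGT_surjective : Function.Surjective (vermaToGT hs hg) := by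
  have h : admSpace n ≤ (LinearMap.range (vermaToGT hs hg)).map GTMod.val := by
    refine admSpace_le_of_lowerOp_stable hg hs ⟨gtTop n, ⟨_, vermaToGT_hwVec hs hg⟩, rfl⟩ ?_
    rintro m h1 h2 _ ⟨_, ⟨v, rfl⟩, rfl⟩
    refine ⟨_, ⟨el (qOf s) (.f (⟨m - 1, by omega⟩ : Fin (n - 1))) • v, rfl⟩, ?_⟩
    rw [vermaToGT_el_smul]
    change lowerOp s (shifted lam) (m - 1 + 1) _ = _
    rw [Nat.sub_add_cancel h1]
    rfl
  intro w
  obtain ⟨_, ⟨v, rfl⟩, hv⟩ := h w.val_mem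
  exact ⟨v, GTMod.ext hv⟩

end iso

/-! ### From surjectivity to injectivity through finite weight blocks -/

theorem injOn_of_surjOn_finiteDimensional {V : Type*} [AddCommGroup V] [Module ℂ V]
    (W : Submodule ℂ V) [FiniteDimensional ℂ W] (T : V →ₗ[ℂ] V) (hmaps : ∀ u ∈ W, T u ∈ W)
    (hsurj : ∀ y ∈ W, ∃ x ∈ W, T x = y) {u : V} (hu : u ∈ W) (h0 : T u = 0) : u = 0 := by
  have hs : Function.Surjective (T.restrict hmaps) := by
    rintro ⟨y, hy⟩
    obtain ⟨x, hx, rfl⟩ := hsurj y hy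
    exact ⟨⟨x, hx⟩, rfl⟩
  exact congrArg Subtype.val ((injective_iff_map_eq_zero _).1
    (LinearMap.injective_iff_surjective.2 hs) ⟨u, hu⟩ (Subtype.ext h0))

/-- A surjective endomorphism that preserves finite blocks of a basis is injective. -/
theorem injective_of_surjective_of_finite_blocks {X I : Type*} (w : X → I)
    (hfin : ∀ i, {x | w x = i}.Finite) (T : (X →₀ ℂ) →ₗ[ℂ] (X →₀ ℂ))
    (hT : ∀ x y, T (Finsupp.single x 1) y ≠ 0 → w y = w x) (hsurj : Function.Surjective T) :
    Function.Injective T := by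
  classical
  have hcomm : ∀ (i : I) (v : X →₀ ℂ), T (v.filter (fun x => w x = i)) = (T v).filter (fun x => w x = i) := by
    intro i v
    induction v using Finsupp.induction_linear with
    | zero => rw [Finsupp.filter_zero, map_zero, Finsupp.filter_zero]
    | add f g hf hg => simp only [Finsupp.filter_add, map_add, hf, hg]
    | single x z =>
      have hz : Finsupp.single x z = z • Finsupp.single x (1 : ℂ) := by simp
      ext y
      rw [Finsupp.filter_apply]
      by_cases hx : w x = i
      · rw [Finsupp.filter_single_of_pos (fun x => w x = i) hx]
        split_ifs with hy
        · rfl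
        · rw [hz, map_smul, Finsupp.smul_apply, smul_eq_mul, mul_eq_zero]
          right
          by_contra hne
          exact hy ((hT x y hne).trans hx)
      · rw [Finsupp.filter_single_of_neg (fun x => w x = i) hx, map_zero, Finsupp.zero_apply]
        split_ifs with hy
        · rw [hz, map_smul, Finsupp.smul_apply, smul_eq_mul, eq_comm, mul_eq_zero]
          right
          by_contra hne
          exact hx ((hT x y hne).symm.trans hy)
        · rfl
  have hmem : ∀ (i : I) (v : X →₀ ℂ),
      v.filter (fun x => w x = i) ∈ Finsupp.supported ℂ ℂ {x | w x = i} := by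
    intro i v
    rw [Finsupp.mem_supported']
    intro x hx
    exact Finsupp.filter_apply_neg _ _ hx
  have hself : ∀ (i : I), ∀ v ∈ Finsupp.supported ℂ ℂ {x | w x = i}, v.filter (fun x => w x = i) = v := by
    intro i v hv
    rw [Finsupp.filter_eq_self_iff]
    intro x hx
    by_contra hne
    exact hx ((Finsupp.mem_supported' ℂ v).1 hv x hne)
  rw [injective_iff_map_eq_zero]
  intro v hv
  have hblock : ∀ i, v.filter (fun x => w x = i) = 0 := by
    intro i
    have : Finite {x | w x = i} := (hfin i).to_subtype
    have hfd : FiniteDimensional ℂ (Finsupp.supported ℂ ℂ {x | w x = i}) :=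
      (Finsupp.supportedEquivFinsupp (R := ℂ) (M := ℂ) {x | w x = i}).symm.finiteDimensional
    have hmaps : ∀ u ∈ Finsupp.supported ℂ ℂ {x | w x = i},
        T u ∈ Finsupp.supported ℂ ℂ {x | w x = i} := by
      intro u hu
      rw [← hself i u hu, hcomm]
      exact hmem i _
    refine injOn_of_surjOn_finiteDimensional _ T hmaps (fun y hy => ?_) (hmem i v) ?_
    · obtain ⟨x, hx⟩ := hsurj y
      exact ⟨_, hmem i x, by rw [hcomm, hx, hself i y hy]⟩
    · rw [hcomm, hv, Finsupp.filter_zero]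
  ext x
  have := DFunLike.congr_fun (hblock (w x)) x
  rwa [Finsupp.filter_apply_pos (fun y => w y = w x) v rfl] at this

/-- The admissible arrays of a given weight are finite in number. -/
theorem finite_adm_wtExp (n : ℕ) (δ : Fin n → ℤ) :
    {d : Arr | Adm n d ∧ ∀ j : Fin n, wtExp d (j.1 + 1) = δ j}.Finite := by
  set C : ℤ := ∑ j : Fin n, |δ j| with hC
  -- The weight determines all row sums. As the entries are nonnegative, each one is bounded by its
  -- row sum.
  have hsum : ∀ (d : Arr) (m : ℕ), rowSum d m = -∑ k ∈ Finset.range m, wtExp d (k + 1) := by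
    intro d m
    induction m with
    | zero => simp [rowSum]
    | succ m ih =>
      rw [Finset.sum_range_succ, neg_add, ← ih, wtExp, Nat.add_sub_cancel]
      ring
  have hbound : ∀ d : Arr, Adm n d → (∀ j : Fin n, wtExp d (j.1 + 1) = δ j) →
      ∀ m i, d m i ≤ C := by
    intro d hd hw m i
    by_cases h : 1 ≤ i ∧ i ≤ m ∧ m < n
    · have h1 : d m i ≤ rowSum d m :=
        Finset.single_le_sum (f := fun i => d m i) (fun j _ => hd.nonneg m j) (by simp; omega)
      have h2 : rowSum d m ≤ ∑ k ∈ Finset.range m, |wtExp d (k + 1)| := by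
        rw [hsum]
        exact (neg_le_abs _).trans (Finset.abs_sum_le_sum_abs _ _)
      have h3 : ∑ k ∈ Finset.range m, |wtExp d (k + 1)|
          ≤ ∑ k ∈ Finset.range n, |wtExp d (k + 1)| :=
        Finset.sum_le_sum_of_subset_of_nonneg (by simpa using h.2.2.le) fun _ _ _ => abs_nonneg _
      have h4 : ∑ k ∈ Finset.range n, |wtExp d (k + 1)| = C := by
        rw [hC, ← Fin.sum_univ_eq_sum_range (fun k => |wtExp d (k + 1)|)]
        exact Finset.sum_congr rfl fun j _ => by rw [hw j]
      omega
    · rw [hd.outside m i h]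
      exact Finset.sum_nonneg fun _ _ => abs_nonneg _
  refine Set.Finite.of_finite_image (f := fun (d : Arr) (a : Fin n) (b : Fin n) =>
    d a.1 b.1) ?_ ?_
  · refine (Set.Finite.pi' (t := fun _ : Fin n => Set.univ.pi fun _ : Fin n => Set.Icc 0 C)
      fun _ => Set.Finite.pi fun _ => Set.finite_Icc 0 C).subset ?_
    rintro _ ⟨d, ⟨hd, hw⟩, rfl⟩ a b _
    exact ⟨hd.nonneg _ _, hbound d hd hw _ _⟩
  · rintro d ⟨hd, -⟩ d' ⟨hd', -⟩ h
    funext m i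
    by_cases hmi : 1 ≤ i ∧ i ≤ m ∧ m < n
    · exact congrFun (congrFun h ⟨m, hmi.2.2⟩) ⟨i, by omega⟩
    · rw [hd.outside m i hmi, hd'.outside m i hmi]

/-- The type of admissible arrays. -/
abbrev AdmArr (n : ℕ) : Type := {d : Arr // Adm n d}

/-- Coordinates on the Gelfand–Tsetlin module. -/
def gtCoord (n : ℕ) : GTMod n ≃ₗ[ℂ] (AdmArr n →₀ ℂ) :=
  Finsupp.supportedEquivFinsupp (R := ℂ) (M := ℂ) {d | Adm n d}

theorem gtCoord_apply {n : ℕ} (v : GTMod n) (d : AdmArr n) : gtCoord n v d = v.val d.1 := rfl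

theorem diagOp_apply (c : Arr → ℂ) (v : Arr →₀ ℂ) (d : Arr) : diagOp c v d = c d * v d := by
  classical
  induction v using Finsupp.induction_linear with
  | zero => simp
  | add f g hf hg => simp only [map_add, Finsupp.add_apply, hf, hg, mul_add]
  | single e z =>
    rw [diagOp_single, Finsupp.single_apply, Finsupp.single_apply]
    split_ifs with h
    · rw [h, mul_comm]
    · simp

theorem qpow_wtAt_injective {s : ℝ} (hs : Irrational s) {n : ℕ} {lam : Fin n → ℝ} {d : Arr}
    {j : Fin n} {k : ℤ} (h : qpow s (wtAt (shifted lam) d (j.1 + 1)) = qpow s (lam j + k)) :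
    wtExp d (j.1 + 1) = k := by
  rw [wtAt_shifted, qpow_add, qpow_add, mul_right_inj' (qpow_ne_zero s _), qpow_intCast,
    qpow_intCast] at h
  have := qOf_zpow_injective hs (k := wtExp d (j.1 + 1) - k) (by
    rw [zpow_sub₀ (qOf_ne_zero s), h, div_self (zpow_ne_zero _ (qOf_ne_zero s))])
  omega

/-- Sending each array to the monomial with its exponents, then to the Gelfand–Tsetlin module, gives
a surjective endomorphism of the free space on admissible arrays. It preserves weights, whose blocks
are finite, so it is injective. As the monomials span M(λ), the second map is injective too, and
linear independence of the monomials is never assumed. -/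
theorem vermaToGT_injective {s : ℝ} {n : ℕ} {lam : Fin n → ℝ} (hs : Irrational s)
    (hg : Generic s (shifted lam) n) : Function.Injective (vermaToGT hs hg) := by
  set p : AdmArr n → Verma s lam := fun d =>
    pbwMono (qOf s) (lowGen (qOf s) n) (exponents d.1) (n - 1) • hwVec s lam with hp
  set G := Finsupp.linearCombination ℂ p with hG
  have hGsurj : Function.Surjective G := by
    rw [← LinearMap.range_eq_top, Finsupp.range_linearCombination, eq_top_iff,
      ← span_pbwMono_smul_hwVec lam hs, Submodule.span_le]
    rintro _ ⟨c, rfl⟩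
    obtain ⟨d, hd, hc⟩ := exists_adm_exponents n c
    refine Submodule.subset_span ⟨⟨d, hd⟩, ?_⟩
    simp only [hp]
    rw [pbwMono_congr fun l hl i hi => hc l hl i hi]
  set T : (AdmArr n →₀ ℂ) →ₗ[ℂ] (AdmArr n →₀ ℂ) :=
    (gtCoord n).toLinearMap.comp ((vermaToGT hs hg).comp G) with hT
  have hTsurj : Function.Surjective T :=
    (gtCoord n).surjective.comp ((vermaToGT_surjective hs hg).comp hGsurj)
  have hTinj : Function.Injective T := by
    refine injective_of_surjective_of_finite_blocks
      (fun (d : AdmArr n) (j : Fin n) => wtExp d.1 (j.1 + 1)) (fun δ => ?_) T ?_ hTsurj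
    · refine Set.Finite.of_finite_image (f := Subtype.val)
        ((finite_adm_wtExp n δ).subset ?_) Subtype.val_injective.injOn
      rintro _ ⟨d, hd, rfl⟩
      exact ⟨d.2, fun j => congrFun hd j⟩
    · intro d d' hne
      funext j
      have h1 : T (Finsupp.single d 1) = gtCoord n (vermaToGT hs hg (p d)) := by
        simp [hT, hG]
      rw [h1, gtCoord_apply] at hne
      have h2 := congrArg (fun v => (vermaToGT hs hg v).val d'.1)
        (t_smul_pbwMono_smul_hwVec s lam d.2 j)
      simp only [vermaToGT_el_smul, map_smul, Finsupp.smul_apply, smul_eq_mul] at h2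
      have h3 : qpow s (wtAt (shifted lam) d'.1 (j.1 + 1)) * (vermaToGT hs hg (p d)).val d'.1
          = qpow s (wtAt (shifted lam) d.1 (j.1 + 1)) * (vermaToGT hs hg (p d)).val d'.1 := by
        rw [← h2]
        change _ = torusOp s (shifted lam) 1 (j.1 + 1) (vermaToGT hs hg (p d)).val d'.1
        rw [torusOp, diagOp_apply, one_mul]
      have h4 := mul_right_cancel₀ hne h3
      rw [wtAt_shifted lam d.1 j] at h4
      exact qpow_wtAt_injective hs h4
  intro x y hxy
  obtain ⟨a, rfl⟩ := hGsurj x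
  obtain ⟨b, rfl⟩ := hGsurj y
  have : T a = T b := by
    simp only [hT, LinearMap.comp_apply, hxy]
  rw [hTinj this]

/-! ### Signs of norms -/

theorem sgn_mul (x y : ℝ) : sgn (x * y) = sgn x * sgn y := by
  simp only [sgn, sign_mul]
  push_cast
  rfl

theorem sgn_inv (x : ℝ) : sgn x⁻¹ = sgn x := by
  rcases lt_trichotomy x 0 with h | rfl | h
  · rw [sgn, sgn, sign_neg h, sign_neg (inv_lt_zero.2 h)]
  · simp
  · rw [sgn, sgn, sign_pos h, sign_pos (inv_pos.2 h)]

theorem sgn_div (x y : ℝ) : sgn (x / y) = sgn x * sgn y := by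
  rw [div_eq_mul_inv, sgn_mul, sgn_inv]

theorem sgn_one : sgn 1 = 1 := by simp [sgn]

theorem sgn_prod {ι : Type*} (I : Finset ι) (f : ι → ℝ) :
    sgn (∏ i ∈ I, f i) = ∏ i ∈ I, sgn (f i) := by
  classical
  induction I using Finset.induction_on with
  | empty => simpa using sgn_one
  | insert a I ha ih => rw [Finset.prod_insert ha, Finset.prod_insert ha, sgn_mul, ih]

theorem sgn_eq_one_or {x : ℝ} (hx : x ≠ 0) : sgn x = 1 ∨ sgn x = -1 := by
  rcases lt_or_gt_of_ne hx with h | h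
  · right; rw [sgn, sign_neg h]; rfl
  · left; rw [sgn, sign_pos h]; rfl

/-- Signs turn quotients into products. The denominators are reindexed by one, so that each is
grouped with the row supplying the lengths of its falling products; the last denominator is trivial
because the row with index n vanishes. -/
theorem sgn_gtNorm (s : ℝ) (L : ℕ → ℝ) {n : ℕ} {d : Arr} (hd : Adm n d) :
    sgn (gtNorm s L n d) = ∏ m ∈ Finset.Ico 1 n, ∏ i ∈ Finset.Icc 1 m,
      (sgn (∏ j ∈ Finset.Ioc i m, qnum s (pos L d m i - pos L d m j) * qnum s (L i - pos L d m j))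
        * sgn (qfall s (L i - pos L d m i) (d m i).toNat)
        * sgn (∏ j ∈ Finset.Ioc i (m + 1), qfall s (L i - pos L d (m + 1) j - 1) (d m i).toNat)
        * sgn (∏ j ∈ Finset.Ico i m, qfall s (L i - pos L d (m - 1) j) (d m i).toNat)) := by
  rcases n with _ | n
  · simpa [gtNorm] using sgn_one
  have hdown : downFactor s L d n = 1 := by
    refine Finset.prod_eq_one fun i _ => Finset.prod_eq_one fun j _ => ?_
    rw [hd.outside (n + 1) i (by omega), Int.toNat_zero, qfall_zero]
  have h0 : sgn (rowFactor s L d 0 * upFactor s L d 0) = 1 := by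
    simpa [rowFactor, upFactor] using sgn_one
  rw [gtNorm, sgn_prod]
  simp only [sgn_div]
  rw [Finset.prod_mul_distrib, Finset.prod_range_succ', h0, mul_one,
    Finset.prod_range_succ (fun m => sgn (downFactor s L d m)), hdown, sgn_one, mul_one,
    ← Finset.prod_mul_distrib, Finset.prod_Ico_eq_prod_range, Nat.add_sub_cancel]
  refine Finset.prod_congr rfl fun m _ => ?_
  rw [add_comm 1 m]
  simp only [rowFactor, upFactor, downFactor, sgn_mul, sgn_div, sgn_prod, Finset.prod_mul_distrib,
    Nat.add_sub_cancel]
  ring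

/-! ### Arrays of real numbers and of integers -/

section arrays

variable {n : ℕ} {lam : Fin n → ℝ}

theorem GTArray.ext_entry {L L' : GTArray lam} (h : L.entry = L'.entry) : L = L' := by
  cases L
  cases L'
  cases h
  rfl

/-- The array of the integers `λ_i - λ_{m,i}`. -/
def GTArray.toArr (L : GTArray lam) : Arr := fun m i =>
  if 1 ≤ i ∧ i ≤ m ∧ m < n then (L.drop m i : ℤ) else 0

theorem GTArray.exists_drop (L : GTArray lam) {m i : ℕ} (h1 : 1 ≤ i) (h2 : i ≤ m) (h3 : m ≤ n) :
    ∃ k : ℕ, L.entry n i - L.entry m i = k := by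
  induction h3 using Nat.decreasingInduction with
  | self => exact ⟨0, by simp⟩
  | of_succ m hm ih =>
    obtain ⟨a, ha⟩ := ih (by omega)
    obtain ⟨b, hb⟩ := L.step m i h1 h2 hm
    exact ⟨a + b, by push_cast; rw [← ha, ← hb]; ring⟩

theorem GTArray.drop_cast (L : GTArray lam) {m i : ℕ} (h1 : 1 ≤ i) (h2 : i ≤ m) (h3 : m ≤ n) :
    (L.drop m i : ℝ) = L.entry n i - L.entry m i := by
  obtain ⟨k, hk⟩ := L.exists_drop h1 h2 h3
  rw [GTArray.drop, hk, Nat.floor_natCast]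

theorem GTArray.toArr_toNat (L : GTArray lam) {m i : ℕ} (h1 : 1 ≤ i) (h2 : i ≤ m) (h3 : m < n) :
    (L.toArr m i).toNat = L.drop m i := by
  rw [GTArray.toArr, if_pos ⟨h1, h2, h3⟩, Int.toNat_natCast]

theorem GTArray.toArr_cast (L : GTArray lam) {m i : ℕ} (h1 : 1 ≤ i) (h2 : i ≤ m) (h3 : m ≤ n) :
    (L.toArr m i : ℝ) = L.entry n i - L.entry m i := by
  rcases h3.lt_or_eq with h | rfl
  · rw [GTArray.toArr, if_pos ⟨h1, h2, h⟩, Int.cast_natCast, L.drop_cast h1 h2 h3]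
  · rw [GTArray.toArr, if_neg (by omega), sub_self, Int.cast_zero]

theorem GTArray.top_eq (L : GTArray lam) {i : ℕ} (h1 : 1 ≤ i) (h2 : i ≤ n) :
    L.entry n i = shifted lam i + i := by
  obtain ⟨i, rfl⟩ := Nat.exists_eq_add_of_le' h1
  rw [L.top ⟨i, by omega⟩, shifted_succ lam ⟨i, by omega⟩]
  simp

theorem GTArray.pos_eq (L : GTArray lam) {m i : ℕ} (h1 : 1 ≤ i) (h2 : i ≤ m) (h3 : m ≤ n) :
    pos (shifted lam) L.toArr m i = -L.nu m i - 1 := by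
  rw [pos, GTArray.nu, L.toArr_cast h1 h2 h3, L.top_eq h1 (by omega)]
  ring

theorem GTArray.shifted_eq (L : GTArray lam) {i : ℕ} (h1 : 1 ≤ i) (h2 : i ≤ n) :
    shifted lam i = -L.nu n i - 1 := by
  rw [GTArray.nu, L.top_eq h1 h2]
  ring

theorem GTArray.adm_toArr (L : GTArray lam) : Adm n L.toArr := by
  refine ⟨fun m i h => if_neg h, fun m i h1 h2 h3 => ?_⟩
  obtain ⟨k, hk⟩ := L.step m i h1 h2 h3
  have e1 := L.toArr_cast h1 h2 h3.le
  have e2 := L.toArr_cast h1 (by omega : i ≤ m + 1) h3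
  have : (L.toArr (m + 1) i : ℝ) ≤ L.toArr m i := by
    rw [e1, e2]
    have : (0 : ℝ) ≤ k := k.cast_nonneg
    linarith
  exact_mod_cast this

/-- The position λ_{m,i} - i equals -ν_{m,i} - 1, so every difference of positions is the reversed
difference of ν's and the shifts cancel. -/
theorem GTArray.stilde_eq (s : ℝ) (L : GTArray lam) :
    stilde s L = sgn (gtNorm s (shifted lam) n L.toArr) := by
  rw [sgn_gtNorm s _ L.adm_toArr, stilde]
  refine Finset.prod_congr rfl fun m hm => Finset.prod_congr rfl fun i hi => ?_
  have hm := Finset.mem_Ico.1 hm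
  have hi := Finset.mem_Icc.1 hi
  rw [L.toArr_toNat hi.1 hi.2 hm.2, L.shifted_eq hi.1 (by omega), L.pos_eq hi.1 hi.2 hm.2.le]
  congr 1
  · congr 1
    · congr 1
      · refine congrArg sgn (Finset.prod_congr rfl fun j hj => ?_)
        have hj := Finset.mem_Ioc.1 hj
        rw [L.pos_eq (by omega) hj.2 hm.2.le]
        congr 2 <;> ring
      · congr 2; ring
    · refine congrArg sgn (Finset.prod_congr rfl fun j hj => ?_)
      have hj := Finset.mem_Ioc.1 hj
      rw [L.pos_eq (by omega) hj.2 hm.2]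
      congr 1; ring
  · refine congrArg sgn (Finset.prod_congr rfl fun j hj => ?_)
    have hj := Finset.mem_Ico.1 hj
    rw [L.pos_eq (by omega) (by omega) (by omega)]
    congr 1; ring

theorem GTArray.wt_eq (L : GTArray lam) : L.wt = shift lam fun k => wtExp L.toArr (k.1 + 1) := by
  funext k
  have h : ∀ m ≤ n, ∑ i ∈ Finset.Icc 1 m, L.entry m i
      = ∑ i ∈ Finset.Icc 1 m, L.entry n i - rowSum L.toArr m := by
    intro m hm
    rw [rowSum, Int.cast_sum, ← Finset.sum_sub_distrib]
    refine Finset.sum_congr rfl fun i hi => ?_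
    have hi := Finset.mem_Icc.1 hi
    rw [L.toArr_cast hi.1 hi.2 hm]
    ring
  rw [GTArray.wt, h _ k.2, h _ k.2.le, Finset.sum_Icc_succ_top (by omega), L.top k, shift, wtExp,
    Nat.add_sub_cancel]
  push_cast
  ring

variable (lam) in
/-- The array of real numbers that corresponds to an admissible array of integers. -/
def Adm.toGTArray {d : Arr} (hd : Adm n d) : GTArray lam where
  entry m i := if 1 ≤ i ∧ i ≤ m ∧ m ≤ n then shifted lam i + i - d m i else 0
  entry_outside m i h := if_neg h
  top i := by
    rw [if_pos (by omega), hd.outside _ _ (by omega), shifted_succ]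
    simp
  step m i h1 h2 h3 := by
    have h := hd.step m i h1 h2 h3
    refine ⟨(d m i - d (m + 1) i).toNat, ?_⟩
    rw [if_pos (by omega), if_pos (by omega)]
    have : (((d m i - d (m + 1) i).toNat : ℤ) : ℝ) = (d m i - d (m + 1) i : ℤ) := by
      rw [Int.toNat_of_nonneg (by omega)]
    rw [Int.cast_natCast] at this
    rw [this]
    push_cast
    ring

variable (lam) in
/-- Arrays of real numbers correspond to admissible arrays of integers. -/
def admEquiv : AdmArr n ≃ GTArray lam where
  toFun d := d.2.toGTArray lam
  invFun L := ⟨L.toArr, L.adm_toArr⟩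
  left_inv d := by
    refine Subtype.ext (funext fun m => funext fun i => ?_)
    by_cases h : 1 ≤ i ∧ i ≤ m ∧ m < n
    · have e := (d.2.toGTArray lam).toArr_cast h.1 h.2.1 h.2.2.le
      simp only [Adm.toGTArray] at e
      rw [if_pos (by omega), if_pos (by omega), d.2.outside n i (by omega)] at e
      have : ((d.2.toGTArray lam).toArr m i : ℝ) = d.1 m i := by
        rw [Adm.toGTArray, e]
        simp
      exact_mod_cast this
    · rw [d.2.outside m i h]
      exact if_neg h
  right_inv L := by
    refine GTArray.ext_entry (funext fun m => funext fun i => ?_)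
    by_cases h : 1 ≤ i ∧ i ≤ m ∧ m ≤ n
    · change (if _ then _ else _) = _
      rw [if_pos h, L.toArr_cast h.1 h.2.1 h.2.2, L.top_eq h.1 (by omega)]
      ring
    · rw [L.entry_outside m i h]
      exact if_neg h

theorem admEquiv_symm_val (L : GTArray lam) : ((admEquiv lam).symm L).1 = L.toArr := rfl

theorem shift_injective : Function.Injective (shift lam) := by
  intro a b h
  funext i
  have := congrFun h i
  simp only [shift, add_right_inj, Int.cast_inj] at this
  exact this

theorem GTArray.finite_wt (μ : Fin n → ℝ) : {L : GTArray lam | L.wt = μ}.Finite := by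
  by_cases h : ∃ δ, μ = shift lam δ
  · obtain ⟨δ, rfl⟩ := h
    refine Set.Finite.of_finite_image (f := GTArray.toArr)
      ((finite_adm_wtExp n δ).subset ?_) ?_
    · rintro _ ⟨L, hL, rfl⟩
      rw [Set.mem_ofPred_eq, L.wt_eq] at hL
      exact ⟨L.adm_toArr, fun j => congrFun (shift_injective hL) j⟩
    · intro L _ L' _ hLL
      exact (admEquiv lam).symm.injective (Subtype.ext hLL)
  · convert Set.finite_empty
    ext L
    simp only [Set.mem_ofPred_eq, Set.mem_empty_iff_false, iff_false]
    intro hL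
    exact h ⟨_, hL ▸ L.wt_eq⟩

theorem GTArray.stilde_eq_one_or {s : ℝ} (hs : Irrational s) (hg : Generic s (shifted lam) n)
    (L : GTArray lam) : stilde s L = 1 ∨ stilde s L = -1 := by
  rw [L.stilde_eq]
  exact sgn_eq_one_or (gtNorm_ne_zero hg hs L.adm_toArr)

end arrays

/-! ### Sylvester's law of inertia -/

section sylvester

variable {V : Type} [AddCommGroup V] [Module ℂ V] {κ κ' : Type} [Fintype κ] [Fintype κ']
  {B : SesqForm V}

theorem re_form_self (c : Module.Basis κ ℂ V) (hc : ∀ i j, i ≠ j → B (c i) (c j) = 0) (x : V) :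
    (B x x).re = ∑ i, Complex.normSq (c.equivFun x i) * (B (c i) (c i)).re := by
  have h : B x x = ∑ i, conj (c.equivFun x i) * (c.equivFun x i * B (c i) (c i)) := by
    conv_lhs => rw [← c.sum_equivFun x]
    rw [map_sum]
    refine Finset.sum_congr rfl fun i _ => ?_
    rw [map_sum, LinearMap.sum_apply, Finset.sum_eq_single i]
    · simp [mul_left_comm]
    · intro j _ hj
      simp [hc j i hj]
    · simp
  rw [h, Complex.re_sum]
  refine Finset.sum_congr rfl fun i _ => ?_
  rw [← mul_assoc, mul_comm (conj _), Complex.mul_conj, Complex.re_ofReal_mul]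

open scoped Classical in
-- Map the span of the positive vectors of `c` to the positive coordinates with respect to `c'`. On
-- a kernel vector the form is both nonnegative and nonpositive, hence zero, and positivity on the
-- span forces the vector to vanish. So the map is injective and dimensions compare.
theorem card_pos_le (c : Module.Basis κ ℂ V) (hc : ∀ i j, i ≠ j → B (c i) (c j) = 0)
    (c' : Module.Basis κ' ℂ V) (hc' : ∀ i j, i ≠ j → B (c' i) (c' j) = 0) :
    Fintype.card {i // 0 < (B (c i) (c i)).re} ≤ Fintype.card {i // 0 < (B (c' i) (c' i)).re} := by
  set F : ({i // 0 < (B (c i) (c i)).re} → ℂ) →ₗ[ℂ] ({i // 0 < (B (c' i) (c' i)).re} → ℂ) :=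
    (LinearMap.funLeft ℂ ℂ Subtype.val).comp (c'.equivFun.toLinearMap.comp
      (c.equivFun.symm.toLinearMap.comp (Function.ExtendByZero.linearMap ℂ Subtype.val))) with hF
  have hinj : Function.Injective F := by
    rw [injective_iff_map_eq_zero]
    intro a ha
    set x : V := c.equivFun.symm (Function.extend Subtype.val a 0) with hx
    have hxc : c.equivFun x = Function.extend Subtype.val a 0 := by
      rw [hx, LinearEquiv.apply_symm_apply]
    have h1 : ∀ i, 0 ≤ Complex.normSq (c.equivFun x i) * (B (c i) (c i)).re := by
      intro i
      by_cases hi : 0 < (B (c i) (c i)).re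
      · exact mul_nonneg (Complex.normSq_nonneg _) hi.le
      · rw [hxc, Function.extend_apply' _ _ _ (by rintro ⟨⟨j, hj⟩, rfl⟩; exact hi hj)]
        simp
    have h2 : (B x x).re ≤ 0 := by
      rw [re_form_self c' hc']
      refine Finset.sum_nonpos fun i _ => ?_
      by_cases hi : 0 < (B (c' i) (c' i)).re
      · have : c'.equivFun x i = 0 := congrFun ha ⟨i, hi⟩
        rw [this]
        simp
      · exact mul_nonpos_of_nonneg_of_nonpos (Complex.normSq_nonneg _) (not_lt.1 hi)
    rw [re_form_self c hc] at h2
    have h3 := (Finset.sum_eq_zero_iff_of_nonneg fun i _ => h1 i).1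
      (le_antisymm h2 (Finset.sum_nonneg fun i _ => h1 i))
    funext i
    have h4 := h3 i.1 (Finset.mem_univ _)
    rw [hxc, Subtype.val_injective.extend_apply, mul_eq_zero, Complex.normSq_eq_zero] at h4
    exact h4.resolve_right i.2.ne'
  simpa using LinearMap.finrank_le_finrank_of_injective hinj

open scoped Classical in
theorem sum_sign_eq (N : κ → ℝ) : ∑ i, (SignType.sign (N i) : ℤ)
    = Fintype.card {i // 0 < N i} - Fintype.card {i // 0 < -N i} := by
  rw [Fintype.card_subtype, Fintype.card_subtype, ← Finset.sum_boole, ← Finset.sum_boole,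
    ← Finset.sum_sub_distrib]
  refine Finset.sum_congr rfl fun i _ => ?_
  rcases lt_trichotomy (N i) 0 with h | h | h
  · rw [sign_neg h, if_neg (by linarith), if_pos (by linarith)]
    rfl
  · rw [h]
    simp
  · rw [sign_pos h, if_pos h, if_neg (by linarith)]
    rfl

/-- Applying `card_pos_le` both ways to `B` and to `-B` fixes the numbers of positive and of
negative vectors. The bases may have different index types. -/
theorem sum_sign_eq_of_orthogonal (c : Module.Basis κ ℂ V)
    (hc : ∀ i j, i ≠ j → B (c i) (c j) = 0) (c' : Module.Basis κ' ℂ V)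
    (hc' : ∀ i j, i ≠ j → B (c' i) (c' j) = 0) :
    ∑ i, (SignType.sign (B (c i) (c i)).re : ℤ) = ∑ i, (SignType.sign (B (c' i) (c' i)).re : ℤ) := by
  classical
  have h1 := le_antisymm (card_pos_le c hc c' hc') (card_pos_le c' hc' c hc)
  have hn : ∀ i j, i ≠ j → (-B) (c i) (c j) = 0 := fun i j h => by simp [hc i j h]
  have hn' : ∀ i j, i ≠ j → (-B) (c' i) (c' j) = 0 := fun i j h => by simp [hc' i j h]
  have h2 := le_antisymm (card_pos_le c hn c' hn') (card_pos_le c' hn' c hn)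
  simp only [LinearMap.neg_apply, Complex.neg_re] at h2
  rw [sum_sign_eq, sum_sign_eq, h1, h2]

theorem hasSignature_of_basis {W : Submodule ℂ V} (c : Module.Basis κ ℂ W)
    (hc : IsOrthogonalBasis B W c) :
    HasSignature B W (∑ k, (SignType.sign (B (c k : V) (c k : V)).re : ℤ)) := by
  refine ⟨c.finiteDimensional_of_finite, ⟨c.reindex (Fintype.equivFinOfCardEq
    (Module.finrank_eq_card_basis c).symm), fun i j h => ?_⟩, fun b hb => ?_⟩
  · rw [Module.Basis.reindex_apply, Module.Basis.reindex_apply]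
    exact hc _ _ fun e => h (Equiv.injective _ e)
  · exact sum_sign_eq_of_orthogonal (B := B.domRestrict₁₂ W W) b hb c hc

/-- A basis of the span of a part of a basis. -/
def spanImageBasis {ι : Type} (b : Module.Basis ι ℂ V) (S : Set ι) :
    Module.Basis S ℂ (Submodule.span ℂ (b '' S)) :=
  (Module.Basis.span (b.linearIndependent.comp (Subtype.val : S → ι) Subtype.val_injective)).map
    (LinearEquiv.ofEq _ _ (by rw [Set.range_comp, Subtype.range_coe]))

theorem spanImageBasis_apply {ι : Type} (b : Module.Basis ι ℂ V) (S : Set ι) (i : S) :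
    (spanImageBasis b S i : V) = b i := by
  rw [spanImageBasis, Module.Basis.map_apply, LinearEquiv.coe_ofEq_apply, Module.Basis.span_apply]
  rfl

/-- A basis that is partitioned into blocks decomposes the space into the spans of the blocks. -/
theorem isInternal_span_image {ι I : Type} [DecidableEq I] (b : Module.Basis ι ℂ V) (w : ι → I) :
    DirectSum.IsInternal fun i : I => Submodule.span ℂ (b '' {x | w x = i}) := by
  rw [DirectSum.isInternal_submodule_iff_iSupIndep_and_iSup_eq_top]
  constructor
  · intro i
    simp only [← Submodule.span_iUnion, ← Set.image_iUnion]
    refine b.linearIndependent.disjoint_span_image (Set.disjoint_left.2 fun x hx hx' => ?_)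
    simp only [Set.mem_iUnion] at hx'
    obtain ⟨j, hj, hx'⟩ := hx'
    exact hj (hx'.symm.trans hx)
  · rw [← Submodule.span_iUnion, ← Set.image_iUnion, eq_top_iff, ← b.span_eq]
    refine Submodule.span_mono ?_
    rintro _ ⟨x, rfl⟩
    exact ⟨x, Set.mem_iUnion.2 ⟨w x, rfl⟩, rfl⟩

end sylvester

/-! ### The standard form -/

section form

variable {s : ℝ} {n : ℕ} {lam : Fin n → ℝ}

theorem IsStandardForm.adjoint_f_e {B : SesqForm (Verma s lam)} (hB : IsStandardForm s lam B)
    (m : Fin (n - 1)) (v w : Verma s lam) :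
    B (el (qOf s) (.f m) • v) w = B v (el (qOf s) (.e m) • w) := by
  rw [hB.hermitian w, ← hB.adjoint_e_f, ← hB.hermitian]

/-- Pairing v_λ with f_m v gives zero because e_m kills v_λ, so the pairing with v_λ is determined
by its norm. An f in the first argument moves to the second as an e, and the f-words on v_λ span. -/
theorem IsStandardForm.unique {B B' : SesqForm (Verma s lam)} (hB : IsStandardForm s lam B)
    (hB' : IsStandardForm s lam B') : B' = B := by
  have key : ∀ {P : Submodule ℂ (Verma s lam)}, hwVec s lam ∈ P →
      (∀ (m : Fin (n - 1)), ∀ v ∈ P, el (qOf s) (.f m) • v ∈ P) → ∀ v, v ∈ P := fun h0 h v =>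
    lowSpan_le s lam h0 h (by rw [lowSpan_eq_top]; exact Submodule.mem_top)
  have h1 : ∀ w, B' (hwVec s lam) w = B (hwVec s lam) w := by
    intro w
    have := key (P := LinearMap.ker (B' (hwVec s lam) - B (hwVec s lam))) ?_ ?_ w
    · rwa [LinearMap.mem_ker, LinearMap.sub_apply, sub_eq_zero] at this
    · rw [LinearMap.mem_ker, LinearMap.sub_apply, hB.norm_hwVec, hB'.norm_hwVec, sub_self]
    · intro m v _
      rw [LinearMap.mem_ker, LinearMap.sub_apply, ← hB.adjoint_e_f, ← hB'.adjoint_e_f,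
        e_smul_hwVec]
      simp
  refine LinearMap.ext fun v => ?_
  have := key (P := LinearMap.ker (B' - B)) ?_ ?_ v
  · rwa [LinearMap.mem_ker, LinearMap.sub_apply, sub_eq_zero] at this
  · rw [LinearMap.mem_ker, LinearMap.sub_apply, sub_eq_zero]
    exact LinearMap.ext h1
  · intro m v hv
    rw [LinearMap.mem_ker, LinearMap.sub_apply, sub_eq_zero] at hv ⊢
    refine LinearMap.ext fun w => ?_
    rw [hB.adjoint_f_e, hB'.adjoint_f_e, hv]

variable (hs : Irrational s) (hg : Generic s (shifted lam) n)

/-- The standard form on the Verma module. -/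
def vermaForm : SesqForm (Verma s lam) :=
  LinearMap.mk₂'ₛₗ (starRingEnd ℂ) (RingHom.id ℂ)
    (fun v w => gtForm s (shifted lam) n (vermaToGT hs hg v) (vermaToGT hs hg w))
    (fun _ _ _ => by simp) (fun _ _ _ => by simp) (fun _ _ _ => by simp) (fun _ _ _ => by simp)

theorem vermaForm_apply (v w : Verma s lam) : vermaForm hs hg v w
    = gtForm s (shifted lam) n (vermaToGT hs hg v) (vermaToGT hs hg w) := rfl

theorem isStandardForm_vermaForm : IsStandardForm s lam (vermaForm hs hg) where
  hermitian v w := diagForm_hermitian _ _ _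
  adjoint_e_f m v w := by
    rw [vermaForm_apply, vermaForm_apply, vermaToGT_el_smul, vermaToGT_el_smul, gtForm_e_f hs hg]
  adjoint_t i v w := by
    rw [vermaForm_apply, vermaForm_apply, vermaToGT_el_smul, vermaToGT_el_smul, gtForm_t]
  norm_hwVec := by
    rw [vermaForm_apply, vermaToGT_hwVec]
    change diagForm _ (Finsupp.single 0 1) (Finsupp.single 0 1) = 1
    rw [diagForm_single_single, gtNorm_zero hg]
    simp

theorem isNondegenerate_vermaForm : IsNondegenerate (vermaForm hs hg) := by
  intro v h
  refine vermaToGT_injective hs hg ?_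
  rw [map_zero]
  refine gtForm_nondegenerate hs hg _ fun w => ?_
  obtain ⟨w, rfl⟩ := vermaToGT_surjective hs hg w
  exact h w

/-- The orthogonal basis of the Verma module. -/
def gtBasis : Module.Basis (GTArray lam) ℂ (Verma s lam) :=
  (Module.Basis.ofRepr ((LinearEquiv.ofBijective (vermaToGT hs hg)
    ⟨vermaToGT_injective hs hg, vermaToGT_surjective hs hg⟩).trans (gtCoord n))).reindex
    (admEquiv lam)

theorem gtBasis_repr_apply (v : Verma s lam) (L : GTArray lam) :
    (gtBasis hs hg).repr v L = (vermaToGT hs hg v).val L.toArr := by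
  rw [gtBasis, Module.Basis.repr_reindex_apply]
  rfl

open scoped Classical in
theorem vermaToGT_gtBasis_val (L : GTArray lam) :
    (vermaToGT hs hg (gtBasis hs hg L)).val = Finsupp.single L.toArr 1 := by
  ext d
  by_cases hd : Adm n d
  · have h := gtBasis_repr_apply hs hg (gtBasis hs hg L) (admEquiv lam ⟨d, hd⟩)
    have e : (admEquiv lam ⟨d, hd⟩).toArr = d := by
      rw [← admEquiv_symm_val, Equiv.symm_apply_apply]
    rw [e, Module.Basis.repr_self] at h
    rw [← h, Finsupp.single_apply, Finsupp.single_apply]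
    congr 1
    rw [← Equiv.symm_apply_eq, Subtype.ext_iff, admEquiv_symm_val]
  · rw [Finsupp.single_apply, if_neg (by rintro rfl; exact hd L.adm_toArr)]
    exact (Finsupp.mem_supported' ℂ _).1 (GTMod.val_mem _) d hd

theorem vermaForm_gtBasis_self (L : GTArray lam) :
    vermaForm hs hg (gtBasis hs hg L) (gtBasis hs hg L) = gtNorm s (shifted lam) n L.toArr := by
  rw [vermaForm_apply, gtForm_apply, vermaToGT_gtBasis_val, diagForm_single_single]
  simp

theorem vermaForm_gtBasis_of_ne {L L' : GTArray lam} (h : L ≠ L') :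
    vermaForm hs hg (gtBasis hs hg L) (gtBasis hs hg L') = 0 := by
  rw [vermaForm_apply, gtForm_apply, vermaToGT_gtBasis_val, vermaToGT_gtBasis_val,
    diagForm_single_single, if_neg]
  exact fun e => h ((admEquiv lam).symm.injective (Subtype.ext e))

/-- The t_i are diagonal in the array basis, and within the coset λ + ℤ^n their eigenvalues
determine the weight because q is not a root of unity. -/
theorem weightSpace_eq_span (δ : Fin n → ℤ) : weightSpace s lam (shift lam δ)
    = Submodule.span ℂ (gtBasis hs hg '' {L | L.wt = shift lam δ}) := by
  have ht : ∀ (i : Fin n) (v : Verma s lam) (L : GTArray lam),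
      (gtBasis hs hg).repr (el (qOf s) (.t i) • v) L
        = qpow s (wtAt (shifted lam) L.toArr (i.1 + 1)) * (gtBasis hs hg).repr v L := by
    intro i v L
    rw [gtBasis_repr_apply, gtBasis_repr_apply, vermaToGT_el_smul]
    change torusOp s (shifted lam) 1 (i.1 + 1) (vermaToGT hs hg v).val L.toArr = _
    rw [torusOp, diagOp_apply, one_mul]
  ext v
  rw [Module.Basis.mem_span_image, weightSpace, Submodule.mem_iInf]
  simp only [Module.End.mem_eigenspace_iff, Algebra.lsmul_coe]
  constructor
  · intro h L hL
    rw [Set.mem_ofPred_eq, L.wt_eq]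
    congr 1
    funext i
    have h1 := DFunLike.congr_fun (congrArg (gtBasis hs hg).repr (h i)) L
    rw [ht, map_smul, Finsupp.smul_apply, smul_eq_mul] at h1
    exact qpow_wtAt_injective hs (mul_right_cancel₀ (Finsupp.mem_support_iff.1 hL) h1)
  · intro h i
    refine (gtBasis hs hg).repr.injective (Finsupp.ext fun L => ?_)
    rw [ht, map_smul, Finsupp.smul_apply, smul_eq_mul]
    by_cases hL : (gtBasis hs hg).repr v L = 0
    · rw [hL, mul_zero, mul_zero]
    · have h1 : L.wt = shift lam δ := h (Finsupp.mem_support_iff.2 hL)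
      rw [← h1, L.wt_eq, wtAt_shifted, shift]

theorem hasSignatureCharacter_vermaForm :
    HasSignatureCharacter s lam (vermaForm hs hg) (arraySum s lam) where
  decomposition := by
    have h := isInternal_span_image (gtBasis hs hg)
      fun L (k : Fin n) => wtExp L.toArr (k.1 + 1)
    have e : (fun δ : Fin n → ℤ => weightSpace s lam (shift lam δ)) = fun δ =>
        Submodule.span ℂ (gtBasis hs hg '' {L | (fun k => wtExp L.toArr (k.1 + 1)) = δ}) := by
      funext δ
      rw [weightSpace_eq_span hs hg]
      simp only [GTArray.wt_eq, shift_injective.eq_iff]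
    rw [e]
    exact h
  signature δ := by
    rw [weightSpace_eq_span hs hg]
    have : Fintype {L : GTArray lam // L.wt = shift lam δ} := (GTArray.finite_wt _).fintype
    convert hasSignature_of_basis (spanImageBasis (gtBasis hs hg) {L | L.wt = shift lam δ}) ?_
      using 1
    · rw [arraySum, ← finsum_subtype_eq_finsum_cond, finsum_eq_sum_of_fintype]
      refine Finset.sum_congr rfl fun L _ => ?_
      rw [spanImageBasis_apply, vermaForm_gtBasis_self, Complex.ofReal_re, GTArray.stilde_eq, sgn]
    · intro L L' h
      rw [spanImageBasis_apply, spanImageBasis_apply]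
      exact vermaForm_gtBasis_of_ne hs hg fun e => h (Subtype.ext e)
  support μ h := by
    rw [arraySum, ← finsum_subtype_eq_finsum_cond]
    have : IsEmpty {L : GTArray lam // L.wt = μ} := ⟨fun L => h _ (L.2 ▸ L.1.wt_eq)⟩
    exact finsum_of_isEmpty _

end form

end UqGl

end

/-! ### The signature character -/

theorem mainTheorem3 (n : ℕ) (s : ℝ) (hs_pos : 0 < s) (hs_lt : s < 2) (hs : Irrational s)
    (lam : Fin n → ℝ)
    (hlam : ∀ i j : Fin n, i ≠ j → ∀ k l : ℤ, s * (lam i - lam j + (k : ℝ)) ≠ (l : ℝ)) :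
    (∀ L : UqGl.GTArray lam, UqGl.stilde s L = 1 ∨ UqGl.stilde s L = -1) ∧
    (∀ μ : Fin n → ℝ, {L : UqGl.GTArray lam | L.wt = μ}.Finite) ∧
    ∃ B : UqGl.SesqForm (UqGl.Verma s lam),
      UqGl.IsStandardForm s lam B ∧
      UqGl.IsNondegenerate B ∧
      (∀ B' : UqGl.SesqForm (UqGl.Verma s lam), UqGl.IsStandardForm s lam B' → B' = B) ∧
      UqGl.HasSignatureCharacter s lam B (UqGl.arraySum s lam) := by
  have hg := UqGl.generic_shifted hs hlam
  refine ⟨UqGl.GTArray.stilde_eq_one_or hs hg, UqGl.GTArray.finite_wt, UqGl.vermaForm hs hg,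
    UqGl.isStandardForm_vermaForm hs hg, UqGl.isNondegenerate_vermaForm hs hg, fun _ hB' => ?_,
    UqGl.hasSignatureCharacter_vermaForm hs hg⟩
  exact (UqGl.isStandardForm_vermaForm hs hg).unique hB'
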